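/- **Theorem (Approximate Sparsitron).** Let $\sigma:\mathbb R\to[0,1]$ be non-decreasing and $1$-Lipschitz, let $N\ge 1$, $\lambda\ge 0$ and $\epsilon,\delta\in(0,1)$. Let $\mathcal D$ be a probability distribution on $[-1,1]^N\times\{0,1\}$ such that $\mathbb E[Y\mid X]=\sigma(w\cdot X)$ for $(X,Y)\sim\mathcal D$, where $w\in\mathbb R^N$, and let $\varepsilon(v)=\mathbb E_{(X,Y)\sim\mathcal D}\big[(\sigma(v\cdot X)-\sigma(w\cdot X))^2\big]$ be the risk of $v\in\mathbb R^N$. *The algorithm.* Input: a first training set $(x^{(t)},y^{(t)})$, $t=1,\dots,T$, a second training set $(a^{(m)},b^{(m)})$, $m=1,\dots,M$, and parameters $\sigma,\lambda,\epsilon,\delta'$ and $\beta$. In dimension $n$ (that is, for feature vectors in $\mathbb R^n$) it starts with $w^{(1)}=(1/n,\dots,1/n)$. In round $t$ it computes $p^{(t)}=w^{(t)}/\|w^{(t)}\|_1$, the loss $l^{(t)}=\frac12\big(\vec 1+(\sigma(\lambda p^{(t)}\cdot x^{(t)})-y^{(t)})x^{(t)}\big)$ and the weights $w^{(t+1)}_j=w^{(t)}_j\beta^{l^{(t)}_j}$.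 It prepares a data structure for sampling indices $j$ with probability $p^{(t)}_j$. For each $m$ it estimates $p^{(t)}\cdot a^{(m)}$ to accuracy $\epsilon/(16\lambda)$ with success probability $1-\delta'/(MT)$ by a number $z^{(t,m)}$, the median of $\lceil 6\log (MT/\delta')\rceil$ means of $\max(1,\lceil \frac92(16\lambda/\epsilon)^2\rceil)$ samples $a^{(m)}_j$, $j\sim p^{(t)}$. It then computes the approximate empirical risk $\frac1M\sum_{m}(\sigma(\lambda z^{(t,m)})-b^{(m)})^2$. The output is $\lambda p^{(t')}$ for the (first) round $t'$ with the smallest approximate empirical risk. The parameters are set to $\beta=1-\sqrt{\log n/T}$ and $\delta'=\delta/3$. There are universal constants $C,C'>0$ and $k\in\mathbb N$ such that the following holds. Call $(T,M)$ *admissible in dimension $n$* if $T>\log n$ (so that $\beta>0$), $T\ge C\lambda^2\log(n/(\delta\epsilon))/\epsilon^2$ and $M\ge C\log(T/\delta)/\epsilon^2$. 1. (Number of samples.) There are $T,M$, admissible in both dimensions $N$ and $2N+1$, with $M\le C'\log(2T/\delta)/\epsilon^2$ and with both $T$ and $T+M$ at most $C'\max(1,\lambda)^2\log(2N/(\delta\epsilon))/\epsilon^2$.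 2. (Learning.) If $w\ge 0$, $\|w\|_1=\lambda$ and $(T,M)$ is admissible in dimension $N$, then the algorithm, run on $T+M$ independent samples of $\mathcal D$, outputs a vector $v$ with $\varepsilon(v)\le\epsilon$ with probability at least $1-\delta$ over the samples and its internal randomness. If only $\|w\|_1\le\lambda$ and $(T,M)$ is admissible in dimension $2N+1$, the same holds for the algorithm run in dimension $n=2N+1$ on the features $(x,-x,0)$, with $v_j=u_j-u_{N+j}$ computed from its output $u$. 3. (Run time.) On a randomized real RAM (unit-cost arithmetic, powers, logarithm, rounding up, comparison, array access, index operations, evaluation of $\sigma$, random numbers), for all $T\ge1$, all $M$ and all training sets, both versions take at most $C'\log^k\!\big(2+N+T+M+\lambda+\tfrac1\epsilon+\tfrac1\delta\big)\cdot T\Big(N+\frac{M\max(1,\lambda)^4\max(1,\log\frac1\delta)}{\epsilon^2}\Big)$ steps. For $\lambda\ge1$ and $\delta\le 1/e$ this is $\tilde O\big(T(N+\frac{M\lambda^4}{\epsilon^2}\log\frac1\delta)\big)$, where $\tilde O$ hides factors polylogarithmic in any of the variables. 4. (Online.) Both versions can be run online: the state (weights, best approximate empirical risk so far, corresponding vector)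 after $t+1$ rounds is obtained from the state after $t$ rounds by one update that uses only the $(t+1)$-st example of the first training set (and the second training set). For $T\ge1$, each update costs at most the bound in 3 divided by $T$. -/

import Mathlib

open MeasureTheory
open scoped ENNReal NNReal

noncomputable section

namespace Sparsitron

/-! ### A randomized real RAM

A computation is represented by the joint law of its result and of the number of instructions that
it has executed.  The only source of cost is `RAM.exec`, which executes one instruction of the list
`Instr` and adds one to the step count. -/

/-- The instructions of the machine, indexed by the type of the value they return. -/
inductive Instr : Type → Type
  /-- arithmetic on real registers -/
  | add (a b : ℝ) : Instr ℝ
  | sub (a b : ℝ) : Instr ℝ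
  | mul (a b : ℝ) : Instr ℝ
  | div (a b : ℝ) : Instr ℝ
  | pow (a b : ℝ) : Instr ℝ
  | log (a : ℝ) : Instr ℝ
  | ceil (a : ℝ) : Instr ℕ
  /-- comparison of two real registers -/
  | less (a b : ℝ) : Instr Bool
  /-- one evaluation of the activation function -/
  | call (f : ℝ → ℝ) (z : ℝ) : Instr ℝ
  /-- load one real number from the input -/
  | load (a : ℝ) : Instr ℝ
  /-- read one cell of an array -/
  | read {n : ℕ} (A : Fin n → ℝ) (i : Fin n) : Instr ℝ
  /-- overwrite one cell of an array -/
  | write {n : ℕ} (A : Fin n → ℝ) (i : Fin n) (a : ℝ) : Instr (Fin n → ℝ)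
  /-- one operation on integer words: increment, halving, comparison or jump -/
  | index : Instr Unit
  /-- draw a uniform random number of `[0,1]` and test whether it is below `p` -/
  | coin (p : ℝ) : Instr Bool

open Classical in
/-- The law of the value that an instruction returns. -/
def Instr.eval {α : Type} : Instr α → PMF α
  | .add a b => PMF.pure (a + b)
  | .sub a b => PMF.pure (a - b)
  | .mul a b => PMF.pure (a * b)
  | .div a b => PMF.pure (a / b)
  | .pow a b => PMF.pure (a ^ b)
  | .log a => PMF.pure (Real.log a)
  | .ceil a => PMF.pure ⌈a⌉₊
  | .less a b => PMF.pure (decide (a < b))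
  | .call f z => PMF.pure (f z)
  | .load a => PMF.pure a
  | .read A i => PMF.pure (A i)
  | .write A i a => PMF.pure (Function.update A i a)
  | .index => PMF.pure ()
  | .coin p => PMF.ofFintype
      (fun b => cond b (ENNReal.ofReal (min p 1)) (1 - ENNReal.ofReal (min p 1))) (by
        simp [add_tsub_cancel_of_le])

/-- A randomized computation with result in `α`, given by the joint law of the result and of the
number of executed instructions. -/
@[ext]
structure RAM (α : Type) : Type where
  law : PMF (α × ℕ)

namespace RAM

instance : Monad RAM where
  pure a := ⟨PMF.pure (a, 0)⟩
  bind c f := ⟨c.law.bind fun r => (f r.1).law.map fun s => (s.1, r.2 + s.2)⟩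

/-- Execute one instruction, at cost one. -/
def exec {α : Type} (i : Instr α) : RAM α := ⟨i.eval.map fun a => (a, 1)⟩

/-- `for i = 0, …, n - 1 do s ← body i s`; every iteration is charged one extra instruction. -/
def loop {s : Type} : (n : ℕ) → (Fin n → s → RAM s) → s → RAM s
  | 0, _, st => pure st
  | n + 1, body, st => do
      let st' ← loop n (fun i => body i.castSucc) st
      exec .index
      body (Fin.last n) st'

end RAM

open RAM

/-! ### Vector subroutines -/

/-- `w / ‖w‖₁` for an array of nonnegative weights. -/
def normalizeWeights {n : ℕ} (w : Fin n → ℝ) : RAM (Fin n → ℝ) := do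
  let s ← loop n (fun j s => do
    let a ← exec (.read w j)
    exec (.add s a)) 0
  loop n (fun j p => do
    let a ← exec (.read w j)
    let b ← exec (.div a s)
    exec (.write p j b)) (fun _ => 0)

/-- The inner product of an array with a vector that is given by query access. -/
def innerProduct {n : ℕ} (p : Fin n → ℝ) (query : Fin n → RAM ℝ) : RAM ℝ :=
  loop n (fun j s => do
    let a ← exec (.read p j)
    let b ← query j
    let c ← exec (.mul a b)
    exec (.add s c)) 0

/-- The vector `c • p`. -/
def scale {n : ℕ} (c : ℝ) (p : Fin n → ℝ) : RAM (Fin n → ℝ) :=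
  loop n (fun j v => do
    let a ← exec (.read p j)
    let b ← exec (.mul c a)
    exec (.write v j b)) (fun _ => 0)

/-- Multiplicative update `w ⊙ β ^ l` for the loss vector `l = (1 + g x) / 2`. -/
def updateWeights {n : ℕ} (beta g : ℝ) (query : Fin n → RAM ℝ) (w : Fin n → ℝ) :
    RAM (Fin n → ℝ) :=
  loop n (fun j w => do
    let x ← query j
    let a ← exec (.mul g x)
    let b ← exec (.add 1 a)
    let l ← exec (.div b 2)
    let c ← exec (.pow beta l)
    let d ← exec (.read w j)
    let e ← exec (.mul d c)
    exec (.write w j e)) w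

/-! ### Sampling from a probability vector and estimation of inner products -/

/-- The data structure for sampling from `p`: the array of partial sums `S i = ∑ j < i, p j`. -/
def prepareSampling {n : ℕ} (p : Fin n → ℝ) : RAM (Fin (n + 1) → ℝ) := do
  let S₀ ← exec (.write (fun _ => 0) 0 0)
  let r ← loop n (fun j (r : (Fin (n + 1) → ℝ) × ℝ) => do
    let a ← exec (.read p j)
    let c ← exec (.add r.2 a)
    let S ← exec (.write r.1 j.succ c)
    pure (S, c)) (S₀, 0)
  pure r.1

/-- Sample an index of `{lo, …, hi - 1}` with probability proportional to `p`, by bisection: go to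
the left half with the conditional probability of that half. -/
def sampleRange {n : ℕ} (S : Fin (n + 1) → ℝ) (lo hi : ℕ) (hlo : lo < hi) (hhi : hi ≤ n) :
    RAM (Fin n) :=
  if h : hi = lo + 1 then do
    exec .index
    pure ⟨lo, by omega⟩
  else do
    exec .index
    exec .index
    exec .index
    let a ← exec (.read S ⟨lo, by omega⟩)
    let b ← exec (.read S ⟨(lo + hi) / 2, by omega⟩)
    let c ← exec (.read S ⟨hi, by omega⟩)
    let left ← exec (.sub b a)
    let all ← exec (.sub c a)
    let q ← exec (.div left all)
    let goLeft ← exec (.coin q)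
    if goLeft then sampleRange S lo ((lo + hi) / 2) (by omega) (by omega)
    else sampleRange S ((lo + hi) / 2) hi (by omega) hhi
termination_by hi - lo

/-- One sample `j` with probability `p j`. -/
def sampleIndex {n : ℕ} [NeZero n] (S : Fin (n + 1) → ℝ) : RAM (Fin n) :=
  sampleRange S 0 n (Nat.pos_of_neZero n) le_rfl

/-- The mean of the values `x j` over `q` independent samples `j ∼ p`. -/
def sampleMean {n : ℕ} [NeZero n] (S : Fin (n + 1) → ℝ) (query : Fin n → RAM ℝ) (q : ℕ) :
    RAM ℝ := do
  let s ← loop q (fun _ s => do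
    let j ← sampleIndex S
    let a ← query j
    exec (.add s a)) 0
  exec (.div s q)

/-- A median of the entries of an array: an entry `a` such that at most half of the entries are
`< a` and at least half of the entries are `≤ a`. -/
def median {K : ℕ} (Z : Fin K → ℝ) : RAM ℝ :=
  loop K (fun i cur => do
    let a ← exec (.read Z i)
    let c ← loop K (fun k (c : ℕ × ℕ) => do
      let b ← exec (.read Z k)
      let isLt ← exec (.less b a)
      let isGt ← exec (.less a b)
      exec .index
      exec .index
      pure (if isLt then c.1 + 1 else c.1, if isGt then c.2 else c.2 + 1)) (0, 0)
    exec .index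
    exec .index
    pure (if 2 * c.1 ≤ K ∧ K ≤ 2 * c.2 then a else cur)) 0

/-- Estimate of `p · x`: the median of `K` means of `q` samples each. -/
def estimateInner {n : ℕ} [NeZero n] (S : Fin (n + 1) → ℝ) (query : Fin n → RAM ℝ) (K q : ℕ) :
    RAM ℝ := do
  let Z ← loop K (fun i (Z : Fin K → ℝ) => do
    let z ← sampleMean S query q
    exec (.write Z i z)) (fun _ => 0)
  median Z

/-! ### The approximate Sparsitron -/

/-- The parameters of the algorithm. -/
structure Params where
  /-- the activation function `σ` -/
  act : ℝ → ℝ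
  /-- the bound `λ` on the `ℓ₁`-norm -/
  lam : ℝ
  /-- the accuracy `ε` -/
  eps : ℝ
  /-- the confidence parameter `δ` -/
  delta : ℝ
  /-- the update parameter `β` -/
  beta : ℝ

/-- A labelled example `(x, y)`. -/
abbrev Example (N : ℕ) : Type := (Fin N → ℝ) × ℝ

/-- The number `⌈6 log (1 / (δ / (M T)))⌉` of repetitions, for success probability
`1 - δ / (M T)` of one estimate. -/
def repetitions (P : Params) (T M : ℕ) : RAM ℕ := do
  let a ← exec (.mul M T)
  let b ← exec (.div a P.delta)
  let c ← exec (.log b)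
  let d ← exec (.mul 6 c)
  exec (.ceil d)

/-- The number `⌈9 / (2 η ^ 2)⌉` (and at least one) of samples in one mean, for the accuracy
`η = ε / (16 λ)` of one estimate. -/
def batchSize (P : Params) : RAM ℕ := do
  let a ← exec (.mul 16 P.lam)
  let b ← exec (.div a P.eps)
  let c ← exec (.mul b b)
  let d ← exec (.mul (9 / 2) c)
  let q ← exec (.ceil d)
  exec .index
  pure (max 1 q)

/-- What the algorithm stores between two rounds: the weights `w`, and (after the first round) the
smallest approximate empirical risk so far together with the vector `λ p` that attains it. -/
structure State (n : ℕ) where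
  weights : Fin n → ℝ
  best : Option (ℝ × (Fin n → ℝ))

/-- The initial state, with the weights `1 / n`. -/
def initState (n : ℕ) : RAM (State n) := do
  let c ← exec (.div 1 n)
  let w ← loop n (fun j w => exec (.write w j c)) (fun _ => 0)
  pure ⟨w, none⟩

/-- The approximate empirical risk `(1/M) ∑ m, (σ (λ z m) - b m) ^ 2` on the second training set,
where `z m` is an estimate of `p · a m` by sampling from `p`. -/
def approxRisk {N n M : ℕ} [NeZero n] (access : (Fin N → ℝ) → Fin n → RAM ℝ) (P : Params)
    (T : ℕ) (test : Fin M → Example N) (p : Fin n → ℝ) : RAM ℝ := do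
  let S ← prepareSampling p
  let K ← repetitions P T M
  let q ← batchSize P
  let total ← loop M (fun m s => do
    let z ← estimateInner S (access (test m).1) K q
    let u ← exec (.mul P.lam z)
    let o ← exec (.call P.act u)
    let b ← exec (.load (test m).2)
    let d ← exec (.sub o b)
    let d2 ← exec (.mul d d)
    exec (.add s d2)) 0
  exec (.div total M)

/-- One round of the algorithm, on the example `ex` of the first training set.  The learner works
in dimension `n` and reads the coordinates of the feature vectors through `access`. -/
def oneRound {N n M : ℕ} [NeZero n] (access : (Fin N → ℝ) → Fin n → RAM ℝ) (P : Params) (T : ℕ)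
    (test : Fin M → Example N) (ex : Example N) (st : State n) : RAM (State n) := do
  let p ← normalizeWeights st.weights
  let h ← innerProduct p (access ex.1)
  let u ← exec (.mul P.lam h)
  let o ← exec (.call P.act u)
  let y ← exec (.load ex.2)
  let g ← exec (.sub o y)
  let w ← updateWeights P.beta g (access ex.1) st.weights
  let risk ← approxRisk access P T test p
  exec .index
  let better ← match st.best with
    | none => pure true
    | some b => exec (.less risk b.1)
  if better then do
    let v ← scale P.lam p
    pure ⟨w, some (risk, v)⟩
  else pure ⟨w, st.best⟩

/-- The state after the rounds on the examples `train 0, …, train (t - 1)`.  The number `T` is the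
planned number of rounds. -/
def stateAfter {N n M : ℕ} [NeZero n] (access : (Fin N → ℝ) → Fin n → RAM ℝ) (P : Params)
    (T : ℕ) (test : Fin M → Example N) {t : ℕ} (train : Fin t → Example N) : RAM (State n) := do
  let s ← initState n
  loop t (fun i st => oneRound access P T test (train i) st) s

/-- The algorithm: `T` rounds, then output the stored vector. -/
def learn {N n T M : ℕ} [NeZero n] (access : (Fin N → ℝ) → Fin n → RAM ℝ) (P : Params)
    (train : Fin T → Example N) (test : Fin M → Example N) : RAM (Fin n → ℝ) := do
  let s ← stateAfter access P T test train
  exec .index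
  match s.best with
    | none => pure (fun _ => 0)
    | some b => pure b.2

/-- Direct query access to the coordinates of a feature vector. -/
def plainAccess {N : ℕ} (x : Fin N → ℝ) (j : Fin N) : RAM ℝ := exec (.read x j)

/-- Query access to the coordinates of the vector `(x, -x, 0)`. -/
def signedAccess {N : ℕ} (x : Fin N → ℝ) (j : Fin (2 * N + 1)) : RAM ℝ := do
  exec .index
  exec .index
  if h : j.val < N then exec (.read x ⟨j.val, h⟩)
  else if h' : j.val < 2 * N then do
    exec .index
    let a ← exec (.read x ⟨j.val - N, by omega⟩)
    exec (.sub 0 a)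
  else pure 0

/-- The approximate Sparsitron; it outputs a vector `λ p` with `p` a probability vector. -/
def sparsitron {N T M : ℕ} [NeZero N] (P : Params) (train : Fin T → Example N)
    (test : Fin M → Example N) : RAM (Fin N → ℝ) :=
  learn plainAccess P train test

/-- The approximate Sparsitron for weight vectors of arbitrary signs and of `ℓ₁`-norm at most `λ`:
run the algorithm on the features `(x, -x, 0)`, in dimension `2 N + 1`, and return
`v j = u j - u (N + j)` for its output `u`. -/
def sparsitronSigned {N T M : ℕ} (P : Params) (train : Fin T → Example N)
    (test : Fin M → Example N) : RAM (Fin N → ℝ) := do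
  let u ← learn (n := 2 * N + 1) signedAccess P train test
  loop N (fun j v => do
    exec .index
    let a ← exec (.read u ⟨j.val, by omega⟩)
    let b ← exec (.read u ⟨N + j.val, by omega⟩)
    let c ← exec (.sub a b)
    exec (.write v j c)) (fun _ => 0)

/-- The parameters for `T` rounds in dimension `n` with overall failure probability `δ`:
`β = 1 - √(log n / T)`, and a third of the failure probability goes to the estimates. -/
def parameters (act : ℝ → ℝ) (lam eps delta : ℝ) (n T : ℕ) : Params where
  act := act
  lam := lam
  eps := eps
  delta := delta / 3
  beta := 1 - Real.sqrt (Real.log n / T)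

/-! ### The learning problem -/

/-- `D` is a distribution on `[-1,1]^N × {0,1}` with `E[Y | X] = σ (w · X)`. -/
structure IsGLM {N : ℕ} (act : ℝ → ℝ) (w : Fin N → ℝ) (D : Measure (Example N)) : Prop where
  isProbabilityMeasure : IsProbabilityMeasure D
  features_mem : ∀ᵐ s ∂D, ∀ j, s.1 j ∈ Set.Icc (-1 : ℝ) 1
  label_mem : ∀ᵐ s ∂D, s.2 = 0 ∨ s.2 = 1
  condExp_eq : D[fun s => s.2 | MeasurableSpace.comap Prod.fst inferInstance] =ᵐ[D]
    fun s => act (w ⬝ᵥ s.1)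

/-- The risk `E (σ (v · X) - σ (w · X)) ^ 2`. -/
def risk {N : ℕ} (act : ℝ → ℝ) (w : Fin N → ℝ) (D : Measure (Example N)) (v : Fin N → ℝ) : ℝ :=
  ∫ s, (act (v ⬝ᵥ s.1) - act (w ⬝ᵥ s.1)) ^ 2 ∂D

/-- The probability, over `T + M` independent samples of `D` and the internal randomness of the
algorithm, that the output lies in `good`. -/
def successProb {N : ℕ} (D : Measure (Example N)) (T M : ℕ)
    (alg : (Fin T → Example N) → (Fin M → Example N) → RAM (Fin N → ℝ))
    (good : Set (Fin N → ℝ)) : ℝ≥0∞ :=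
  ∫⁻ s, (alg s.1 s.2).law.toOuterMeasure {r | r.1 ∈ good}
    ∂((Measure.pi fun _ : Fin T => D).prod (Measure.pi fun _ : Fin M => D))

/-- Sizes of the two training sets that suffice in dimension `n`, up to the constant `C`; the
condition `log n < T` says that `β = 1 - √(log n / T)` is positive. -/
def SampleSizes (C : ℝ) (n : ℕ) (lam eps delta : ℝ) (T M : ℕ) : Prop :=
  Real.log n < T ∧
  C * lam ^ 2 * Real.log (n / (delta * eps)) / eps ^ 2 ≤ T ∧
  C * Real.log (T / delta) / eps ^ 2 ≤ M

/-- `c` takes at most `b` steps, whatever its random choices are. -/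
def StepsLE {α : Type} (c : RAM α) (b : ℝ) : Prop := ∀ r ∈ c.law.support, (r.2 : ℝ) ≤ b

/-- `C (log (all parameters))^k`, the factor hidden in the soft-O. -/
def polylog (C : ℝ) (k N T M : ℕ) (lam eps delta : ℝ) : ℝ :=
  C * Real.log (2 + N + T + M + lam + 1 / eps + 1 / delta) ^ k

/-- `N + M λ⁴ log (1/δ) / ε²`, where `λ` and `log (1/δ)` are replaced by `1` if they are smaller. -/
def roundCost (N M : ℕ) (lam eps delta : ℝ) : ℝ :=
  N + M * max 1 lam ^ 4 * max 1 (Real.log (1 / delta)) / eps ^ 2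

end Sparsitron

end

open Sparsitron

/-! The learner is the multiplicative weights method with the `n` coordinates as experts. Write the
target as `w = λ q` with a probability vector `q`, and let `u = λ p` be the current candidate. The
constant part of the loss `l` cancels between `p` and `q`, so `2 λ (p · l - q · l)` equals the
excess `(σ(u · x) - y)(u · x - w · x)` (`excess_eq`), and the regret bound says that the excesses of
all rounds sum to at most `6 λ √(T log n)` (`prefixSum_excess_le`). In expectation `y` may be
replaced by `σ(w · x)`; since `σ` is monotone and 1-Lipschitz, the expected excess dominates the
risk (`FeatureModel.featRisk_le_integral_excess`). Azuma's inequality relates expected to observed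
excesses, so the average risk over the rounds is `O(λ √(log(n/(δε)) / T))` and some round has risk
at most `ε/2` (`measure_not_exists_good_le`).

It remains to find such a round. The weights ignore the risk estimates, so the candidates depend on
the first training set only. The second set is independent of them, and Hoeffding with a union bound
makes all empirical risks accurate to `ε/16` (`measure_exists_bad_estimate_le`); their means differ
from the risks by a common constant (`FeatureModel.integral_sqLoss`). Sampling adds an error of at
most `ε/8` per empirical risk: Chebyshev controls one mean, an exponential moment of the number of
bad means controls the median (`failProb_estimateInner_le`), and Lipschitz continuity passes this on
to the risk (`failProb_approxRisk_le`). The output has risk at most `ε/2 + 2 ε/8 + 2 ε/16 < ε`. If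
`n = 1` or `λ ≤ ε/2`, the sample bound may be too weak for this argument, but then every candidate
is good. Weights of arbitrary sign reduce to nonnegative ones by splitting into positive and
negative parts, with the feature `0` taking the unused mass.

Programs are analysed with two tools: `Ensures` gives bounds on cost and result that hold for all
random choices, and `failProb`, defined through `expect`, carries the union bounds. The run time
follows because the number of means and the depth of the bisection are logarithmic and a mean uses
`O(max(1, λ)² / ε²)` samples (`oneRoundCost_le`). -/

namespace Sparsitron

open RAM

/-! ### Reasoning about computations -/

section Logic

variable {α β : Type}

namespace RAM

/-- The expectation of a nonnegative function of the result of a computation. -/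
noncomputable def expect (c : RAM α) (g : α → ℝ≥0∞) : ℝ≥0∞ := ∑' r, c.law r * g r.1

/-- Whatever the random choices are, `c` takes at most `b` steps and its result satisfies `P`. -/
def Ensures (c : RAM α) (b : ℕ) (P : α → Prop) : Prop := ∀ r ∈ c.law.support, r.2 ≤ b ∧ P r.1

theorem pure_law (a : α) : (pure a : RAM α).law = PMF.pure (a, 0) := rfl

theorem bind_law (c : RAM α) (f : α → RAM β) :
    (c >>= f).law = c.law.bind fun r => (f r.1).law.map fun s => (s.1, r.2 + s.2) := rfl

/-- Step counts are part of the law, so this rests on associativity of their addition. It serves to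
unroll the last round in `stateAfter_succ`. -/
theorem bind_assoc {γ : Type} (c : RAM α) (f : α → RAM β) (g : β → RAM γ) :
    (c >>= f) >>= g = c >>= fun a => f a >>= g := by
  apply RAM.ext
  simp only [bind_law, PMF.map_bind, PMF.bind_bind, PMF.bind_map, PMF.map_comp]
  congr 1
  funext r
  congr 1
  funext s
  simp only [Function.comp_apply]
  congr 1
  funext t
  simp [Nat.add_assoc]

theorem tsum_bind_mul (p : PMF α) (f : α → PMF β) (g : β → ℝ≥0∞) :
    ∑' b, p.bind f b * g b = ∑' a, p a * ∑' b, f a b * g b := by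
  simp only [PMF.bind_apply, ← ENNReal.tsum_mul_right, ← ENNReal.tsum_mul_left]
  rw [ENNReal.tsum_comm]
  simp only [mul_assoc]

theorem tsum_pure_mul (a : α) (g : α → ℝ≥0∞) : ∑' b, PMF.pure a b * g b = g a := by
  rw [tsum_eq_single a]
  · simp
  · intro b hb
    simp [PMF.pure_apply, hb]

theorem tsum_map_mul (p : PMF α) (f : α → β) (g : β → ℝ≥0∞) :
    ∑' b, p.map f b * g b = ∑' a, p a * g (f a) := by
  rw [← PMF.bind_pure_comp, tsum_bind_mul]
  simp only [Function.comp_apply, tsum_pure_mul]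

@[simp]
theorem expect_pure (a : α) (g : α → ℝ≥0∞) : expect (pure a) g = g a := by
  simp [expect, pure_law]

@[simp]
theorem expect_bind (c : RAM α) (f : α → RAM β) (g : β → ℝ≥0∞) :
    expect (c >>= f) g = expect c fun a => expect (f a) g := by
  simp only [expect, bind_law]
  rw [tsum_bind_mul _ _ fun r : β × ℕ => g r.1]
  simp only [tsum_map_mul _ _ fun r : β × ℕ => g r.1]

theorem expect_exec (i : Instr α) (g : α → ℝ≥0∞) :
    expect (exec i) g = ∑' a, i.eval a * g a := by
  simp only [expect, exec]
  rw [tsum_map_mul _ _ fun r : α × ℕ => g r.1]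

theorem expect_mono {c : RAM α} {g h : α → ℝ≥0∞} (hgh : ∀ a, g a ≤ h a) :
    expect c g ≤ expect c h :=
  ENNReal.tsum_le_tsum fun r => mul_le_mul_right (hgh r.1) _

theorem expect_const (c : RAM α) (x : ℝ≥0∞) : expect c (fun _ => x) = x := by
  simp [expect, ENNReal.tsum_mul_right, PMF.tsum_coe]

theorem expect_add (c : RAM α) (g h : α → ℝ≥0∞) :
    expect c (fun a => g a + h a) = expect c g + expect c h := by
  simp [expect, mul_add, ENNReal.tsum_add]

theorem expect_const_mul (c : RAM α) (x : ℝ≥0∞) (g : α → ℝ≥0∞) :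
    expect c (fun a => x * g a) = x * expect c g := by
  simp only [expect, ← ENNReal.tsum_mul_left]
  exact tsum_congr fun r => by ring

/-- Results that violate `P` lie outside the support and carry no mass. -/
theorem Ensures.expect_le {c : RAM α} {b : ℕ} {P : α → Prop} (hc : Ensures c b P)
    {g : α → ℝ≥0∞} {x : ℝ≥0∞} (hg : ∀ a, P a → g a ≤ x) : expect c g ≤ x := by
  calc expect c g ≤ ∑' r, c.law r * x := by
        refine ENNReal.tsum_le_tsum fun r => ?_
        by_cases hr : r ∈ c.law.support
        · exact mul_le_mul_right (hg _ (hc r hr).2) _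
        · simp [(PMF.apply_eq_zero_iff _ _).2 hr]
    _ = x := by rw [ENNReal.tsum_mul_right, PMF.tsum_coe, one_mul]

theorem Ensures.mono {c : RAM α} {b b' : ℕ} {P Q : α → Prop} (hc : Ensures c b P) (hb : b ≤ b')
    (hPQ : ∀ a, P a → Q a) : Ensures c b' Q :=
  fun r hr => ⟨(hc r hr).1.trans hb, hPQ _ (hc r hr).2⟩

theorem ensures_pure {a : α} {P : α → Prop} (h : P a) : Ensures (pure a) 0 P := by
  intro r hr
  rw [pure_law, PMF.mem_support_pure_iff] at hr
  subst hr
  exact ⟨le_rfl, h⟩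

theorem Ensures.bind {c : RAM α} {f : α → RAM β} {b b' : ℕ} {P : α → Prop} {Q : β → Prop}
    (hc : Ensures c b P) (hf : ∀ a, P a → Ensures (f a) b' Q) : Ensures (c >>= f) (b + b') Q := by
  intro r hr
  rw [bind_law, PMF.mem_support_bind_iff] at hr
  obtain ⟨s, hs, hr⟩ := hr
  rw [PMF.mem_support_map_iff] at hr
  obtain ⟨t, ht, rfl⟩ := hr
  have h1 := hc s hs
  have h2 := hf s.1 h1.2 t ht
  exact ⟨add_le_add h1.1 h2.1, h2.2⟩

theorem ensures_exec (i : Instr α) : Ensures (exec i) 1 fun a => a ∈ i.eval.support := by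
  intro r hr
  rw [exec, PMF.mem_support_map_iff] at hr
  obtain ⟨a, ha, rfl⟩ := hr
  exact ⟨le_rfl, ha⟩

theorem ensures_exec_pure {i : Instr α} {a : α} (hi : i.eval = PMF.pure a) :
    Ensures (exec i) 1 fun x => x = a := by
  refine (ensures_exec i).mono le_rfl fun x hx => ?_
  rwa [hi, PMF.mem_support_pure_iff] at hx

theorem ensures_exec_of {i : Instr α} {a : α} (hi : i.eval = PMF.pure a) {Q : α → Prop}
    (h : Q a) : Ensures (exec i) 1 Q :=
  (ensures_exec_pure hi).mono le_rfl fun _ hx => hx ▸ h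

/-- A computation that starts with a deterministic instruction. -/
theorem Ensures.exec_bind {i : Instr α} {a : α} (hi : i.eval = PMF.pure a) {f : α → RAM β}
    {b : ℕ} {Q : β → Prop} (hf : Ensures (f a) b Q) : Ensures (exec i >>= f) (b + 1) Q := by
  rw [add_comm]
  exact (ensures_exec_pure hi).bind fun x hx => hx ▸ hf

theorem expect_exec_pure {i : Instr α} {a : α} (hi : i.eval = PMF.pure a) (g : α → ℝ≥0∞) :
    expect (exec i) g = g a := by
  rw [expect_exec, hi, tsum_pure_mul]

/-- Loop rule: an invariant `I`, and a bound for the cost of every iteration. -/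
theorem ensures_loop {s : Type} {n : ℕ} {body : Fin n → s → RAM s} {st : s} {b : ℕ}
    (I : ℕ → s → Prop) (h0 : I 0 st)
    (hbody : ∀ (i : Fin n) st, I i st → Ensures (body i st) b (I (i + 1))) :
    Ensures (loop n body st) (n * (b + 1)) (I n) := by
  induction n with
  | zero => simpa [loop] using ensures_pure h0
  | succ n ih =>
    have h1 := ih (body := fun i => body i.castSucc) fun i st hi => hbody i.castSucc st hi
    have h2 : ∀ st', I n st' → Ensures (do exec .index; body (Fin.last n) st') (b + 1)
        (I (n + 1)) := fun st' h' => Ensures.exec_bind rfl (hbody (Fin.last n) st' h')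
    exact (h1.bind h2).mono (le_of_eq (by ring)) fun _ h => h

/-- Loop rule for the expectation of a potential that grows by a factor in every iteration. -/
theorem expect_loop_mul_le {s : Type} {n : ℕ} {body : Fin n → s → RAM s} {st : s}
    (Φ : ℕ → s → ℝ≥0∞) (x : ℝ≥0∞)
    (hbody : ∀ (i : Fin n) st, expect (body i st) (Φ (i + 1)) ≤ x * Φ i st) :
    expect (loop n body st) (Φ n) ≤ x ^ n * Φ 0 st := by
  induction n with
  | zero => simp [loop]
  | succ n ih =>
    have h1 := ih (body := fun i => body i.castSucc) fun i st => hbody i.castSucc st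
    simp only [loop, expect_bind, expect_exec_pure (i := .index) rfl]
    calc _ ≤ expect (loop n (fun i => body i.castSucc) st) fun st' => x * Φ n st' :=
          RAM.expect_mono fun st' => hbody (Fin.last n) st'
      _ ≤ x * (x ^ n * Φ 0 st) := by
          rw [expect_const_mul]
          exact mul_le_mul_right h1 _
      _ = _ := by ring

/-- Loop rule for the expectation of a potential that grows by a summand in every iteration. -/
theorem expect_loop_add_le {s : Type} {n : ℕ} {body : Fin n → s → RAM s} {st : s}
    (Φ : ℕ → s → ℝ≥0∞) (x : ℝ≥0∞)
    (hbody : ∀ (i : Fin n) st, expect (body i st) (Φ (i + 1)) ≤ Φ i st + x) :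
    expect (loop n body st) (Φ n) ≤ Φ 0 st + n * x := by
  induction n with
  | zero => simp [loop]
  | succ n ih =>
    have h1 := ih (body := fun i => body i.castSucc) fun i st => hbody i.castSucc st
    simp only [loop, expect_bind, expect_exec_pure (i := .index) rfl]
    calc _ ≤ expect (loop n (fun i => body i.castSucc) st) fun st' => Φ n st' + x :=
          RAM.expect_mono fun st' => hbody (Fin.last n) st'
      _ ≤ (Φ 0 st + n * x) + x := by
          rw [expect_add, expect_const]
          gcongr
      _ = _ := by push_cast; ring

open Classical in
/-- The probability that the result of a computation violates `P`. -/
noncomputable def failProb (c : RAM α) (P : α → Prop) : ℝ≥0∞ :=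
  expect c fun a => if P a then 0 else 1

theorem failProb_le_one (c : RAM α) (P : α → Prop) : failProb c P ≤ 1 := by
  classical
  rw [← expect_const c 1]
  refine RAM.expect_mono fun a => ?_
  split_ifs <;> simp

theorem failProb_pure {a : α} {P : α → Prop} (h : P a) : failProb (pure a) P = 0 := by
  simp [failProb, h]

theorem Ensures.failProb_eq_zero {c : RAM α} {b : ℕ} {P : α → Prop} (h : Ensures c b P) :
    failProb c P = 0 :=
  le_antisymm (h.expect_le fun a ha => by simp [ha]) bot_le

theorem failProb_mono {c : RAM α} {P Q : α → Prop} (h : ∀ a, P a → Q a) :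
    failProb c Q ≤ failProb c P := by
  classical
  refine RAM.expect_mono fun a => ?_
  by_cases hP : P a
  · simp [hP, h a hP]
  · simp only [hP, if_false]
    split_ifs <;> simp

/-- Union bound for two stages: after a failed first stage, the second is charged at most one. With
`x = 0` it passes a failure bound through a continuation that succeeds whenever `P` holds. -/
theorem failProb_bind_le {c : RAM α} {f : α → RAM β} {P : α → Prop} {Q : β → Prop} {x : ℝ≥0∞}
    (hf : ∀ a, P a → failProb (f a) Q ≤ x) : failProb (c >>= f) Q ≤ failProb c P + x := by
  classical
  rw [failProb, expect_bind]
  calc _ ≤ expect c fun a => (if P a then 0 else 1) + x := by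
        refine RAM.expect_mono fun a => ?_
        by_cases hP : P a
        · rw [if_pos hP, zero_add]
          exact hf a hP
        · simp only [hP, if_false]
          exact (failProb_le_one (f a) Q).trans le_self_add
    _ = _ := by rw [expect_add, expect_const, failProb]

theorem Ensures.failProb_bind_le {c : RAM α} {f : α → RAM β} {b : ℕ} {P : α → Prop}
    {Q : β → Prop} {x : ℝ≥0∞} (hc : Ensures c b P) (hf : ∀ a, P a → failProb (f a) Q ≤ x) :
    failProb (c >>= f) Q ≤ x := by
  simpa [hc.failProb_eq_zero] using RAM.failProb_bind_le (c := c) hf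

theorem failProb_exec_bind {i : Instr α} {a : α} (hi : i.eval = PMF.pure a) {f : α → RAM β}
    {Q : β → Prop} : failProb (exec i >>= f) Q = failProb (f a) Q := by
  rw [failProb, expect_bind, expect_exec_pure hi, failProb]

/-- Union bound over the iterations of a loop. -/
theorem failProb_loop_le {s : Type} {n : ℕ} {body : Fin n → s → RAM s} {st : s}
    (I : ℕ → s → Prop) (h0 : I 0 st) (x : ℝ≥0∞)
    (hbody : ∀ (i : Fin n) st, I i st → failProb (body i st) (I (i + 1)) ≤ x) :
    failProb (loop n body st) (I n) ≤ n * x := by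
  classical
  -- The potential is the indicator of a broken invariant; once it is one, a further iteration
  -- cannot increase it.
  refine (expect_loop_add_le (fun i a => if I i a then 0 else 1) x fun i st => ?_).trans
    (by simp [h0])
  by_cases hI : I i st
  · rw [if_pos hI, zero_add]
    exact hbody i st hI
  · simp only [hI, if_false]
    exact (failProb_le_one _ _).trans le_self_add

/-- The indicators of success and failure add up to one. This is the passage from `failProb` to the
outer measure in `successProb`. -/
theorem one_sub_failProb_le (c : RAM α) (S : Set α) :
    1 - failProb c (fun a => a ∈ S) ≤ c.law.toOuterMeasure {r | r.1 ∈ S} := by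
  classical
  rw [tsub_le_iff_right, PMF.toOuterMeasure_apply, failProb, expect, ← ENNReal.tsum_add,
    ← c.law.tsum_coe]
  refine ENNReal.tsum_le_tsum fun r => ?_
  by_cases h : r.1 ∈ S <;> simp [Set.indicator, h]

theorem Ensures.stepsLE {c : RAM α} {b : ℕ} {P : α → Prop} (h : Ensures c b P) {x : ℝ}
    (hx : (b : ℝ) ≤ x) : StepsLE c x :=
  fun r hr => le_trans (by exact_mod_cast (h r hr).1) hx

end RAM

end Logic

/-! ### The deterministic subroutines -/

section Subroutines

variable {n : ℕ}

/-- The sum of the first `i` entries of an array. -/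
def partialSum (f : Fin n → ℝ) (i : ℕ) : ℝ := ∑ j with j.val < i, f j

theorem filter_lt_succ (i : Fin n) :
    (Finset.univ.filter fun j : Fin n => j.val < i.val + 1) =
      insert i (Finset.univ.filter fun j : Fin n => j.val < i.val) := by
  ext j
  simp only [Finset.mem_filter, Finset.mem_univ, true_and, Finset.mem_insert, Fin.ext_iff]
  omega

@[simp]
theorem partialSum_zero (f : Fin n → ℝ) : partialSum f 0 = 0 := by simp [partialSum]

theorem partialSum_succ (f : Fin n → ℝ) (i : Fin n) :
    partialSum f (i + 1) = partialSum f i + f i := by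
  rw [partialSum, filter_lt_succ, Finset.sum_insert (by simp), add_comm, partialSum]

@[simp]
theorem partialSum_self (f : Fin n → ℝ) : partialSum f n = ∑ j, f j := by simp [partialSum]

/-- `query` gives access to the entries of `x`, at cost at most `a`. -/
def Reads (query : Fin n → RAM ℝ) (a : ℕ) (x : Fin n → ℝ) : Prop :=
  ∀ j, Ensures (query j) a fun y => y = x j

/-- A loop that fills an array cell by cell. -/
theorem ensures_loop_write {body : Fin n → (Fin n → ℝ) → RAM (Fin n → ℝ)} {A₀ f : Fin n → ℝ}
    {b : ℕ} (hbody : ∀ j A, A j = A₀ j → Ensures (body j A) b fun A' => A' = Function.update A j (f j)) :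
    Ensures (loop n body A₀) (n * (b + 1)) fun A => A = f := by
  -- The invariant also records that later cells are untouched, because `updateWeights` works in
  -- place and reads cell `j` before overwriting it.
  refine (ensures_loop (fun i A => ∀ j : Fin n, A j = if j.val < i then f j else A₀ j)
    (by simp) fun i A hA => ?_).mono le_rfl fun A hA => ?_
  · refine (hbody i A (by simp [hA])).mono le_rfl ?_
    rintro _ rfl j
    by_cases hj : j = i
    · subst hj; simp
    · have hij : (j.val < i.val + 1) ↔ j.val < i.val := by
        have : j.val ≠ i.val := fun h => hj (Fin.ext h)
        omega
      simp [Function.update_of_ne hj, hA, hij]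
  · funext j
    simp [hA]

theorem ensures_normalizeWeights (w : Fin n → ℝ) :
    Ensures (normalizeWeights w) (7 * n) fun p => p = fun j => w j / ∑ i, w i := by
  refine (Ensures.bind (b := n * 3) (b' := n * 4) (P := fun s => s = ∑ i, w i) ?_ ?_).mono
    (by omega) fun _ h => h
  · rw [← partialSum_self]
    refine ensures_loop (fun i s => s = partialSum w i) (by simp) ?_
    rintro i _ rfl
    refine Ensures.exec_bind rfl (ensures_exec_of rfl ?_)
    rw [partialSum_succ]
  · rintro _ rfl
    refine ensures_loop_write fun j A _ => ?_
    exact Ensures.exec_bind rfl (Ensures.exec_bind rfl (ensures_exec_of rfl rfl))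

theorem ensures_innerProduct (p : Fin n → ℝ) {query : Fin n → RAM ℝ} {a : ℕ} {x : Fin n → ℝ}
    (hq : Reads query a x) :
    Ensures (innerProduct p query) (n * (a + 4)) fun s => s = p ⬝ᵥ x := by
  rw [dotProduct, ← partialSum_self]
  refine ensures_loop (b := a + 3) (fun i s => s = partialSum (fun j => p j * x j) i)
    (by simp) ?_
  rintro i _ rfl
  refine Ensures.exec_bind rfl ((hq i).bind ?_)
  rintro _ rfl
  refine Ensures.exec_bind rfl (ensures_exec_of rfl ?_)
  rw [partialSum_succ]

theorem ensures_scale (c : ℝ) (p : Fin n → ℝ) :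
    Ensures (scale c p) (4 * n) fun v => v = c • p := by
  rw [mul_comm]
  refine ensures_loop_write fun j A _ => ?_
  exact Ensures.exec_bind rfl (Ensures.exec_bind rfl (ensures_exec_of rfl rfl))

theorem ensures_updateWeights (beta g : ℝ) {query : Fin n → RAM ℝ} {a : ℕ} {x : Fin n → ℝ}
    (hq : Reads query a x) (w : Fin n → ℝ) :
    Ensures (updateWeights beta g query w) (n * (a + 8)) fun w' =>
      w' = fun j => w j * beta ^ ((1 + g * x j) / 2) := by
  refine ensures_loop_write (b := a + 7) fun j A hA => (hq j).bind ?_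
  rintro _ rfl
  iterate 6 refine Ensures.exec_bind rfl ?_
  refine ensures_exec_of rfl ?_
  rw [hA]

theorem ensures_prepareSampling (p : Fin n → ℝ) :
    Ensures (prepareSampling p) (4 * n + 1) fun S => ∀ i, S i = partialSum p i := by
  refine Ensures.exec_bind (b := 4 * n) rfl ?_
  refine (Ensures.bind (b := n * 4) (b' := 0) (ensures_loop
    (fun k (r : (Fin (n + 1) → ℝ) × ℝ) =>
      (∀ i : Fin (n + 1), i.val ≤ k → r.1 i = partialSum p i) ∧ r.2 = partialSum p k)
    ?_ ?_) ?_).mono (by omega) fun _ h => h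
  · refine ⟨fun i hi => ?_, by simp⟩
    have : i = 0 := Fin.ext (by simpa using hi)
    subst this
    simp
  · rintro i ⟨S, c⟩ ⟨hS, rfl⟩
    iterate 3 refine Ensures.exec_bind (b := _) rfl ?_
    refine ensures_pure ⟨fun k hk => ?_, ?_⟩
    · by_cases hki : k = i.succ
      · subst hki
        simp [partialSum_succ]
      · have : k.val ≠ i.val + 1 := fun h => hki (Fin.ext (by simpa using h))
        simp only [Function.update_of_ne hki]
        exact hS k (by omega)
    · simp [partialSum_succ]
  · rintro r ⟨hr, -⟩
    exact ensures_pure fun i => hr i (by omega)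

theorem ensures_initState (n : ℕ) :
    Ensures (initState n) (2 * n + 1) fun s => s = ⟨fun _ => 1 / n, none⟩ := by
  refine Ensures.exec_bind (b := 2 * n) rfl ?_
  refine (Ensures.bind (b := n * 2) (b' := 0) (P := fun w => w = fun _ => 1 / (n : ℝ))
    ?_ ?_).mono (by omega) fun _ h => h
  · exact ensures_loop_write fun j A _ => ensures_exec_of rfl rfl
  · rintro _ rfl
    exact ensures_pure rfl

end Subroutines

/-! ### Sampling -/

section Sampling

variable {n : ℕ}

theorem expect_index (g : Unit → ℝ≥0∞) : expect (exec .index) g = g () := expect_exec_pure rfl g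

theorem expect_read (A : Fin n → ℝ) (i : Fin n) (g : ℝ → ℝ≥0∞) :
    expect (exec (.read A i)) g = g (A i) := expect_exec_pure rfl g

theorem expect_write (A : Fin n → ℝ) (i : Fin n) (a : ℝ) (g : (Fin n → ℝ) → ℝ≥0∞) :
    expect (exec (.write A i a)) g = g (Function.update A i a) := expect_exec_pure rfl g

theorem expect_exec_add (a b : ℝ) (g : ℝ → ℝ≥0∞) : expect (exec (.add a b)) g = g (a + b) :=
  expect_exec_pure rfl g

theorem expect_exec_sub (a b : ℝ) (g : ℝ → ℝ≥0∞) : expect (exec (.sub a b)) g = g (a - b) :=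
  expect_exec_pure rfl g

theorem expect_div (a b : ℝ) (g : ℝ → ℝ≥0∞) : expect (exec (.div a b)) g = g (a / b) :=
  expect_exec_pure rfl g

theorem expect_coin (q : ℝ) (g : Bool → ℝ≥0∞) :
    expect (exec (.coin q)) g =
      ENNReal.ofReal (min q 1) * g true + (1 - ENNReal.ofReal (min q 1)) * g false := by
  rw [expect_exec, tsum_bool]
  simp [Instr.eval, add_comm]

/-- A level of the bisection costs ten instructions, and both parts of a range of length at most `2
^ (d + 1)` have length at most `2 ^ d`, also when rounding makes them unequal. -/
theorem ensures_sampleRange (S : Fin (n + 1) → ℝ) (d : ℕ) :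
    ∀ (lo hi : ℕ) (hlo : lo < hi) (hhi : hi ≤ n), hi - lo ≤ 2 ^ d →
      Ensures (sampleRange S lo hi hlo hhi) (10 * d + 1) fun _ => True := by
  induction d with
  | zero =>
    intro lo hi hlo hhi h
    have h' : hi = lo + 1 := by simp at h; omega
    rw [sampleRange, dif_pos h']
    exact Ensures.exec_bind rfl (ensures_pure trivial)
  | succ d ih =>
    intro lo hi hlo hhi h
    rw [pow_succ] at h
    rw [sampleRange]
    split_ifs with h'
    · refine Ensures.mono (b := 1) (P := fun _ => True) ?_ (by omega) fun _ h => h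
      exact Ensures.exec_bind rfl (ensures_pure trivial)
    · rw [show 10 * (d + 1) + 1 = (1 + (10 * d + 1)) + 9 by ring]
      iterate 9 refine Ensures.exec_bind rfl ?_
      refine (ensures_exec _).bind fun b _ => ?_
      cases b
      · exact ih _ _ _ _ (by omega)
      · exact ih _ _ _ _ (by omega)

theorem partialSum_add (p : Fin n → ℝ) {lo hi : ℕ} (h : lo ≤ hi) :
    partialSum p hi = partialSum p lo + ∑ j with lo ≤ j.val ∧ j.val < hi, p j := by
  rw [partialSum, partialSum, ← Finset.sum_union]
  · congr 1
    ext j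
    simp only [Finset.mem_filter, Finset.mem_univ, true_and, Finset.mem_union]
    omega
  · refine Finset.disjoint_left.2 fun j hj hj' => ?_
    simp only [Finset.mem_filter, Finset.mem_univ, true_and] at hj hj'
    omega

theorem partialSum_lt (p : Fin n → ℝ) (hp : ∀ j, 0 < p j) {lo hi : ℕ} (h : lo < hi)
    (hhi : hi ≤ n) : partialSum p lo < partialSum p hi := by
  rw [partialSum_add p h.le, lt_add_iff_pos_right]
  exact Finset.sum_pos (fun j _ => hp j) ⟨⟨lo, by omega⟩, by simp [h]⟩

/-- The law of the index that is found by bisection. -/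
theorem expect_sampleRange (p : Fin n → ℝ) (hp : ∀ j, 0 < p j) (S : Fin (n + 1) → ℝ)
    (hS : ∀ i, S i = partialSum p i) (g : Fin n → ℝ≥0∞) (d : ℕ) :
    ∀ (lo hi : ℕ) (hlo : lo < hi) (hhi : hi ≤ n), hi - lo ≤ d →
      expect (sampleRange S lo hi hlo hhi) g =
        ∑ j with lo ≤ j.val ∧ j.val < hi,
          ENNReal.ofReal (p j / (partialSum p hi - partialSum p lo)) * g j := by
  induction d with
  | zero => intro lo hi hlo hhi h; omega
  | succ d ih =>
    intro lo hi hlo hhi h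
    rw [sampleRange]
    split_ifs with h'
    · subst h'
      have hf : (Finset.univ.filter fun j : Fin n => lo ≤ j.val ∧ j.val < lo + 1) =
          {⟨lo, by omega⟩} := by
        ext j
        simp only [Finset.mem_filter, Finset.mem_univ, true_and, Finset.mem_singleton,
          Fin.ext_iff]
        omega
      have hs := partialSum_succ p ⟨lo, by omega⟩
      simp only at hs
      rw [hf, Finset.sum_singleton, hs, add_sub_cancel_left, div_self (hp _).ne']
      simp [expect_index]
    · have h1 : lo < (lo + hi) / 2 := by omega
      have h2 : (lo + hi) / 2 < hi := by omega
      obtain ⟨m, hm⟩ : ∃ m, m = (lo + hi) / 2 := ⟨_, rfl⟩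
      rw [← hm] at h1 h2
      -- Positive entries give both halves positive mass, so no denominator vanishes.
      have l1 := partialSum_lt p hp h1 (by omega)
      have l2 := partialSum_lt p hp h2 hhi
      set a := partialSum p lo
      set b := partialSum p m
      set c := partialSum p hi
      have hsplit : (Finset.univ.filter fun j : Fin n => lo ≤ j.val ∧ j.val < hi) =
          (Finset.univ.filter fun j : Fin n => lo ≤ j.val ∧ j.val < m) ∪
          (Finset.univ.filter fun j : Fin n => m ≤ j.val ∧ j.val < hi) := by
        ext j
        simp only [Finset.mem_filter, Finset.mem_univ, true_and, Finset.mem_union]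
        omega
      have hdisj : Disjoint (Finset.univ.filter fun j : Fin n => lo ≤ j.val ∧ j.val < m)
          (Finset.univ.filter fun j : Fin n => m ≤ j.val ∧ j.val < hi) := by
        refine Finset.disjoint_left.2 fun j hj hj' => ?_
        simp only [Finset.mem_filter, Finset.mem_univ, true_and] at hj hj'
        omega
      -- The truncation in `coin` is inactive. Below, the probability of a half times the
      -- conditional law inside that half gives back `p j / (c - a)`.
      have hq : min ((b - a) / (c - a)) 1 = (b - a) / (c - a) :=
        min_eq_left ((div_le_one (by linarith)).2 (by linarith))
      have hq' : 1 - ENNReal.ofReal ((b - a) / (c - a)) = ENNReal.ofReal ((c - b) / (c - a)) := by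
        rw [← ENNReal.ofReal_one, ← ENNReal.ofReal_sub _
          (div_nonneg (by linarith) (by linarith))]
        congr 1
        have : c - a ≠ 0 := by linarith
        field_simp
        ring
      have e1 := ih lo m h1 (by omega) (by omega)
      have e2 := ih m hi h2 hhi (by omega)
      rw [hsplit, Finset.sum_union hdisj]
      subst hm
      simp only [expect_bind, expect_index, expect_read, expect_exec_sub, expect_div,
        expect_coin, hS]
      simp only [if_true, Bool.false_eq_true, if_false, e1, e2]
      rw [hq, hq', Finset.mul_sum, Finset.mul_sum]
      congr 1
      · refine Finset.sum_congr rfl fun j _ => ?_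
        rw [← mul_assoc, ← ENNReal.ofReal_mul (div_nonneg (by linarith) (by linarith))]
        congr 2
        have : c - a ≠ 0 := by linarith
        have : b - a ≠ 0 := by linarith
        change (b - a) / (c - a) * (p j / (b - a)) = _
        field_simp
      · refine Finset.sum_congr rfl fun j _ => ?_
        rw [← mul_assoc, ← ENNReal.ofReal_mul (div_nonneg (by linarith) (by linarith))]
        congr 2
        have : c - a ≠ 0 := by linarith
        have : c - b ≠ 0 := by linarith
        change (c - b) / (c - a) * (p j / (c - b)) = _
        field_simp

theorem expect_sampleIndex [NeZero n] (p : Fin n → ℝ) (hp : ∀ j, 0 < p j) (hp1 : ∑ j, p j = 1)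
    (S : Fin (n + 1) → ℝ) (hS : ∀ i, S i = partialSum p i) (g : Fin n → ℝ≥0∞) :
    expect (sampleIndex S) g = ∑ j, ENNReal.ofReal (p j) * g j := by
  rw [sampleIndex, expect_sampleRange p hp S hS g n 0 n (Nat.pos_of_neZero n) le_rfl (by omega)]
  simp [hp1]

/-- The second moment of the sum of samples around its mean. -/
theorem expect_sampleMean_sq [NeZero n] (p : Fin n → ℝ) (hp : ∀ j, 0 < p j)
    (hp1 : ∑ j, p j = 1) (S : Fin (n + 1) → ℝ) (hS : ∀ i, S i = partialSum p i)
    {query : Fin n → RAM ℝ} {a : ℕ} {x : Fin n → ℝ} (hq : Reads query a x)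
    (hx : ∀ j, |x j| ≤ 1) {q : ℕ} (hq0 : 0 < q) :
    expect (sampleMean S query q) (fun z => ENNReal.ofReal ((z - p ⬝ᵥ x) ^ 2)) ≤
      ENNReal.ofReal (1 / q) := by
  set μ := p ⬝ᵥ x with hμ
  -- The squared deviation of the running sum from `i μ` grows in expectation by at most the
  -- variance of one sample, which is at most one.
  have hloop := expect_loop_add_le (n := q) (st := (0 : ℝ))
    (body := fun _ s => do
      let j ← sampleIndex S
      let a ← query j
      exec (.add s a))
    (fun i s => ENNReal.ofReal ((s - i * μ) ^ 2)) 1 (fun i s => by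
      simp only [expect_bind, expect_sampleIndex p hp hp1 S hS]
      calc _ ≤ ∑ j, ENNReal.ofReal (p j) *
            ENNReal.ofReal ((s + x j - ((i + 1 : ℕ) : ℝ) * μ) ^ 2) := by
            refine Finset.sum_le_sum fun j _ => mul_le_mul_right ?_ _
            refine (hq j).expect_le ?_
            rintro _ rfl
            rw [expect_exec_add]
        _ = ENNReal.ofReal (∑ j, p j * (s + x j - ((i + 1 : ℕ) : ℝ) * μ) ^ 2) := by
            rw [ENNReal.ofReal_sum_of_nonneg fun j _ =>
              mul_nonneg (hp j).le (sq_nonneg _)]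
            exact Finset.sum_congr rfl fun j _ => (ENNReal.ofReal_mul (hp j).le).symm
        _ ≤ ENNReal.ofReal ((s - i * μ) ^ 2 + 1) := by
            refine ENNReal.ofReal_le_ofReal ?_
            -- After summation the cross terms cancel because `x j - μ` has mean zero; what is added
            -- to `(s - i μ) ^ 2` is `∑ p j x j ^ 2 - μ ^ 2`.
            have e : ∀ j, p j * (s + x j - ((i + 1 : ℕ) : ℝ) * μ) ^ 2 =
                ((s - i * μ) ^ 2 - 2 * (s - i * μ) * μ + μ ^ 2) * p j +
                (2 * (s - i * μ) - 2 * μ) * (p j * x j) + p j * x j ^ 2 := by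
              intro j; push_cast; ring
            have hsq : ∑ j, p j * x j ^ 2 ≤ 1 := by
              rw [← hp1]
              refine Finset.sum_le_sum fun j _ => ?_
              have : x j ^ 2 ≤ 1 := (sq_le_one_iff_abs_le_one _).2 (hx j)
              nlinarith [hp j]
            have hμ' : ∑ j, p j * x j = μ := rfl
            simp only [e, Finset.sum_add_distrib, ← Finset.mul_sum, hp1, hμ']
            nlinarith [sq_nonneg μ]
        _ = _ := by
            rw [ENNReal.ofReal_add (sq_nonneg _) zero_le_one, ENNReal.ofReal_one])
  simp only [sampleMean, expect_bind, expect_div]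
  have hq0' : (0 : ℝ) < q := by exact_mod_cast hq0
  have e : ∀ s : ℝ, ENNReal.ofReal ((s / q - μ) ^ 2) =
      ENNReal.ofReal (1 / q ^ 2) * ENNReal.ofReal ((s - q * μ) ^ 2) := by
    intro s
    rw [← ENNReal.ofReal_mul (by positivity)]
    congr 1
    field_simp
  simp only [e, expect_const_mul]
  calc _ ≤ ENNReal.ofReal (1 / q ^ 2) * q := by
        refine mul_le_mul_right (hloop.trans ?_) _
        simp
    _ = _ := by
        rw [← ENNReal.ofReal_natCast q, ← ENNReal.ofReal_mul (by positivity)]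
        congr 1
        field_simp

/-- Chebyshev's inequality with second moment at most `1 / q`. The value `2/9` is what makes the
growth factor in the median argument equal to `5/3`. -/
theorem failProb_sampleMean_le [NeZero n] (p : Fin n → ℝ) (hp : ∀ j, 0 < p j)
    (hp1 : ∑ j, p j = 1) (S : Fin (n + 1) → ℝ) (hS : ∀ i, S i = partialSum p i)
    {query : Fin n → RAM ℝ} {a : ℕ} {x : Fin n → ℝ} (hq : Reads query a x)
    (hx : ∀ j, |x j| ≤ 1) {q : ℕ} {η : ℝ} (hη : 0 < η) (hqη : 9 / 2 / η ^ 2 ≤ q) :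
    failProb (sampleMean S query q) (fun z => |z - p ⬝ᵥ x| ≤ η) ≤ ENNReal.ofReal (2 / 9) := by
  have hq0' : (0 : ℝ) < q := lt_of_lt_of_le (by positivity) hqη
  have hq0 : 0 < q := by exact_mod_cast hq0'
  have h := expect_sampleMean_sq p hp hp1 S hS hq hx hq0
  calc _ ≤ expect (sampleMean S query q) (fun z => ENNReal.ofReal (1 / η ^ 2) *
        ENNReal.ofReal ((z - p ⬝ᵥ x) ^ 2)) := by
        refine RAM.expect_mono fun z => ?_
        split_ifs with hz
        · simp
        · rw [← ENNReal.ofReal_mul (by positivity), ← ENNReal.ofReal_one]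
          refine ENNReal.ofReal_le_ofReal ?_
          rw [one_div, ← div_eq_inv_mul, one_le_div (by positivity)]
          rw [sq_le_sq, abs_of_pos hη]
          exact (not_le.1 hz).le
    _ ≤ ENNReal.ofReal (1 / η ^ 2) * ENNReal.ofReal (1 / q) := by
        rw [expect_const_mul]
        exact mul_le_mul_right h _
    _ ≤ _ := by
        rw [← ENNReal.ofReal_mul (by positivity)]
        refine ENNReal.ofReal_le_ofReal ?_
        rw [div_mul_div_comm, mul_one, div_le_div_iff₀ (by positivity) (by norm_num)]
        rw [div_le_iff₀ (by positivity)] at hqη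
        linarith

theorem ensures_sampleMean [NeZero n] (S : Fin (n + 1) → ℝ) {query : Fin n → RAM ℝ} {a : ℕ}
    {x : Fin n → ℝ} (hq : Reads query a x) (q : ℕ) {d : ℕ} (hd : n ≤ 2 ^ d) :
    Ensures (sampleMean S query q) (q * (10 * d + a + 3) + 1) fun _ => True := by
  refine Ensures.bind (P := fun _ => True) (ensures_loop (b := 10 * d + 1 + (a + 1))
    (fun _ _ => True) trivial fun i s _ => ?_) (fun s _ => ensures_exec_of rfl trivial) |>.mono
      (by apply le_of_eq; ring) fun _ h => h
  refine (ensures_sampleRange S d _ _ _ _ (by simpa using hd)).bind fun j _ => ?_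
  exact (hq j).bind fun y _ => ensures_exec_of rfl trivial

end Sampling

/-! ### The median of means -/

section Median

variable {K : ℕ}

/-- `a` is a median of the entries of `Z`. -/
def IsMedian (Z : Fin K → ℝ) (a : ℝ) : Prop :=
  2 * (Finset.univ.filter fun k => Z k < a).card ≤ K ∧
    K ≤ 2 * (Finset.univ.filter fun k => Z k ≤ a).card

/-- Take the smallest entry that has at least half of the entries at or below it. The largest entry
strictly below it lacks this property, so fewer than half of the entries are strictly smaller. -/
theorem exists_isMedian (Z : Fin K → ℝ) (hK : 0 < K) : ∃ j, IsMedian Z (Z j) := by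
  classical
  have : Nonempty (Fin K) := ⟨⟨0, hK⟩⟩
  set A := Finset.univ.filter fun j => K ≤ 2 * (Finset.univ.filter fun k => Z k ≤ Z j).card
  have hA : A.Nonempty := by
    obtain ⟨j, -, hj⟩ := Finset.exists_max_image Finset.univ Z Finset.univ_nonempty
    refine ⟨j, Finset.mem_filter.2 ⟨Finset.mem_univ _, ?_⟩⟩
    rw [Finset.filter_true_of_mem fun k hk => hj k hk]
    simp
    omega
  obtain ⟨j, hjA, hj⟩ := Finset.exists_min_image A Z hA
  refine ⟨j, ?_, (Finset.mem_filter.1 hjA).2⟩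
  by_cases hB : (Finset.univ.filter fun k => Z k < Z j).Nonempty
  · obtain ⟨i, hi, hmax⟩ := Finset.exists_max_image _ Z hB
    have hij : Z i < Z j := (Finset.mem_filter.1 hi).2
    have hiA : i ∉ A := fun h => absurd (hj i h) (not_le.2 hij)
    have hc : ¬ K ≤ 2 * (Finset.univ.filter fun k => Z k ≤ Z i).card := fun h =>
      hiA (Finset.mem_filter.2 ⟨Finset.mem_univ _, h⟩)
    have hsub : (Finset.univ.filter fun k => Z k < Z j) ⊆
        Finset.univ.filter fun k => Z k ≤ Z i := fun k hk =>
      Finset.mem_filter.2 ⟨Finset.mem_univ _, hmax k hk⟩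
    have := Finset.card_le_card hsub
    omega
  · rw [Finset.not_nonempty_iff_eq_empty.1 hB]
    simp

theorem card_filter_lt_succ (P : Fin K → Prop) [DecidablePred P] (i : Fin K) :
    (Finset.univ.filter fun k : Fin K => k.val < i.val + 1 ∧ P k).card =
      (Finset.univ.filter fun k : Fin K => k.val < i.val ∧ P k).card + if P i then 1 else 0 := by
  have : (Finset.univ.filter fun k : Fin K => k.val < i.val + 1 ∧ P k) =
      (Finset.univ.filter fun k : Fin K => k.val < i.val ∧ P k) ∪
        (if P i then {i} else ∅) := by
    ext k
    by_cases hk : k = i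
    · subst hk
      by_cases hP : P k <;> simp [hP]
    · have hk' : k.val ≠ i.val := fun h => hk (Fin.ext h)
      have h1 : k.val < i.val + 1 ↔ k.val < i.val := by omega
      by_cases hP : P i <;>
        simp only [hP, if_true, if_false, Finset.mem_filter, Finset.mem_union, Finset.mem_univ,
          true_and, Finset.mem_singleton, Finset.notMem_empty, hk, h1, or_false]
  rw [this, Finset.card_union_of_disjoint]
  · split_ifs <;> simp
  · split_ifs <;> simp

theorem ensures_median (Z : Fin K → ℝ) :
    Ensures (median Z) (K * (6 * K + 4)) fun a => 0 < K → IsMedian Z a := by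
  classical
  refine (ensures_loop (b := 6 * K + 3)
    -- The invariant is conditional because the initial value `0` need not be a median;
    -- `exists_isMedian` discharges the condition at the end.
    (fun i cur => (∃ j : Fin K, j.val < i ∧ IsMedian Z (Z j)) → IsMedian Z cur)
    (by simp) fun i cur hcur => ?_).mono le_rfl fun a ha hK => ?_
  · refine Ensures.exec_bind (b := 6 * K + 2) rfl ?_
    refine (Ensures.bind (b := K * 6) (b' := 2) (ensures_loop (b := 5)
      (fun k (c : ℕ × ℕ) =>
        c.1 = (Finset.univ.filter fun l : Fin K => l.val < k ∧ Z l < Z i).card ∧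
        c.2 = (Finset.univ.filter fun l : Fin K => l.val < k ∧ Z l ≤ Z i).card)
      (by simp) ?_) ?_).mono (by omega) fun _ h => h
    · rintro k ⟨c, c'⟩ ⟨rfl, rfl⟩
      iterate 5 refine Ensures.exec_bind rfl ?_
      refine ensures_pure ⟨?_, ?_⟩
      · rw [card_filter_lt_succ]
        by_cases h : Z k < Z i <;> simp [h]
      · rw [card_filter_lt_succ]
        by_cases h : Z i < Z k
        · simp [h]
        · simp [h, not_lt.1 h]
    · rintro ⟨c, c'⟩ ⟨rfl, rfl⟩
      iterate 2 refine Ensures.exec_bind rfl ?_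
      refine ensures_pure ?_
      rintro ⟨j, hj, hjm⟩
      simp only [Fin.is_lt, true_and]
      by_cases hm : IsMedian Z (Z i)
      · rw [if_pos]
        · exact hm
        · exact hm
      · rw [if_neg]
        · refine hcur ⟨j, ?_, hjm⟩
          have : j.val ≠ i.val := fun h => hm ((Fin.ext h : j = i) ▸ hjm)
          omega
        · exact hm
  · obtain ⟨j, hj⟩ := exists_isMedian Z hK
    exact ha ⟨j, j.2, hj⟩

/-- A median lies in every interval that contains more than half of the entries. -/
theorem IsMedian.abs_sub_le {Z : Fin K → ℝ} {a μ η : ℝ} (h : IsMedian Z a)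
    (hbad : 2 * (Finset.univ.filter fun k => ¬ |Z k - μ| ≤ η).card < K) : |a - μ| ≤ η := by
  have hsum := Finset.card_filter_add_card_filter_not (s := (Finset.univ : Finset (Fin K)))
    (fun k => |Z k - μ| ≤ η)
  rw [Finset.card_univ, Fintype.card_fin] at hsum
  by_contra hcon
  rcases lt_abs.1 (not_le.1 hcon) with h1 | h1
  · have hsub : (Finset.univ.filter fun k => |Z k - μ| ≤ η) ⊆
        Finset.univ.filter fun k => Z k < a := fun k hk => by
      simp only [Finset.mem_filter, Finset.mem_univ, true_and] at hk ⊢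
      linarith [(abs_le.1 hk).2]
    have := Finset.card_le_card hsub
    have := h.1
    omega
  · have hsub : (Finset.univ.filter fun k => Z k ≤ a) ⊆
        Finset.univ.filter fun k => ¬ |Z k - μ| ≤ η := fun k hk => by
      simp only [Finset.mem_filter, Finset.mem_univ, true_and] at hk ⊢
      intro hk'
      linarith [(abs_le.1 hk').1]
    have := Finset.card_le_card hsub
    have := h.2
    omega

variable {n : ℕ}

theorem ensures_estimateInner [NeZero n] (S : Fin (n + 1) → ℝ) {query : Fin n → RAM ℝ} {a : ℕ}
    {x : Fin n → ℝ} (hq : Reads query a x) (K q : ℕ) {d : ℕ} (hd : n ≤ 2 ^ d) :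
    Ensures (estimateInner S query K q)
      (K * (q * (10 * d + a + 3) + 3) + K * (6 * K + 4)) fun _ => True := by
  refine Ensures.bind (P := fun _ => True) (ensures_loop
    (b := q * (10 * d + a + 3) + 1 + 1) (fun _ _ => True) trivial fun i Z _ => ?_)
    fun Z _ => (ensures_median Z).mono le_rfl fun _ _ => trivial
  exact (ensures_sampleMean S hq q hd).bind fun z _ => ensures_exec_of rfl trivial

/-- The median of `K` means of `q` samples fails with a probability that is exponentially small
in `K`. -/
theorem failProb_estimateInner_le [NeZero n] (p : Fin n → ℝ) (hp : ∀ j, 0 < p j)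
    (hp1 : ∑ j, p j = 1) (S : Fin (n + 1) → ℝ) (hS : ∀ i, S i = partialSum p i)
    {query : Fin n → RAM ℝ} {a : ℕ} {x : Fin n → ℝ} (hq : Reads query a x)
    (hx : ∀ j, |x j| ≤ 1) {q : ℕ} {η : ℝ} (hη : 0 < η) (hqη : 9 / 2 / η ^ 2 ≤ q)
    {K : ℕ} (hK : 0 < K) :
    failProb (estimateInner S query K q) (fun z => |z - p ⬝ᵥ x| ≤ η) ≤
      ENNReal.ofReal (Real.exp (-(K / 6))) := by
  classical
  set μ := p ⬝ᵥ x
  -- The potential is `4` to the number of bad means so far. A new mean is bad with probability at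
  -- most `2/9`, so the potential grows in expectation by a factor of at most `1 + 3 · 2/9 = 5/3`.
  have hloop := expect_loop_mul_le (n := K) (st := fun _ => (0 : ℝ))
    (body := fun i (Z : Fin K → ℝ) => do
      let z ← sampleMean S query q
      exec (.write Z i z))
    (fun i Z => 4 ^ (Finset.univ.filter fun k : Fin K => k.val < i ∧ ¬ |Z k - μ| ≤ η).card)
    (ENNReal.ofReal (5 / 3)) (fun i Z => by
      simp only [expect_bind, expect_write]
      have e : ∀ z : ℝ, ((4 : ℝ≥0∞) ^ (Finset.univ.filter fun k : Fin K =>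
            k.val < i.val + 1 ∧ ¬ |Function.update Z i z k - μ| ≤ η).card) =
          4 ^ (Finset.univ.filter fun k : Fin K => k.val < i.val ∧ ¬ |Z k - μ| ≤ η).card *
            (1 + 3 * if |z - μ| ≤ η then 0 else 1) := by
        intro z
        rw [card_filter_lt_succ (fun k => ¬ |Function.update Z i z k - μ| ≤ η), pow_add]
        congr 1
        · congr 2
          refine Finset.filter_congr fun k _ => and_congr_right fun hk => ?_
          rw [Function.update_of_ne (fun h => by subst h; omega)]
        · by_cases hz : |z - μ| ≤ η
          · simp [hz]
          · simp only [Function.update_self, hz, not_false_eq_true, if_true, if_false]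
            norm_num
      simp only [e, expect_const_mul, expect_add, expect_const]
      rw [mul_comm]
      refine mul_le_mul_left ?_ _
      calc _ ≤ 1 + 3 * ENNReal.ofReal (2 / 9) := by
            gcongr
            have := failProb_sampleMean_le p hp hp1 S hS hq hx hη hqη
            rw [failProb] at this
            convert this
        _ = ENNReal.ofReal (5 / 3) := by
            rw [← ENNReal.ofReal_one, show (3 : ℝ≥0∞) = ENNReal.ofReal 3 by simp,
              ← ENNReal.ofReal_mul (by norm_num), ← ENNReal.ofReal_add (by norm_num)
              (by norm_num)]
            norm_num)
  rw [failProb, estimateInner, expect_bind]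
  -- Markov's inequality: a bad median forces at least `K / 2` bad means, so the potential is at
  -- least `2 ^ K`. The result is `(5/6) ^ K`, and `5/6 = 1 - 1/6 ≤ exp (-1/6)`.
  calc _ ≤ expect _ (fun Z : Fin K → ℝ => ENNReal.ofReal ((1 / 2) ^ K) *
        4 ^ (Finset.univ.filter fun k : Fin K => k.val < K ∧ ¬ |Z k - μ| ≤ η).card) := by
        refine RAM.expect_mono fun Z => (ensures_median Z).expect_le fun z hz => ?_
        split_ifs with hzη
        · simp
        · have hb : ¬ 2 * (Finset.univ.filter fun k => ¬ |Z k - μ| ≤ η).card < K :=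
            fun h => hzη ((hz hK).abs_sub_le h)
          simp only [Fin.is_lt, true_and]
          rw [show (4 : ℝ≥0∞) = ENNReal.ofReal 4 by simp, ← ENNReal.ofReal_pow (by norm_num),
            ← ENNReal.ofReal_mul (by positivity), ← ENNReal.ofReal_one]
          refine ENNReal.ofReal_le_ofReal ?_
          rw [show (4 : ℝ) = 2 ^ 2 by norm_num, ← pow_mul]
          calc (1 : ℝ) = (1 / 2) ^ K * 2 ^ K := by rw [← mul_pow]; norm_num
            _ ≤ _ := by
              refine mul_le_mul_of_nonneg_left ?_ (by positivity)
              exact pow_le_pow_right₀ (by norm_num) (not_lt.1 hb)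
    _ ≤ ENNReal.ofReal ((1 / 2) ^ K) * ENNReal.ofReal (5 / 3) ^ K := by
        rw [expect_const_mul]
        refine mul_le_mul_right (hloop.trans ?_) _
        simp
    _ ≤ _ := by
        rw [← ENNReal.ofReal_pow (by norm_num), ← ENNReal.ofReal_mul (by positivity), ← mul_pow]
        refine ENNReal.ofReal_le_ofReal ?_
        have h56 : (1 / 2 * (5 / 3) : ℝ) ≤ Real.exp (-(1 / 6)) := by
          have := Real.add_one_le_exp (-(1 / 6) : ℝ)
          linarith
        calc (1 / 2 * (5 / 3) : ℝ) ^ K ≤ Real.exp (-(1 / 6)) ^ K := by gcongr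
          _ = _ := by
            rw [← Real.exp_nat_mul]
            congr 1
            ring

end Median

/-! ### The rounds of the algorithm -/

section Rounds

variable {N n M : ℕ}

/-- The probability vector `w / ‖w‖₁`. -/
noncomputable def normalized (w : Fin n → ℝ) : Fin n → ℝ := fun j => w j / ∑ i, w i

/-- The vector `λ w / ‖w‖₁` that belongs to the weights `w`. -/
noncomputable def predictor (P : Params) (w : Fin n → ℝ) : Fin n → ℝ := P.lam • normalized w

/-- The weights after a round on the example `ex`, for the features `φ`. -/
noncomputable def nextWeights (P : Params) (φ : (Fin N → ℝ) → Fin n → ℝ) (w : Fin n → ℝ)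
    (ex : Example N) : Fin n → ℝ :=
  fun j => w j * P.beta ^ ((1 + (P.act (P.lam * (normalized w ⬝ᵥ φ ex.1)) - ex.2) * φ ex.1 j) / 2)

/-- The weights after the rounds on all examples of `train`. -/
noncomputable def weightsAfter (P : Params) (φ : (Fin N → ℝ) → Fin n → ℝ) :
    (t : ℕ) → (Fin t → Example N) → Fin n → ℝ
  | 0, _ => fun _ => 1 / n
  | t + 1, train =>
      nextWeights P φ (weightsAfter P φ t (Fin.init train)) (train (Fin.last t))

/-- The candidates for the output: the vectors `λ p` of all rounds. -/
def visited (P : Params) (φ : (Fin N → ℝ) → Fin n → ℝ) :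
    (t : ℕ) → (Fin t → Example N) → Set (Fin n → ℝ)
  | 0, _ => ∅
  | t + 1, train =>
      insert (predictor P (weightsAfter P φ t (Fin.init train))) (visited P φ t (Fin.init train))

/-- The empirical risk of `u` on the examples `test`. -/
noncomputable def empRisk (act : ℝ → ℝ) (φ : (Fin N → ℝ) → Fin n → ℝ) (test : Fin M → Example N)
    (u : Fin n → ℝ) : ℝ :=
  (∑ m, (act (u ⬝ᵥ φ (test m).1) - (test m).2) ^ 2) / M

/-- The number of means whose median is taken. -/
noncomputable def numReps (P : Params) (T M : ℕ) : ℕ := ⌈6 * Real.log (M * T / P.delta)⌉₊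

/-- The number of samples in one mean. -/
noncomputable def numSamples (P : Params) : ℕ :=
  max 1 ⌈9 / 2 * (16 * P.lam / P.eps * (16 * P.lam / P.eps))⌉₊

/-- A bound for the cost of one estimate of the risk, where `n ≤ 2 ^ d` and the access to a
feature costs at most `a`. -/
noncomputable def approxRiskCost (P : Params) (n T M a d : ℕ) : ℕ :=
  4 * n + 13 + M * (numReps P T M * (numSamples P * (10 * d + a + 3) + 3) +
    numReps P T M * (6 * numReps P T M + 4) + 7)

/-- A bound for the cost of one round. -/
noncomputable def oneRoundCost (P : Params) (n T M a d : ℕ) : ℕ :=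
  n * (2 * a + 23) + 6 + approxRiskCost P n T M a d

variable {access : (Fin N → ℝ) → Fin n → RAM ℝ} {a : ℕ} {φ : (Fin N → ℝ) → Fin n → ℝ}

theorem ensures_repetitions (P : Params) (T M : ℕ) :
    Ensures (repetitions P T M) 5 fun K => K = numReps P T M := by
  iterate 4 refine Ensures.exec_bind rfl ?_
  exact ensures_exec_of rfl rfl

theorem ensures_batchSize (P : Params) :
    Ensures (batchSize P) 6 fun q => q = numSamples P := by
  iterate 6 refine Ensures.exec_bind rfl ?_
  exact ensures_pure rfl

theorem ensures_approxRisk [NeZero n] (hacc : ∀ x, Reads (access x) a (φ x)) (P : Params)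
    (T : ℕ) (test : Fin M → Example N) (p : Fin n → ℝ) {d : ℕ} (hd : n ≤ 2 ^ d) :
    Ensures (approxRisk access P T test p) (approxRiskCost P n T M a d) fun _ => True := by
  rw [show approxRiskCost P n T M a d = (4 * n + 1) + (5 + (6 + (M * (numReps P T M *
    (numSamples P * (10 * d + a + 3) + 3) + numReps P T M * (6 * numReps P T M + 4) + 6 + 1)
      + 1))) by simp only [approxRiskCost]; ring]
  refine (ensures_prepareSampling p).bind fun S _ => (ensures_repetitions P T M).bind ?_
  rintro _ rfl
  refine (ensures_batchSize P).bind ?_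
  rintro _ rfl
  refine Ensures.bind (P := fun _ => True) (ensures_loop (fun _ _ => True) trivial
    fun m s _ => ?_) fun s _ => ensures_exec_of rfl trivial
  refine (ensures_estimateInner S (hacc _) _ _ hd).bind fun z _ => ?_
  iterate 5 refine Ensures.exec_bind rfl ?_
  exact ensures_exec_of rfl trivial

/-- The comparison depends on random estimates, so with certainty one only knows that the new
predictor is stored or an existing entry is kept. The weights, however, are determined. -/
theorem ensures_oneRound [NeZero n] (hacc : ∀ x, Reads (access x) a (φ x)) (P : Params)
    (T : ℕ) (test : Fin M → Example N) (ex : Example N) (st : State n) {d : ℕ}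
    (hd : n ≤ 2 ^ d) :
    Ensures (oneRound access P T test ex st) (oneRoundCost P n T M a d) fun s =>
      s.weights = nextWeights P φ st.weights ex ∧
      ((∃ r, s.best = some (r, predictor P st.weights)) ∨ (s.best = st.best ∧ st.best ≠ none)) := by
  rw [show oneRoundCost P n T M a d = 7 * n + (n * (a + 4) + (n * (a + 8) +
    (approxRiskCost P n T M a d + ((1 + 4 * n) + 1)) + 4)) by simp only [oneRoundCost]; ring]
  refine (ensures_normalizeWeights _).bind ?_
  rintro _ rfl
  refine (ensures_innerProduct _ (hacc _)).bind ?_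
  rintro _ rfl
  iterate 4 refine Ensures.exec_bind rfl ?_
  refine (ensures_updateWeights _ _ (hacc _) _).bind ?_
  rintro _ rfl
  refine (ensures_approxRisk hacc P T test _ hd).bind fun r _ => ?_
  refine Ensures.exec_bind rfl ?_
  rcases h : st.best with _ | b
  -- No comparison takes place without a stored entry; its cost is padded to one so that both cases
  -- meet the same bound.
  · refine Ensures.bind (b := 1) (P := fun b => b = true)
      ((ensures_pure (P := fun b => b = true) rfl).mono zero_le_one fun _ h => h) ?_
    rintro _ rfl
    refine ((ensures_scale _ _).bind (b' := 0) ?_)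
    rintro _ rfl
    exact ensures_pure ⟨rfl, Or.inl ⟨r, rfl⟩⟩
  · refine (ensures_exec _).bind ?_
    rintro (_ | _) -
    · exact (ensures_pure ⟨rfl, Or.inr ⟨rfl, by simp⟩⟩).mono (Nat.zero_le _) fun _ h => h
    · refine ((ensures_scale _ _).bind (b' := 0) ?_)
      rintro _ rfl
      exact ensures_pure ⟨rfl, Or.inl ⟨r, rfl⟩⟩

/-- An identity of joint laws of state and step count, and as such the precise form of online
operation. It also drives the inductions over the rounds. -/
theorem stateAfter_succ [NeZero n] (access : (Fin N → ℝ) → Fin n → RAM ℝ) (P : Params) (T : ℕ)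
    (test : Fin M → Example N) {t : ℕ} (train : Fin (t + 1) → Example N) :
    stateAfter access P T test train = (do
      let s ← stateAfter access P T test (Fin.init train)
      exec .index
      oneRound access P T test (train (Fin.last t)) s) := by
  simp only [stateAfter, loop, bind_assoc]
  rfl

/-- The stored vector is one of the candidates. -/
theorem ensures_stateAfter [NeZero n] (hacc : ∀ x, Reads (access x) a (φ x)) (P : Params)
    (T : ℕ) (test : Fin M → Example N) {d : ℕ} (hd : n ≤ 2 ^ d) {t : ℕ}
    (train : Fin t → Example N) :
    Ensures (stateAfter access P T test train)
      (2 * n + 1 + t * (oneRoundCost P n T M a d + 1)) fun s =>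
      s.weights = weightsAfter P φ t train ∧
      ((s.best = none ∧ t = 0) ∨ ∃ r, ∃ v ∈ visited P φ t train, s.best = some (r, v)) := by
  induction t with
  | zero =>
    change Ensures (initState n >>= fun s => pure s) _ _
    refine ((ensures_initState n).bind (b' := 0) ?_).mono (by omega) fun _ h => h
    rintro _ rfl
    exact ensures_pure ⟨rfl, Or.inl ⟨rfl, rfl⟩⟩
  | succ t ih =>
    rw [stateAfter_succ]
    refine ((ih (Fin.init train)).bind (b' := oneRoundCost P n T M a d + 1) fun s hs => ?_).mono
      (le_of_eq (by ring)) fun _ h => h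
    refine Ensures.exec_bind (a := ()) rfl
      ((ensures_oneRound hacc P T test (train (Fin.last t)) s hd).mono le_rfl ?_)
    rintro s' ⟨hw, hb⟩
    rw [hs.1] at hw hb
    refine ⟨hw, Or.inr ?_⟩
    rcases hb with ⟨r, hr⟩ | ⟨h1, h2⟩
    · exact ⟨r, _, Set.mem_insert _ _, hr⟩
    · rcases hs.2 with ⟨h3, -⟩ | ⟨r, v, hv, h3⟩
      · exact absurd h3 h2
      · exact ⟨r, v, Set.mem_insert_of_mem _ hv, h1.trans h3⟩

/-- At least one round is needed, since otherwise nothing is stored. Besides the cost, the certain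
membership settles the cases in which all candidates are good. -/
theorem ensures_learn [NeZero n] (hacc : ∀ x, Reads (access x) a (φ x)) (P : Params)
    {T : ℕ} (hT : 0 < T) (train : Fin T → Example N) (test : Fin M → Example N) {d : ℕ}
    (hd : n ≤ 2 ^ d) :
    Ensures (learn access P train test) (2 * n + 2 + T * (oneRoundCost P n T M a d + 1))
      fun u => u ∈ visited P φ T train := by
  refine ((ensures_stateAfter hacc P T test hd train).bind (b' := 1) ?_).mono
    (le_of_eq (by ring)) fun _ h => h
  rintro s ⟨-, ⟨-, h⟩ | ⟨r, v, hv, h⟩⟩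
  · omega
  · refine Ensures.exec_bind rfl ?_
    rw [h]
    exact ensures_pure hv

/-! ### The failure probability of the estimates -/

/-- An error `ε / (16 λ)` in `p · a` changes `σ(λ p · a)` by at most `ε / 16`. In the difference of
the squared losses the other factor is at most `2`, which gives `ε / 8` per test example. A union
bound runs over the `M` estimates. -/
theorem failProb_approxRisk_le [NeZero n] (hacc : ∀ x, Reads (access x) a (φ x)) {P : Params}
    (hlip : LipschitzWith 1 P.act) (hact : ∀ z, P.act z ∈ Set.Icc (0 : ℝ) 1)
    (hlam : 0 < P.lam) (heps : 0 < P.eps) {T : ℕ} {test : Fin M → Example N}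
    (hM : 0 < M) (hK : 0 < numReps P T M)
    (htest : ∀ m, (∀ j, |φ (test m).1 j| ≤ 1) ∧ (test m).2 ∈ Set.Icc (0 : ℝ) 1)
    {p : Fin n → ℝ} (hp : ∀ j, 0 < p j) (hp1 : ∑ j, p j = 1) :
    failProb (approxRisk access P T test p)
      (fun r => |r - empRisk P.act φ test (P.lam • p)| ≤ P.eps / 8) ≤
      M * ENNReal.ofReal (Real.exp (-(numReps P T M / 6))) := by
  set f : Fin M → ℝ := fun m => (P.act ((P.lam • p) ⬝ᵥ φ (test m).1) - (test m).2) ^ 2 with hf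
  have hM' : (0 : ℝ) < M := by exact_mod_cast hM
  refine (ensures_prepareSampling p).failProb_bind_le fun S hS => ?_
  refine (ensures_repetitions P T M).failProb_bind_le ?_
  rintro _ rfl
  refine (ensures_batchSize P).failProb_bind_le ?_
  rintro _ rfl
  refine (failProb_bind_le (x := 0)
    (P := fun s : ℝ => |s - partialSum f M| ≤ M * (P.eps / 8)) ?_).trans ?_
  · intro s hs
    refine le_of_eq (Ensures.failProb_eq_zero (b := 1) (ensures_exec_of rfl ?_))
    rw [partialSum_self] at hs
    rw [empRisk, ← sub_div, abs_div, abs_of_pos hM', div_le_iff₀ hM']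
    linarith
  · rw [add_zero]
    refine failProb_loop_le (fun i s => |s - partialSum f i| ≤ i * (P.eps / 8)) (by simp) _ ?_
    intro m s hs
    have hη : 0 < P.eps / (16 * P.lam) := by positivity
    refine (failProb_bind_le (x := 0) ?_).trans ((add_zero _).trans_le
      (failProb_estimateInner_le p hp hp1 S hS (hacc (test m).1) (htest m).1 hη ?_ hK))
    · intro z hz
      iterate 5 rw [failProb_exec_bind rfl]
      refine le_of_eq (Ensures.failProb_eq_zero (b := 1) (ensures_exec_of rfl ?_))
      rw [partialSum_succ]
      have e : P.lam * z - (P.lam • p) ⬝ᵥ φ (test m).1 = P.lam * (z - p ⬝ᵥ φ (test m).1) := by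
        rw [smul_dotProduct, smul_eq_mul]; ring
      have h1 : |P.act (P.lam * z) - P.act ((P.lam • p) ⬝ᵥ φ (test m).1)| ≤ P.eps / 16 := by
        have := hlip.dist_le_mul (P.lam * z) ((P.lam • p) ⬝ᵥ φ (test m).1)
        rw [Real.dist_eq, Real.dist_eq, e, abs_mul, abs_of_pos hlam] at this
        calc _ ≤ P.lam * |z - p ⬝ᵥ φ (test m).1| := by simpa using this
          _ ≤ P.lam * (P.eps / (16 * P.lam)) := by gcongr
          _ = _ := by field_simp
      have h2 := hact (P.lam * z)
      have h3 := hact ((P.lam • p) ⬝ᵥ φ (test m).1)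
      have h4 := (htest m).2
      have h5 : |(P.act (P.lam * z) - (test m).2) * (P.act (P.lam * z) - (test m).2) - f m| ≤
          P.eps / 8 := by
        have : (P.act (P.lam * z) - (test m).2) * (P.act (P.lam * z) - (test m).2) - f m =
            (P.act (P.lam * z) - P.act ((P.lam • p) ⬝ᵥ φ (test m).1)) *
            (P.act (P.lam * z) + P.act ((P.lam • p) ⬝ᵥ φ (test m).1) - 2 * (test m).2) := by
          rw [hf]; ring
        rw [this, abs_mul]
        have h6 : |P.act (P.lam * z) + P.act ((P.lam • p) ⬝ᵥ φ (test m).1) - 2 * (test m).2| ≤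
            2 := by
          rw [abs_le]
          constructor <;> linarith [h2.1, h2.2, h3.1, h3.2, h4.1, h4.2]
        calc _ ≤ P.eps / 16 * 2 := mul_le_mul h1 h6 (abs_nonneg _) (by positivity)
          _ = _ := by ring
      rw [abs_le] at h5 hs ⊢
      push_cast
      constructor <;> linarith [h5.1, h5.2, hs.1, hs.2]
    -- The batch size is chosen as `9 / (2 η ^ 2)` rounded up, for `η = ε / (16 λ)`.
    · refine le_trans (le_of_eq ?_) ((Nat.le_ceil _).trans (Nat.cast_le.2 (le_max_right _ _)))
      field_simp

/-- The stored vector `v` and its approximate risk, where all risks of candidates are known up to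
an error `τ`. -/
def Tracks (emp : (Fin n → ℝ) → ℝ) (τ : ℝ) (V : Set (Fin n → ℝ)) :
    Option (ℝ × (Fin n → ℝ)) → Prop
  | none => V = ∅
  | some b => b.2 ∈ V ∧ |b.1 - emp b.2| ≤ τ ∧ ∀ u ∈ V, b.1 ≤ emp u + τ

/-- The estimate of the risk is the only step that can fail; given that it is accurate to `τ`, both
keeping and replacing the stored entry preserve `Tracks`. -/
theorem failProb_oneRound_le [NeZero n] (hacc : ∀ x, Reads (access x) a (φ x)) {P : Params}
    {T : ℕ} {test : Fin M → Example N} {ex : Example N} {st : State n} {emp : (Fin n → ℝ) → ℝ}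
    {τ : ℝ} {V : Set (Fin n → ℝ)} (hst : Tracks emp τ V st.best) {x : ℝ≥0∞}
    (hx : failProb (approxRisk access P T test (normalized st.weights))
      (fun r => |r - emp (predictor P st.weights)| ≤ τ) ≤ x) :
    failProb (oneRound access P T test ex st) (fun s => s.weights = nextWeights P φ st.weights ex ∧
      Tracks emp τ (insert (predictor P st.weights) V) s.best) ≤ x := by
  classical
  refine (ensures_normalizeWeights _).failProb_bind_le ?_
  rintro _ rfl
  refine (ensures_innerProduct _ (hacc _)).failProb_bind_le ?_
  rintro _ rfl
  iterate 4 rw [failProb_exec_bind rfl]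
  refine (ensures_updateWeights _ _ (hacc _) _).failProb_bind_le ?_
  rintro _ rfl
  refine (failProb_bind_le (x := 0) ?_).trans ((add_zero _).trans_le hx)
  intro r hr
  rw [failProb_exec_bind rfl]
  rw [abs_le] at hr
  rcases h : st.best with _ | b
  · rw [h] at hst
    refine Ensures.failProb_bind_le (ensures_pure rfl) (P := fun b => b = true) ?_
    rintro _ rfl
    refine (ensures_scale _ _).failProb_bind_le ?_
    rintro _ rfl
    refine le_of_eq (failProb_pure ⟨rfl, Set.mem_insert _ _, abs_le.2 hr, ?_⟩)
    rintro u (rfl | hu)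
    · linarith [hr.2]
    · rw [show V = ∅ from hst] at hu
      exact absurd hu (Set.notMem_empty _)
  · rw [h] at hst
    refine (ensures_exec_pure (i := .less r b.1) rfl).failProb_bind_le ?_
    rintro _ rfl
    beta_reduce
    by_cases hrb : r < b.1
    · rw [if_pos (decide_eq_true hrb)]
      refine (ensures_scale _ _).failProb_bind_le ?_
      rintro _ rfl
      refine le_of_eq (failProb_pure ⟨rfl, Set.mem_insert _ _, abs_le.2 hr, ?_⟩)
      rintro u (rfl | hu)
      · linarith [hr.2]
      · exact hrb.le.trans (hst.2.2 u hu)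
    · rw [if_neg (by simpa using hrb)]
      refine le_of_eq (failProb_pure ⟨rfl, Set.mem_insert_of_mem _ hst.1, hst.2.1, ?_⟩)
      rintro u (rfl | hu)
      · linarith [hr.2, not_lt.1 hrb]
      · exact hst.2.2 u hu

/-- The internal randomness does not influence the weights, so a bound for the estimates along
deterministic trajectories suffices for a union bound over the rounds. -/
theorem failProb_stateAfter_le [NeZero n] (hacc : ∀ x, Reads (access x) a (φ x)) {P : Params}
    {T : ℕ} {test : Fin M → Example N} {emp : (Fin n → ℝ) → ℝ} {τ : ℝ} {x : ℝ≥0∞} {t : ℕ}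
    (hx : ∀ (t : ℕ) (train : Fin t → Example N), failProb (approxRisk access P T test
      (normalized (weightsAfter P φ t train)))
      (fun r => |r - emp (predictor P (weightsAfter P φ t train))| ≤ τ) ≤ x)
    (train : Fin t → Example N) :
    failProb (stateAfter access P T test train) (fun s => s.weights = weightsAfter P φ t train ∧
      Tracks emp τ (visited P φ t train) s.best) ≤ t * x := by
  induction t with
  | zero =>
    change failProb (initState n >>= fun s => pure s) _ ≤ _
    refine (ensures_initState n).failProb_bind_le ?_
    rintro _ rfl
    exact (failProb_pure ⟨rfl, rfl⟩).le.trans bot_le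
  | succ t ih =>
    rw [stateAfter_succ]
    refine (failProb_bind_le (x := x) ?_).trans ((add_le_add (ih (Fin.init train)) le_rfl).trans_eq
      (by push_cast; ring))
    rintro ⟨w, b⟩ ⟨hw, hb⟩
    simp only at hw hb
    subst hw
    rw [failProb_exec_bind rfl]
    exact failProb_oneRound_le hacc hb (hx t (Fin.init train))

/-- With high probability, the output almost minimizes the empirical risk among the candidates. -/
theorem failProb_learn_le [NeZero n] (hacc : ∀ x, Reads (access x) a (φ x)) {P : Params}
    {T : ℕ} (hT : 0 < T) {train : Fin T → Example N} {test : Fin M → Example N}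
    {emp : (Fin n → ℝ) → ℝ} {τ : ℝ} {x : ℝ≥0∞}
    (hx : ∀ (t : ℕ) (train : Fin t → Example N), failProb (approxRisk access P T test
      (normalized (weightsAfter P φ t train)))
      (fun r => |r - emp (predictor P (weightsAfter P φ t train))| ≤ τ) ≤ x) :
    failProb (learn access P train test) (fun u => u ∈ visited P φ T train ∧
      ∀ v ∈ visited P φ T train, emp u ≤ emp v + 2 * τ) ≤ T * x := by
  refine (failProb_bind_le (x := 0) ?_).trans ((add_zero _).trans_le
    (failProb_stateAfter_le hacc hx train))
  rintro ⟨w, b⟩ ⟨-, hb⟩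
  rw [failProb_exec_bind rfl]
  cases b with
  | none =>
    obtain ⟨t, rfl⟩ := Nat.exists_eq_succ_of_ne_zero hT.ne'
    simp only [Tracks, visited] at hb
    exact absurd hb (Set.insert_nonempty _ _).ne_empty
  | some b =>
    refine le_of_eq (failProb_pure ⟨hb.1, fun v hv => ?_⟩)
    -- The error `τ` enters twice: once for the stored vector and once for its competitor.
    linarith [hb.2.2 v hv, (abs_le.1 hb.2.1).1]

end Rounds

/-! ### Run time -/

section RunTime

variable {N n M : ℕ}

/-- The vector `(x, -x, 0)`. -/
def signedFeatures (x : Fin N → ℝ) (j : Fin (2 * N + 1)) : ℝ :=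
  if h : j.val < N then x ⟨j.val, h⟩
  else if h' : j.val < 2 * N then -x ⟨j.val - N, by omega⟩ else 0

/-- The true cost is one; five is the cost of `signedAccess`, so that one cost analysis covers both
versions. -/
theorem reads_plainAccess (x : Fin N → ℝ) : Reads (plainAccess x) 5 x :=
  fun j => Ensures.mono (b := 1) (ensures_exec_pure rfl) (by norm_num) fun _ h => h

theorem reads_signedAccess (x : Fin N → ℝ) : Reads (signedAccess x) 5 (signedFeatures x) := by
  intro j
  unfold signedAccess signedFeatures
  iterate 2 refine Ensures.exec_bind rfl ?_
  split_ifs with h h'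
  · exact Ensures.mono (b := 1) (ensures_exec_pure rfl) (by norm_num) fun _ h => h
  · iterate 2 refine Ensures.exec_bind rfl ?_
    exact ensures_exec_of rfl (zero_sub _)
  · exact (ensures_pure rfl).mono (by norm_num) fun _ h => h.symm

/-- The coefficients on `x` of a linear form in the features `(x, -x, 0)`. -/
def unsigned (u : Fin (2 * N + 1) → ℝ) (j : Fin N) : ℝ :=
  u ⟨j.val, by omega⟩ - u ⟨N + j.val, by omega⟩

theorem ensures_unsignedLoop (u : Fin (2 * N + 1) → ℝ) :
    Ensures (loop N (fun j v => do
      exec .index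
      let a ← exec (.read u ⟨j.val, by omega⟩)
      let b ← exec (.read u ⟨N + j.val, by omega⟩)
      let c ← exec (.sub a b)
      exec (.write v j c)) (fun _ => 0)) (N * 6) fun v => v = unsigned u := by
  refine ensures_loop_write fun j A _ => ?_
  iterate 4 refine Ensures.exec_bind rfl ?_
  exact ensures_exec_of rfl rfl

theorem numReps_le {lam eps delta : ℝ} {act : ℝ → ℝ} {m T M : ℕ} {X : ℝ} (hT : 1 ≤ T)
    (hdelta : 0 < delta) (h3 : 3 ≤ X) (hTX : T ≤ X) (hMX : M ≤ X) (hdX : 1 / delta ≤ X) :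
    (numReps (parameters act lam eps delta m T) T M : ℝ) ≤ 25 * Real.log X := by
  have hL : 1 ≤ Real.log X := by
    rw [← Real.log_exp 1]
    exact Real.log_le_log (Real.exp_pos _) (by linarith [Real.exp_one_lt_d9])
  have hT' : (1 : ℝ) ≤ T := by exact_mod_cast hT
  have key : Real.log (M * T / (delta / 3)) ≤ 4 * Real.log X := by
    rcases Nat.eq_zero_or_pos M with rfl | hM
    · simp; linarith
    · have hM' : (1 : ℝ) ≤ M := by exact_mod_cast hM
      rw [show 4 * Real.log X = Real.log (X ^ 4) by rw [Real.log_pow]; norm_num]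
      refine Real.log_le_log (by positivity) ?_
      -- The four factors `M`, `T`, `1/δ` and `3` are each at most `X`; the `3` comes from `δ' = δ /
      -- 3`.
      rw [show (M : ℝ) * T / (delta / 3) = M * T * (1 / delta) * 3 by field_simp]
      calc (M : ℝ) * T * (1 / delta) * 3 ≤ X * X * X * X := by gcongr
        _ = X ^ 4 := by ring
  have h0 : 0 ≤ Real.log X := by linarith
  calc (numReps (parameters act lam eps delta m T) T M : ℝ) ≤ (⌈24 * Real.log X⌉₊ : ℝ) := by
        refine Nat.cast_le.2 (Nat.ceil_mono ?_)
        simp only [parameters]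
        linarith
    _ ≤ 24 * Real.log X + 1 := (Nat.ceil_lt_add_one (by positivity)).le
    _ ≤ _ := by linarith

theorem numSamples_le {lam eps delta : ℝ} {act : ℝ → ℝ} {m T : ℕ} (hlam : 0 ≤ lam)
    (heps : 0 < eps) (heps1 : eps < 1) :
    (numSamples (parameters act lam eps delta m T) : ℝ) ≤ 1153 * (max 1 lam ^ 2 / eps ^ 2) := by
  have h1 : 1 ≤ max 1 lam ^ 2 / eps ^ 2 := by
    rw [one_le_div (by positivity)]
    have : (1 : ℝ) ≤ max 1 lam := le_max_left _ _
    nlinarith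
  have h2 : lam ^ 2 / eps ^ 2 ≤ max 1 lam ^ 2 / eps ^ 2 := by
    gcongr
    exact le_max_right _ _
  simp only [numSamples, parameters, Nat.cast_max, Nat.cast_one]
  refine max_le (by linarith) ?_
  calc _ ≤ 9 / 2 * (16 * lam / eps * (16 * lam / eps)) + 1 :=
        (Nat.ceil_lt_add_one (by positivity)).le
    _ = 1152 * (lam ^ 2 / eps ^ 2) + 1 := by field_simp; ring
    _ ≤ _ := by linarith

/-- Bounds the depth of the bisection. The hypothesis has `X ^ 2` because the dimension `2 N + 1`
may exceed `X`. -/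
theorem clog_le {n : ℕ} {X : ℝ} (hn : 1 ≤ n) (h3 : 3 ≤ X) (hnX : (n : ℝ) ≤ X ^ 2) :
    (Nat.clog 2 n : ℝ) ≤ 5 * Real.log X := by
  have hL : 1 ≤ Real.log X := by
    rw [← Real.log_exp 1]
    exact Real.log_le_log (Real.exp_pos _) (by linarith [Real.exp_one_lt_d9])
  have hn' : (1 : ℝ) ≤ n := by exact_mod_cast hn
  rcases Nat.lt_or_ge 1 n with h | h
  · have h1 : 2 ^ (Nat.clog 2 n).pred < n := Nat.pow_pred_clog_lt_self one_lt_two h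
    have h2 : (2 : ℝ) ^ (Nat.clog 2 n).pred ≤ X ^ 2 := le_trans (by exact_mod_cast h1.le) hnX
    have h3' := Real.log_le_log (by positivity) h2
    rw [Real.log_pow, Real.log_pow] at h3'
    have h4 : (Nat.clog 2 n : ℝ) = (Nat.clog 2 n).pred + 1 := by
      have : 0 < Nat.clog 2 n := Nat.clog_pos one_lt_two h
      have : Nat.clog 2 n = (Nat.clog 2 n).pred + 1 := (Nat.succ_pred_eq_of_pos this).symm
      exact_mod_cast this
    rw [h4]
    have h5 := Real.log_two_gt_d9
    have h6 : (0 : ℝ) ≤ ((Nat.clog 2 n).pred : ℝ) := Nat.cast_nonneg _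
    push_cast at h3'
    nlinarith
  · have : n = 1 := by omega
    subst this
    simp
    linarith

/-- The dominant term per test example is `K q d`: repetitions and bisection depth contribute one
logarithm each, whence the exponent two, and `q` contributes `B = max(1, λ)² / ε²`. The quadratic
cost of the median is `O(L ^ 2)` as well. -/
theorem oneRoundCost_le {lam eps delta : ℝ} {act : ℝ → ℝ} {n N T M : ℕ} (hn : 1 ≤ n)
    (hN : 1 ≤ N) (hnN : n ≤ 2 * N + 1) (hT : 1 ≤ T) (hlam : 0 ≤ lam) (heps : 0 < eps)
    (heps1 : eps < 1) (hdelta : 0 < delta) (hdelta1 : delta < 1) :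
    1 ≤ Real.log (2 + N + T + M + lam + 1 / eps + 1 / delta) ∧ 
    (oneRoundCost (parameters act lam eps delta n T) n T M 5 (Nat.clog 2 n) : ℝ) ≤
      polylog 2000000 2 N T M lam eps delta * roundCost N M lam eps delta := by
  have hN' : (1 : ℝ) ≤ N := by exact_mod_cast hN
  have hT' : (1 : ℝ) ≤ T := by exact_mod_cast hT
  have hM' : (0 : ℝ) ≤ M := Nat.cast_nonneg _
  have he1 : 1 ≤ 1 / eps := by rw [one_le_div heps]; exact heps1.le
  have hd1 : 1 ≤ 1 / delta := by rw [one_le_div hdelta]; exact hdelta1.le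
  rw [polylog, roundCost]
  set X := 2 + (N : ℝ) + T + M + lam + 1 / eps + 1 / delta with hX
  have h3 : 3 ≤ X := by linarith
  have hL : 1 ≤ Real.log X := by
    rw [← Real.log_exp 1]
    exact Real.log_le_log (Real.exp_pos _) (by linarith [Real.exp_one_lt_d9])
  refine ⟨hL, ?_⟩
  have hnR : (n : ℝ) ≤ 2 * N + 1 := by exact_mod_cast hnN
  have hK := numReps_le (lam := lam) (eps := eps) (act := act) (m := n) (T := T) (M := M) hT hdelta
    h3 (by linarith) (by linarith) (by linarith)
  have hq := numSamples_le (delta := delta) (act := act) (m := n) (T := T) hlam heps heps1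
  have hd := clog_le (X := X) hn h3 (by nlinarith)
  simp only [oneRoundCost, approxRiskCost]
  push_cast
  set L := Real.log X
  set K := (numReps (parameters act lam eps delta n T) T M : ℝ)
  set q := (numSamples (parameters act lam eps delta n T) : ℝ)
  set d := (Nat.clog 2 n : ℝ)
  set B := max 1 lam ^ 2 / eps ^ 2
  have hΛ : (1 : ℝ) ≤ max 1 lam := le_max_left _ _
  have hB1 : 1 ≤ B := by
    rw [one_le_div (by positivity)]
    nlinarith
  have hK0 : 0 ≤ K := Nat.cast_nonneg _
  have hq0 : 0 ≤ q := Nat.cast_nonneg _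
  have hd0 : 0 ≤ d := Nat.cast_nonneg _
  have hL0 : 0 ≤ L := by linarith
  have hB0 : 0 ≤ B := by linarith
  have hL2 : 1 ≤ L ^ 2 := by nlinarith
  have hLB : L ^ 2 ≤ L ^ 2 * B := le_mul_of_one_le_right (by positivity) hB1
  have hBL : 1 ≤ B * L := by nlinarith
  have h1 : K * (q * (10 * d + 5 + 3) + 3) ≤ 1672000 * (L ^ 2 * B) := by
    calc _ ≤ (25 * L) * ((1153 * B) * (58 * L) + 3 * (B * L)) := by
          gcongr
          · linarith
          · linarith
      _ = 1671925 * (L ^ 2 * B) := by ring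
      _ ≤ _ := by nlinarith
  have h2 : K * (6 * K + 4) ≤ 3850 * L ^ 2 := by
    calc _ ≤ (25 * L) * (6 * (25 * L) + 4 * L) := by
          gcongr
          linarith
      _ = _ := by ring
  have h3 : K * (q * (10 * d + 5 + 3) + 3) + K * (6 * K + 4) + 7 ≤ 2000000 * (L ^ 2 * B) := by
    linarith
  -- The claimed bound has room to spare: the analysis needs only the square of `max 1 λ`, and `log
  -- (1/δ)` is already contained in `L`.
  have h4 : B ≤ max 1 lam ^ 4 * max 1 (Real.log (1 / delta)) / eps ^ 2 := by
    refine div_le_div_of_nonneg_right ?_ (by positivity)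
    calc max 1 lam ^ 2 ≤ max 1 lam ^ 4 := pow_le_pow_right₀ hΛ (by norm_num)
      _ ≤ _ := le_mul_of_one_le_right (by positivity) (le_max_left _ _)
  have h5 : (n : ℝ) * (2 * 5 + 23) + 6 + (4 * n + 13) ≤ 2000000 * L ^ 2 * N := by
    have : (N : ℝ) ≤ L ^ 2 * N := le_mul_of_one_le_left (by linarith) hL2
    linarith
  calc _ = (n : ℝ) * (2 * 5 + 23) + 6 + (4 * n + 13) +
        M * (K * (q * (10 * d + 5 + 3) + 3) + K * (6 * K + 4) + 7) := by ring
    _ ≤ 2000000 * L ^ 2 * N + M * (2000000 * (L ^ 2 * 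
        (max 1 lam ^ 4 * max 1 (Real.log (1 / delta)) / eps ^ 2))) := by
        refine add_le_add h5 (mul_le_mul_of_nonneg_left (h3.trans ?_) hM')
        gcongr
    _ = _ := by ring

theorem le_roundCost (N M : ℕ) (lam eps delta : ℝ) : (N : ℝ) ≤ roundCost N M lam eps delta := by
  rw [roundCost, le_add_iff_nonneg_right]
  positivity

theorem polylog_mono {C C' : ℝ} (h : C ≤ C') {k N T M : ℕ} {lam eps delta : ℝ}
    (hL : 1 ≤ Real.log (2 + N + T + M + lam + 1 / eps + 1 / delta)) :
    polylog C k N T M lam eps delta ≤ polylog C' k N T M lam eps delta := by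
  unfold polylog
  gcongr

theorem stepsLE_oneRound {lam eps delta : ℝ} {act : ℝ → ℝ} {n N T M : ℕ} [NeZero n]
    (hN : 1 ≤ N) (hnN : n ≤ 2 * N + 1) (hT : 1 ≤ T) (hlam : 0 ≤ lam) (heps : 0 < eps)
    (heps1 : eps < 1) (hdelta : 0 < delta) (hdelta1 : delta < 1) {C' : ℝ} (hC' : 3000000 ≤ C')
    {access : (Fin N → ℝ) → Fin n → RAM ℝ} {φ : (Fin N → ℝ) → Fin n → ℝ}
    (hacc : ∀ x, Reads (access x) 5 (φ x)) (test : Fin M → Example N) (ex : Example N)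
    (s : State n) :
    StepsLE (oneRound access (parameters act lam eps delta n T) T test ex s)
      (polylog C' 2 N T M lam eps delta * roundCost N M lam eps delta) := by
  obtain ⟨hL, h⟩ := oneRoundCost_le (act := act) (M := M) (Nat.pos_of_neZero n) hN hnN hT hlam
    heps heps1 hdelta hdelta1
  refine (ensures_oneRound hacc _ T test ex s (Nat.le_pow_clog one_lt_two n)).stepsLE
    (h.trans (mul_le_mul_of_nonneg_right (polylog_mono (by linarith) hL) ?_))
  exact (Nat.cast_nonneg _).trans (le_roundCost _ _ _ _ _)

/-- The total cost of the algorithm with some linear overhead. -/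
theorem total_cost_le {lam eps delta : ℝ} {act : ℝ → ℝ} {n N T M : ℕ} (hn : 1 ≤ n)
    (hN : 1 ≤ N) (hnN : n ≤ 2 * N + 1) (hT : 1 ≤ T) (hlam : 0 ≤ lam) (heps : 0 < eps)
    (heps1 : eps < 1) (hdelta : 0 < delta) (hdelta1 : delta < 1) {C' : ℝ} (hC' : 3000000 ≤ C') :
    (((2 * n + 2 + T * (oneRoundCost (parameters act lam eps delta n T) n T M 5
      (Nat.clog 2 n) + 1)) + N * 6 : ℕ) : ℝ) ≤
      polylog C' 2 N T M lam eps delta * (T * roundCost N M lam eps delta) := by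
  obtain ⟨hL, h⟩ := oneRoundCost_le (act := act) (M := M) hn hN hnN hT hlam
    heps heps1 hdelta hdelta1
  have hr := le_roundCost N M lam eps delta
  have hN' : (1 : ℝ) ≤ N := by exact_mod_cast hN
  have hT' : (1 : ℝ) ≤ T := by exact_mod_cast hT
  have hnR : (n : ℝ) ≤ 2 * N + 1 := by exact_mod_cast hnN
  push_cast
  refine le_trans ?_ (mul_le_mul_of_nonneg_right (polylog_mono hC' hL)
    (mul_nonneg (Nat.cast_nonneg _) ((Nat.cast_nonneg _).trans hr)))
  set R := roundCost N M lam eps delta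
  set o := (oneRoundCost (parameters act lam eps delta n T) n T M 5 (Nat.clog 2 n) : ℝ)
  simp only [polylog] at h ⊢
  set L := Real.log (2 + N + T + M + lam + 1 / eps + 1 / delta)
  have hL2 : 1 ≤ L ^ 2 := by nlinarith
  have h1 : (2 : ℝ) * n + 2 + 1 + N * 6 ≤ 1000000 * L ^ 2 * R := by
    have : R ≤ L ^ 2 * R := le_mul_of_one_le_left (by linarith) hL2
    linarith
  calc (2 : ℝ) * n + 2 + T * (o + 1) + N * 6 
      ≤ T * (2 * n + 2 + N * 6) + T * (o + 1) := by
        have : (2 : ℝ) * n + 2 + N * 6 ≤ T * (2 * n + 2 + N * 6) :=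
          le_mul_of_one_le_left (by positivity) hT'
        linarith
    _ = T * ((2 * n + 2 + 1 + N * 6) + o) := by ring
    _ ≤ T * (1000000 * L ^ 2 * R + 2000000 * L ^ 2 * R) := by gcongr
    _ = _ := by ring

theorem stepsLE_sparsitron {lam eps delta : ℝ} {act : ℝ → ℝ} {N T M : ℕ} [NeZero N]
    (hT : 1 ≤ T) (hlam : 0 ≤ lam) (heps : 0 < eps) (heps1 : eps < 1) (hdelta : 0 < delta)
    (hdelta1 : delta < 1) {C' : ℝ} (hC' : 3000000 ≤ C') (train : Fin T → Example N)
    (test : Fin M → Example N) :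
    StepsLE (sparsitron (parameters act lam eps delta N T) train test)
      (polylog C' 2 N T M lam eps delta * (T * roundCost N M lam eps delta)) := by
  have hN : 1 ≤ N := Nat.pos_of_neZero N
  refine (ensures_learn reads_plainAccess _ hT train test
    (Nat.le_pow_clog one_lt_two N)).stepsLE (le_trans (Nat.cast_le.2 (Nat.le_add_right _ (N * 6)))
    (total_cost_le hN hN (by omega) hT hlam heps heps1 hdelta hdelta1 hC'))

theorem stepsLE_sparsitronSigned {lam eps delta : ℝ} {act : ℝ → ℝ} {N T M : ℕ} [NeZero N]
    (hT : 1 ≤ T) (hlam : 0 ≤ lam) (heps : 0 < eps) (heps1 : eps < 1) (hdelta : 0 < delta)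
    (hdelta1 : delta < 1) {C' : ℝ} (hC' : 3000000 ≤ C') (train : Fin T → Example N)
    (test : Fin M → Example N) :
    StepsLE (sparsitronSigned (parameters act lam eps delta (2 * N + 1) T) train test)
      (polylog C' 2 N T M lam eps delta * (T * roundCost N M lam eps delta)) := by
  have hN : 1 ≤ N := Nat.pos_of_neZero N
  exact ((ensures_learn reads_signedAccess _ hT train test
    (Nat.le_pow_clog one_lt_two (2 * N + 1))).bind (Q := fun _ => True) fun u _ =>
    (ensures_unsignedLoop u).mono le_rfl fun _ _ => trivial).stepsLE
    (total_cost_le (by omega) hN le_rfl hT hlam heps heps1 hdelta hdelta1 hC')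

/-! ### Number of samples -/

theorem log_div_le_two_mul_log_div {n N : ℕ} (hn : 1 ≤ n) (hN : 1 ≤ N) (hnN : n ≤ 2 * N + 1)
    {c : ℝ} (hc : 0 < c) (hc1 : c < 1) :
    Real.log (n / c) ≤ 2 * Real.log (2 * N / c) := by
  have hn' : (1 : ℝ) ≤ n := by exact_mod_cast hn
  have hN' : (1 : ℝ) ≤ N := by exact_mod_cast hN
  have hnN' : (n : ℝ) ≤ 2 * N + 1 := by exact_mod_cast hnN
  rw [show 2 * Real.log (2 * N / c) = Real.log ((2 * N / c) ^ 2) by rw [Real.log_pow]; norm_num]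
  refine Real.log_le_log (by positivity) ?_
  -- `2 N + 1 ≤ (2 N) ^ 2` for `N ≥ 1`; squaring `c < 1` only enlarges the quotient.
  calc (n : ℝ) / c ≤ (2 * N) ^ 2 / c := by
        gcongr
        nlinarith
    _ ≤ (2 * N) ^ 2 / c ^ 2 := by
        gcongr
        nlinarith
    _ = _ := by rw [div_pow]

-- Both sizes are the least integers allowed by the constants, with `T` doubled to serve dimension
-- `2 N + 1` too. The total is dominated by the bound for `T` because `log (2 T / δ)` is itself `O(Λ
-- ^ 2 ℓ)`.
set_option maxHeartbeats 1000000 in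
theorem exists_sampleSizes {N : ℕ} (hN : 1 ≤ N) {lam eps delta : ℝ} (hlam : 0 ≤ lam)
    (heps : 0 < eps) (heps1 : eps < 1) (hdelta : 0 < delta) (hdelta1 : delta < 1) {C' : ℝ}
    (hC' : 30000 ≤ C') :
    ∃ T M : ℕ, SampleSizes 1024 N lam eps delta T M ∧
      SampleSizes 1024 (2 * N + 1) lam eps delta T M ∧
      (T : ℝ) ≤ C' * max 1 lam ^ 2 * Real.log (2 * N / (delta * eps)) / eps ^ 2 ∧
      (M : ℝ) ≤ C' * Real.log (2 * T / delta) / eps ^ 2 ∧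
      (T + M : ℝ) ≤ C' * max 1 lam ^ 2 * Real.log (2 * N / (delta * eps)) / eps ^ 2 := by
  have hN' : (1 : ℝ) ≤ N := by exact_mod_cast hN
  have hde : 0 < delta * eps := by positivity
  have hde1 : delta * eps < 1 := by nlinarith
  set A := 2 * (N : ℝ) / (delta * eps) with hA
  have hA2 : 2 ≤ A := by
    rw [hA, le_div_iff₀ hde]
    nlinarith
  have hℓ0 : Real.log 2 ≤ Real.log A := Real.log_le_log (by norm_num) hA2
  have hℓ : 1 / 2 ≤ Real.log A := by linarith [Real.log_two_gt_d9]
  set ℓ := Real.log A with hℓdef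
  set Λ := max 1 lam
  have hΛ : 1 ≤ Λ := le_max_left _ _
  have hΛ2 : 1 ≤ Λ ^ 2 := by nlinarith
  have he2 : eps ^ 2 ≤ 1 := by nlinarith
  have he2' : 0 < eps ^ 2 := by positivity
  set B := Λ ^ 2 * ℓ / eps ^ 2 with hB
  have hΛℓ : 1 / 2 ≤ Λ ^ 2 * ℓ := by nlinarith
  have hBΛ : Λ ^ 2 * ℓ ≤ B := by
    rw [hB, le_div_iff₀ he2']
    nlinarith
  -- `2048 = 2 · 1024`, the factor two coming from `log_div_le_two_mul_log_div`. Rounding up costs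
  -- at most `2 B`, since `B ≥ 1/2`.
  obtain ⟨T, hTdef⟩ : ∃ T : ℕ, T = ⌈2048 * B⌉₊ := ⟨_, rfl⟩
  have hT1 : 2048 * B ≤ T := hTdef ▸ Nat.le_ceil _
  have hT2 : (T : ℝ) ≤ 2050 * B := by
    have := (Nat.ceil_lt_add_one (show 0 ≤ 2048 * B by linarith)).le
    rw [← hTdef] at this
    linarith
  have hT0 : (1 : ℝ) ≤ T := by linarith
  have hTd : 1 ≤ T / delta := by
    rw [one_le_div hdelta]
    linarith
  have hlogT : 0 ≤ Real.log (T / delta) := Real.log_nonneg hTd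
  obtain ⟨M, hMdef⟩ : ∃ M : ℕ, M = ⌈1024 * Real.log (T / delta) / eps ^ 2⌉₊ := ⟨_, rfl⟩
  have hM1 : 1024 * Real.log (T / delta) / eps ^ 2 ≤ M := hMdef ▸ Nat.le_ceil _
  have hM2 : (M : ℝ) ≤ 1026 * (Real.log (2 * T / delta) / eps ^ 2) := by
    have h1 : (M : ℝ) ≤ 1024 * Real.log (T / delta) / eps ^ 2 + 1 := by
      rw [hMdef]
      exact (Nat.ceil_lt_add_one (by positivity)).le
    have h2 : Real.log (2 * T / delta) = Real.log 2 + Real.log (T / delta) := by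
      rw [mul_div_assoc, Real.log_mul (by norm_num) (by positivity)]
    have h3 : 1 / 2 ≤ Real.log (2 * T / delta) / eps ^ 2 := by
      rw [le_div_iff₀ he2', h2]
      nlinarith [Real.log_two_gt_d9]
    have h4 : Real.log (T / delta) / eps ^ 2 ≤ Real.log (2 * T / delta) / eps ^ 2 := by
      gcongr
      linarith
    rw [mul_div_assoc] at h1
    linarith
  -- `2 T / δ` is polynomial in `Λ` and `A`. After taking logarithms, `13 log 2`, `2 log Λ` and `3
  -- ℓ` are at most `13`, `4` and `3` times `Λ ^ 2 ℓ`.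
  have hlog2T : Real.log (2 * T / delta) ≤ 20 * (Λ ^ 2 * ℓ) := by
    have h0 : (2 : ℝ) * T / delta ≤ 2 ^ 13 * Λ ^ 2 * A ^ 3 := by
      have h1 : ℓ ≤ A := (Real.log_le_sub_one_of_pos (by linarith)).trans (by linarith)
      have h2 : 1 / (delta * eps) ≤ A := by
        rw [hA]
        gcongr
        linarith
      have h3 : 1 / (eps ^ 2 * delta) ≤ A ^ 2 := by
        calc 1 / (eps ^ 2 * delta) ≤ (1 / (delta * eps)) ^ 2 := by
              rw [div_pow, one_pow]
              gcongr
              nlinarith [mul_pos he2' hdelta]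
          _ ≤ A ^ 2 := by gcongr
      calc (2 : ℝ) * T / delta ≤ 2 * (2050 * B) / delta := by gcongr
        _ = 4100 * Λ ^ 2 * ℓ * (1 / (eps ^ 2 * delta)) := by
            rw [hB]
            field_simp
            ring
        _ ≤ 2 ^ 13 * Λ ^ 2 * A * A ^ 2 := by
            gcongr
            norm_num
        _ = _ := by ring
    have h1 := Real.log_le_log (by positivity) h0
    rw [Real.log_mul (by positivity) (by positivity), Real.log_mul (by positivity) (by positivity),
      Real.log_pow, Real.log_pow, Real.log_pow] at h1
    have h2 : Real.log Λ ≤ Λ := (Real.log_le_sub_one_of_pos (by linarith)).trans (by linarith)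
    have h3 : ℓ ≤ Λ ^ 2 * ℓ := le_mul_of_one_le_left (by linarith) hΛ2
    have h4 : Λ ≤ Λ ^ 2 := by nlinarith
    have h5 : Λ ^ 2 ≤ 2 * (Λ ^ 2 * ℓ) := by nlinarith
    push_cast at h1
    linarith
  have hsizes : ∀ n : ℕ, 1 ≤ n → n ≤ 2 * N + 1 → SampleSizes 1024 n lam eps delta T M := by
    intro n hn hnN
    have hn' : (1 : ℝ) ≤ n := by exact_mod_cast hn
    have hnN' : (n : ℝ) ≤ 2 * N + 1 := by exact_mod_cast hnN
    have h1 : Real.log (n / (delta * eps)) ≤ 2 * ℓ :=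
      log_div_le_two_mul_log_div hn hN hnN hde hde1
    refine ⟨?_, ?_, hM1⟩
    · calc Real.log n ≤ Real.log (n / (delta * eps)) := by
            refine Real.log_le_log (by linarith) ?_
            exact (le_div_iff₀ hde).2 (mul_le_of_le_one_right (by linarith) hde1.le)
        _ ≤ 2 * ℓ := h1
        _ < T := by
            have : ℓ ≤ Λ ^ 2 * ℓ := le_mul_of_one_le_left (by linarith) hΛ2
            linarith
    · have h2 : lam ^ 2 ≤ Λ ^ 2 := by
        gcongr
        exact le_max_right _ _
      calc 1024 * lam ^ 2 * Real.log (n / (delta * eps)) / eps ^ 2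
          ≤ 1024 * Λ ^ 2 * (2 * ℓ) / eps ^ 2 := by
            refine div_le_div_of_nonneg_right ?_ he2'.le
            exact (mul_le_mul_of_nonneg_left h1 (by positivity)).trans (by gcongr)
        _ = 2048 * B := by rw [hB]; ring
        _ ≤ T := hT1
  have hM3 : (M : ℝ) ≤ 20520 * B := by
    calc (M : ℝ) ≤ 1026 * (20 * (Λ ^ 2 * ℓ) / eps ^ 2) := hM2.trans (by gcongr)
      _ = _ := by rw [hB]; ring
  have hB0 : 0 ≤ B := by linarith
  have hC'B : C' * Λ ^ 2 * ℓ / eps ^ 2 = C' * B := by rw [hB]; ring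
  refine ⟨T, M, hsizes N hN (by omega), hsizes (2 * N + 1) (by omega) le_rfl, ?_, ?_, ?_⟩
  · rw [hC'B]
    exact hT2.trans (mul_le_mul_of_nonneg_right (by linarith) hB0)
  · rw [mul_div_assoc]
    refine hM2.trans (mul_le_mul_of_nonneg_right (by linarith) (div_nonneg ?_ he2'.le))
    refine Real.log_nonneg ?_
    rw [mul_div_assoc]
    linarith
  · rw [hC'B]
    have := mul_le_mul_of_nonneg_right hC' hB0
    linarith

end RunTime

/-! ### Concentration for adaptive sums -/

section Concentration

variable {Ω : Type*}

/-- The sum of `g t (x 0, …, x (t - 1)) (x t)` over `t < T`. -/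
def prefixSum (g : (t : ℕ) → (Fin t → Ω) → Ω → ℝ) : (T : ℕ) → (Fin T → Ω) → ℝ
  | 0, _ => 0
  | T + 1, x => prefixSum g T (Fin.init x) + g T (Fin.init x) (x (Fin.last T))

theorem prefixSum_const (g : Ω → ℝ) (T : ℕ) (x : Fin T → Ω) :
    prefixSum (fun _ _ ω => g ω) T x = ∑ i, g (x i) := by
  induction T with
  | zero => simp [prefixSum]
  | succ T ih =>
    rw [prefixSum, ih, Fin.sum_univ_castSucc]
    rfl

theorem prefixSum_add (g h : (t : ℕ) → (Fin t → Ω) → Ω → ℝ) (T : ℕ) (x : Fin T → Ω) :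
    prefixSum (fun t p ω => g t p ω + h t p ω) T x = prefixSum g T x + prefixSum h T x := by
  induction T with
  | zero => simp [prefixSum]
  | succ T ih =>
    simp only [prefixSum, ih]
    ring

theorem prefixSum_const_mul (c : ℝ) (g : (t : ℕ) → (Fin t → Ω) → Ω → ℝ) (T : ℕ)
    (x : Fin T → Ω) :
    prefixSum (fun t p ω => c * g t p ω) T x = c * prefixSum g T x := by
  induction T with
  | zero => simp [prefixSum]
  | succ T ih =>
    simp only [prefixSum, ih]
    ring

theorem prefixSum_sum {ι : Type*} (s : Finset ι) (g : ι → (t : ℕ) → (Fin t → Ω) → Ω → ℝ) (T : ℕ)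
    (x : Fin T → Ω) :
    prefixSum (fun t p ω => ∑ i ∈ s, g i t p ω) T x = ∑ i ∈ s, prefixSum (g i) T x := by
  induction T with
  | zero => simp [prefixSum]
  | succ T ih => simp only [prefixSum, ih, Finset.sum_add_distrib]

theorem prefixSum_mono {g h : (t : ℕ) → (Fin t → Ω) → Ω → ℝ} {s : Set Ω} {T : ℕ}
    {x : Fin T → Ω} (hx : ∀ i, x i ∈ s) (hgh : ∀ t p, ∀ ω ∈ s, g t p ω ≤ h t p ω) :
    prefixSum g T x ≤ prefixSum h T x := by
  induction T with
  | zero => simp [prefixSum]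
  | succ T ih => exact add_le_add (ih fun i => hx i.castSucc) (hgh _ _ _ (hx _))

variable [MeasurableSpace Ω]

theorem measurable_init {T : ℕ} :
    Measurable (Fin.init : (Fin (T + 1) → Ω) → Fin T → Ω) :=
  measurable_pi_lambda _ fun i => measurable_pi_apply i.castSucc

theorem measurable_prefixSum {g : (t : ℕ) → (Fin t → Ω) → Ω → ℝ}
    (hg : ∀ t, Measurable fun z : (Fin t → Ω) × Ω => g t z.1 z.2) (T : ℕ) :
    Measurable (prefixSum g T) := by
  induction T with
  | zero => exact measurable_const
  | succ T ih =>
    exact (ih.comp measurable_init).add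
      ((hg T).comp (measurable_init.prodMk (measurable_pi_apply (Fin.last T))))

variable (D : Measure Ω) [IsProbabilityMeasure D]

/-- Tonelli for the last coordinate. The equivalence used puts the separated coordinate first, hence
the swap. -/
theorem lintegral_pi_init_last {T : ℕ} {F : (Fin T → Ω) × Ω → ℝ≥0∞} (hF : Measurable F) :
    ∫⁻ x, F (Fin.init x, x (Fin.last T)) ∂(Measure.pi fun _ : Fin (T + 1) => D) =
      ∫⁻ p, ∫⁻ ω, F (p, ω) ∂D ∂(Measure.pi fun _ : Fin T => D) := by
  have h := (measurePreserving_piFinSuccAbove (fun _ : Fin (T + 1) => D)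
    (Fin.last T)).lintegral_comp (hF.comp measurable_swap)
  rw [lintegral_prod_symm _ (hF.comp measurable_swap).aemeasurable] at h
  refine Eq.trans (lintegral_congr fun x => ?_) h
  simp only [Function.comp_apply, MeasurableEquiv.piFinSuccAbove, MeasurableEquiv.coe_mk,
    Fin.insertNthEquiv, Equiv.symm_mk, Equiv.coe_fn_mk, Prod.swap]
  congr 2
  funext i
  simp [Fin.init, Fin.removeNth]

/-- The martingale argument without filtrations: integrate out the last coordinate with the prefix
fixed, and use that `c` is uniform in the prefix. -/
theorem lintegral_exp_prefixSum_le {g : (t : ℕ) → (Fin t → Ω) → Ω → ℝ}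
    (hg : ∀ t, Measurable fun z : (Fin t → Ω) × Ω => g t z.1 z.2) {s : ℝ} {c : ℝ≥0∞}
    (hc : ∀ t p, ∫⁻ ω, ENNReal.ofReal (Real.exp (s * g t p ω)) ∂D ≤ c) (T : ℕ) :
    ∫⁻ x, ENNReal.ofReal (Real.exp (s * prefixSum g T x)) ∂(Measure.pi fun _ : Fin T => D) ≤
      c ^ T := by
  induction T with
  | zero => simp [prefixSum]
  | succ T ih =>
    have e : ∀ x : Fin (T + 1) → Ω, ENNReal.ofReal (Real.exp (s * prefixSum g (T + 1) x)) =
        (fun z : (Fin T → Ω) × Ω => ENNReal.ofReal (Real.exp (s * prefixSum g T z.1)) *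
          ENNReal.ofReal (Real.exp (s * g T z.1 z.2))) (Fin.init x, x (Fin.last T)) := by
      intro x
      simp only [prefixSum]
      rw [← ENNReal.ofReal_mul (Real.exp_pos _).le, ← Real.exp_add, mul_add]
    have m1 : Measurable fun p : Fin T → Ω => ENNReal.ofReal (Real.exp (s * prefixSum g T p)) :=
      ((measurable_prefixSum hg T).const_mul s).exp.ennreal_ofReal
    have m2 : Measurable fun z : (Fin T → Ω) × Ω => ENNReal.ofReal (Real.exp (s * g T z.1 z.2)) :=
      ((hg T).const_mul s).exp.ennreal_ofReal
    have m3 : Measurable fun z : (Fin T → Ω) × Ω => ENNReal.ofReal (Real.exp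
        (s * prefixSum g T z.1)) * ENNReal.ofReal (Real.exp (s * g T z.1 z.2)) :=
      (m1.comp measurable_fst).mul m2
    rw [lintegral_congr e, lintegral_pi_init_last D m3]
    calc _ ≤ ∫⁻ p, ENNReal.ofReal (Real.exp (s * prefixSum g T p)) * c
          ∂(Measure.pi fun _ : Fin T => D) := by
          refine lintegral_mono fun p => ?_
          simp only
          rw [lintegral_const_mul' _ _ ENNReal.ofReal_ne_top]
          exact mul_le_mul_right (hc T p) _
      _ ≤ _ := by
          rw [lintegral_mul_const _ m1, pow_succ]
          exact mul_le_mul_left ih _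

/-- Azuma's inequality: if the increments take values in an interval of length `2 b`, then
the adaptive sum of their deviations from the mean is at least `r` with probability at most
`exp (-r ^ 2 / (2 T b ^ 2))`. -/
theorem measure_prefixSum_ge_le {h : (t : ℕ) → (Fin t → Ω) → Ω → ℝ}
    (hh : ∀ t, Measurable fun z : (Fin t → Ω) × Ω => h t z.1 z.2) {l b : ℝ} (hb : 0 < b)
    (hbound : ∀ t p, ∀ᵐ ω ∂D, h t p ω ∈ Set.Icc l (l + 2 * b)) {T : ℕ} (hT : 0 < T) {r : ℝ}
    (hr : 0 ≤ r) :
    (Measure.pi fun _ : Fin T => D)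
      {x | r ≤ prefixSum (fun t p ω => (∫ ω', h t p ω' ∂D) - h t p ω) T x} ≤
      ENNReal.ofReal (Real.exp (-(r ^ 2 / (2 * T * b ^ 2)))) := by
  have hT' : (0 : ℝ) < T := by exact_mod_cast hT
  set g : (t : ℕ) → (Fin t → Ω) → Ω → ℝ := fun t p ω => (∫ ω', h t p ω' ∂D) - h t p ω with hgdef
  have hg : ∀ t, Measurable fun z : (Fin t → Ω) × Ω => g t z.1 z.2 := fun t => by
    have := (hh t).stronglyMeasurable.integral_prod_right' (ν := D)
    exact (this.measurable.comp measurable_fst).sub (hh t)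
  -- The minimizer of the Chernoff exponent `T b ^ 2 s ^ 2 / 2 - s r`.
  set s : ℝ := r / (T * b ^ 2) with hs
  have hs0 : 0 ≤ s := by positivity
  have hstep : ∀ t p, ∫⁻ ω, ENNReal.ofReal (Real.exp (s * g t p ω)) ∂D ≤
      ENNReal.ofReal (Real.exp (b ^ 2 * s ^ 2 / 2)) := by
    intro t p
    have hm : Measurable fun ω => h t p ω := (hh t).comp measurable_prodMk_left
    -- Hoeffding's lemma for a variable in an interval of length `2 b`; it is used at `-s` because
    -- `g` is the mean minus the value.
    have hsub := ProbabilityTheory.hasSubgaussianMGF_of_mem_Icc hm.aemeasurable (hbound t p)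
    have hint := hsub.integrable_exp_mul (-s)
    have hmgf := hsub.mgf_le (-s)
    have hc : (((‖l + 2 * b - l‖₊ / 2) ^ 2 : ℝ≥0) : ℝ) = b ^ 2 := by
      push_cast
      rw [Real.norm_eq_abs, show l + 2 * b - l = 2 * b by ring,
        abs_of_pos (by positivity)]
      ring
    rw [hc, neg_sq, ProbabilityTheory.mgf] at hmgf
    have e : ∀ ω, s * g t p ω = -s * (h t p ω - ∫ ω', h t p ω' ∂D) := fun ω => by
      rw [hgdef]; ring
    simp only [e]
    rw [← ofReal_integral_eq_lintegral_ofReal hint (ae_of_all _ fun _ => (Real.exp_pos _).le)]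
    exact ENNReal.ofReal_le_ofReal hmgf
  have hexp := lintegral_exp_prefixSum_le D hg hstep T
  have hmarkov := mul_meas_ge_le_lintegral₀ (μ := Measure.pi fun _ : Fin T => D)
    (((measurable_prefixSum hg T).const_mul s).exp.ennreal_ofReal).aemeasurable
    (ENNReal.ofReal (Real.exp (s * r)))
  have hsub : {x | r ≤ prefixSum g T x} ⊆ {x : Fin T → Ω | ENNReal.ofReal (Real.exp (s * r)) ≤
      ENNReal.ofReal (Real.exp (s * prefixSum g T x))} := fun x hx =>
    ENNReal.ofReal_le_ofReal (Real.exp_le_exp.2 (mul_le_mul_of_nonneg_left hx hs0))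
  have hpos : ENNReal.ofReal (Real.exp (s * r)) ≠ 0 := by simp [Real.exp_pos]
  calc _ ≤ _ := measure_mono hsub
    _ ≤ ENNReal.ofReal (Real.exp (b ^ 2 * s ^ 2 / 2)) ^ T / ENNReal.ofReal (Real.exp (s * r)) := by
        rw [ENNReal.le_div_iff_mul_le (Or.inl hpos) (Or.inl ENNReal.ofReal_ne_top), mul_comm]
        exact hmarkov.trans hexp
    _ = _ := by
        rw [← ENNReal.ofReal_pow (Real.exp_pos _).le, ← ENNReal.ofReal_div_of_pos (Real.exp_pos _),
          ← Real.exp_nat_mul, ← Real.exp_sub]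
        congr 2
        rw [hs]
        field_simp
        ring

/-- Hoeffding's inequality, in both directions. -/
theorem measure_abs_sum_div_sub_integral_ge_le {f : Ω → ℝ} (hf : Measurable f)
    (hbound : ∀ᵐ ω ∂D, f ω ∈ Set.Icc (0 : ℝ) 1) {M : ℕ} (hM : 0 < M) {τ : ℝ} (hτ : 0 ≤ τ) :
    (Measure.pi fun _ : Fin M => D) {x | τ ≤ |(∑ m, f (x m)) / M - ∫ ω, f ω ∂D|} ≤
      2 * ENNReal.ofReal (Real.exp (-(2 * M * τ ^ 2))) := by
  have hM' : (0 : ℝ) < M := by exact_mod_cast hM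
  have h1 := measure_prefixSum_ge_le D (h := fun _ _ ω => f ω) (l := 0) (b := 1 / 2)
    (fun t => hf.comp measurable_snd) (by norm_num) (fun _ _ => by simpa using hbound) hM
    (r := M * τ) (by positivity)
  have h2 := measure_prefixSum_ge_le D (h := fun _ _ ω => -f ω) (l := -1) (b := 1 / 2)
    (fun t => (hf.comp measurable_snd).neg) (by norm_num) (fun _ _ => by
      filter_upwards [hbound] with ω hω
      exact ⟨by linarith [hω.2], by linarith [hω.1]⟩) hM
    (r := M * τ) (by positivity)
  have e : -((M * τ) ^ 2 / (2 * M * (1 / 2 : ℝ) ^ 2)) = -(2 * M * τ ^ 2) := by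
    field_simp
  rw [e] at h1 h2
  simp only [prefixSum_const (fun ω => (∫ ω', f ω' ∂D) - f ω),
    prefixSum_const (fun ω => (∫ ω', -f ω' ∂D) - -f ω)] at h1 h2
  rw [two_mul]
  refine (measure_mono ?_).trans ((measure_union_le _ _).trans (add_le_add h1 h2))
  intro x hx
  simp only [Set.mem_ofPred_eq, le_abs, Set.mem_union] at hx ⊢
  simp only [integral_neg, Finset.sum_sub_distrib, Finset.sum_const, Finset.card_univ,
    Fintype.card_fin, nsmul_eq_mul, Finset.sum_neg_distrib]
  have hd : (∑ m, f (x m)) / M * M = ∑ m, f (x m) := div_mul_cancel₀ _ hM'.ne'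
  rcases hx with hx | hx
  · right
    nlinarith
  · left
    nlinarith

end Concentration

/-! ### The regret of the multiplicative updates -/

section Regret

variable {N n : ℕ}

/-- The loss vector of a round. -/
noncomputable def lossVec (P : Params) (φ : (Fin N → ℝ) → Fin n → ℝ) (w : Fin n → ℝ)
    (ex : Example N) (j : Fin n) : ℝ :=
  (1 + (P.act (P.lam * (normalized w ⬝ᵥ φ ex.1)) - ex.2) * φ ex.1 j) / 2

theorem nextWeights_apply (P : Params) (φ : (Fin N → ℝ) → Fin n → ℝ) (w : Fin n → ℝ)
    (ex : Example N) (j : Fin n) : nextWeights P φ w ex j = w j * P.beta ^ lossVec P φ w ex j :=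
  rfl

/-- The examples with features in `[-1,1]` and label in `[0,1]`. -/
def bounded (φ : (Fin N → ℝ) → Fin n → ℝ) : Set (Example N) :=
  {s | (∀ j, |φ s.1 j| ≤ 1) ∧ s.2 ∈ Set.Icc (0 : ℝ) 1}

variable {P : Params} {φ : (Fin N → ℝ) → Fin n → ℝ}

theorem lossVec_mem_Icc (hact : ∀ z, P.act z ∈ Set.Icc (0 : ℝ) 1) (w : Fin n → ℝ)
    {ex : Example N} (hex : ex ∈ bounded φ) (j : Fin n) :
    lossVec P φ w ex j ∈ Set.Icc (0 : ℝ) 1 := by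
  have h1 := hact (P.lam * (normalized w ⬝ᵥ φ ex.1))
  have h2 := hex.2
  have h3 : |(P.act (P.lam * (normalized w ⬝ᵥ φ ex.1)) - ex.2) * φ ex.1 j| ≤ 1 := by
    rw [abs_mul]
    refine mul_le_one₀ ?_ (abs_nonneg _) (hex.1 j)
    rw [abs_le]
    constructor <;> linarith [h1.1, h1.2, h2.1, h2.2]
  rw [abs_le] at h3
  unfold lossVec
  constructor <;> linarith [h3.1, h3.2]

theorem normalized_pos [NeZero n] {w : Fin n → ℝ} (hw : ∀ j, 0 < w j) (j : Fin n) :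
    0 < normalized w j :=
  div_pos (hw j) (Finset.sum_pos (fun i _ => hw i) Finset.univ_nonempty)

theorem sum_normalized [NeZero n] {w : Fin n → ℝ} (hw : ∀ j, 0 < w j) :
    ∑ j, normalized w j = 1 := by
  simp only [normalized, ← Finset.sum_div]
  exact div_self (Finset.sum_pos (fun i _ => hw i) Finset.univ_nonempty).ne'

theorem weightsAfter_pos [NeZero n] (hbeta : 0 < P.beta) :
    ∀ {t : ℕ} (train : Fin t → Example N) (j : Fin n), 0 < weightsAfter P φ t train j
  | 0, _, _ => by
    have : (0 : ℝ) < n := by exact_mod_cast Nat.pos_of_neZero n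
    simp only [weightsAfter]
    positivity
  | _ + 1, train, j =>
    mul_pos (weightsAfter_pos hbeta (Fin.init train) j) (Real.rpow_pos_of_pos hbeta _)

/-- The cumulative loss of the expert `j`. -/
noncomputable def expertLoss (P : Params) (φ : (Fin N → ℝ) → Fin n → ℝ) (j : Fin n) (T : ℕ)
    (train : Fin T → Example N) : ℝ :=
  prefixSum (fun t p ex => lossVec P φ (weightsAfter P φ t p) ex j) T train

/-- The cumulative loss of the algorithm. -/
noncomputable def totalLoss (P : Params) (φ : (Fin N → ℝ) → Fin n → ℝ) (T : ℕ)
    (train : Fin T → Example N) : ℝ :=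
  prefixSum (fun t p ex => normalized (weightsAfter P φ t p) ⬝ᵥ
    lossVec P φ (weightsAfter P φ t p) ex) T train

theorem weightsAfter_eq (hbeta : 0 < P.beta) {T : ℕ} (train : Fin T → Example N) (j : Fin n) :
    weightsAfter P φ T train j = 1 / n * P.beta ^ expertLoss P φ j T train := by
  induction T with
  | zero => simp [weightsAfter, expertLoss, prefixSum]
  | succ T ih =>
    rw [weightsAfter, nextWeights_apply, ih, mul_assoc, ← Real.rpow_add hbeta]
    rfl

/-- Bernoulli's inequality `β ^ l ≤ 1 - (1 - β) l` for `l ∈ [0,1]` shows that a round multiplies the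
total weight by at most `1 - (1 - β) p · l ≤ exp (-(1 - β) p · l)`. -/
theorem sum_weightsAfter_le [NeZero n] (hact : ∀ z, P.act z ∈ Set.Icc (0 : ℝ) 1)
    (hbeta : 0 < P.beta) {T : ℕ} {train : Fin T → Example N}
    (htrain : ∀ i, train i ∈ bounded φ) :
    ∑ j, weightsAfter P φ T train j ≤ Real.exp (-((1 - P.beta) * totalLoss P φ T train)) := by
  induction T with
  | zero =>
    have : (n : ℝ) ≠ 0 := by exact_mod_cast NeZero.ne n
    simp [weightsAfter, totalLoss, prefixSum, this]
  | succ T ih =>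
    have ih' := ih fun i => htrain i.castSucc
    have e : totalLoss P φ (T + 1) train = totalLoss P φ T (Fin.init train) +
        normalized (weightsAfter P φ T (Fin.init train)) ⬝ᵥ
          lossVec P φ (weightsAfter P φ T (Fin.init train)) (train (Fin.last T)) := rfl
    rw [e]
    simp only [weightsAfter, nextWeights_apply]
    set w := weightsAfter P φ T (Fin.init train)
    set l := lossVec P φ w (train (Fin.last T))
    have hw : ∀ j, 0 < w j := weightsAfter_pos hbeta _
    have hW : 0 < ∑ j, w j := Finset.sum_pos (fun i _ => hw i) Finset.univ_nonempty
    have hl : ∀ j, l j ∈ Set.Icc (0 : ℝ) 1 := lossVec_mem_Icc hact w (htrain _)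
    have hdot : ∑ j, w j * l j = (∑ j, w j) * (normalized w ⬝ᵥ l) := by
      rw [dotProduct, Finset.mul_sum]
      refine Finset.sum_congr rfl fun j _ => ?_
      rw [normalized]
      field_simp
    calc ∑ j, w j * P.beta ^ l j ≤ ∑ j, w j * (1 - (1 - P.beta) * l j) := by
          refine Finset.sum_le_sum fun j _ => mul_le_mul_of_nonneg_left ?_ (hw j).le
          have := rpow_one_add_le_one_add_mul_self (s := P.beta - 1) (by linarith) (hl j).1 (hl j).2
          rw [show 1 + (P.beta - 1) = P.beta by ring] at this
          linarith
      _ = (∑ j, w j) * (1 - (1 - P.beta) * (normalized w ⬝ᵥ l)) := by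
          have : ∀ j, w j * (1 - (1 - P.beta) * l j) = w j - (1 - P.beta) * (w j * l j) :=
            fun j => by ring
          simp only [this, Finset.sum_sub_distrib, ← Finset.mul_sum, hdot]
          ring
      _ ≤ (∑ j, w j) * Real.exp (-((1 - P.beta) * (normalized w ⬝ᵥ l))) := by
          refine mul_le_mul_of_nonneg_left ?_ hW.le
          have := Real.add_one_le_exp (-((1 - P.beta) * (normalized w ⬝ᵥ l)))
          linarith
      _ ≤ Real.exp (-((1 - P.beta) * totalLoss P φ T (Fin.init train))) *
            Real.exp (-((1 - P.beta) * (normalized w ⬝ᵥ l))) :=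
          mul_le_mul_of_nonneg_right ih' (Real.exp_pos _).le
      _ = _ := by
          rw [← Real.exp_add]
          congr 1
          ring

/-- The regret with respect to a single expert. -/
theorem totalLoss_sub_expertLoss_le [NeZero n] (hact : ∀ z, P.act z ∈ Set.Icc (0 : ℝ) 1)
    {η : ℝ} (hη : 0 < η) (hη2 : η ≤ 1 / 2) (hbeta : P.beta = 1 - η) {T : ℕ}
    {train : Fin T → Example N} (htrain : ∀ i, train i ∈ bounded φ) (j : Fin n) :
    η * (totalLoss P φ T train - expertLoss P φ j T train) ≤ Real.log n + 2 * η ^ 2 * T := by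
  have hb : 0 < P.beta := by linarith
  have hn : (0 : ℝ) < n := by exact_mod_cast Nat.pos_of_neZero n
  -- The final weight of the expert `j` is at most the total weight.
  have h1 : 1 / n * P.beta ^ expertLoss P φ j T train ≤
      Real.exp (-(η * totalLoss P φ T train)) := by
    have h := sum_weightsAfter_le hact hb htrain
    rw [hbeta, sub_sub_cancel] at h
    rw [← weightsAfter_eq hb]
    exact (Finset.single_le_sum (fun i _ => (weightsAfter_pos hb train i).le)
      (Finset.mem_univ j)).trans h
  have h2 := Real.log_le_log (by positivity) h1
  rw [Real.log_exp, Real.log_mul (by positivity) (Real.rpow_pos_of_pos hb _).ne',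
    Real.log_rpow hb, one_div, Real.log_inv] at h2
  -- Via `log β ≥ 1 - 1/β` and `(1 + η + 2 η ^ 2)(1 - η) = 1 + η ^ 2 (1 - 2 η) ≥ 1`; this is where
  -- `η ≤ 1/2` enters.
  have h3 : -(η + 2 * η ^ 2) ≤ Real.log P.beta := by
    have h := Real.one_sub_inv_le_log_of_pos hb
    refine le_trans ?_ h
    have h4 : P.beta⁻¹ ≤ 1 + η + 2 * η ^ 2 := by
      rw [inv_le_comm₀ hb (by positivity), inv_le_iff_one_le_mul₀ (by positivity), hbeta]
      nlinarith [mul_nonneg (sq_nonneg η) (by linarith : 0 ≤ 1 - 2 * η)]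
    linarith
  have hL0 : 0 ≤ expertLoss P φ j T train := by
    have h := prefixSum_mono (g := fun _ _ _ => 0) htrain fun t p ω hω =>
      (lossVec_mem_Icc hact (weightsAfter P φ t p) hω j).1
    rw [prefixSum_const (fun _ => (0 : ℝ)), Finset.sum_const_zero] at h
    exact h
  have hL1 : expertLoss P φ j T train ≤ T := by
    have h := prefixSum_mono (h := fun _ _ _ => 1) htrain fun t p ω hω =>
      (lossVec_mem_Icc hact (weightsAfter P φ t p) hω j).2
    rw [prefixSum_const (fun _ => (1 : ℝ))] at h
    simp only [Finset.sum_const, Finset.card_univ, Fintype.card_fin, nsmul_eq_mul, mul_one] at h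
    exact h
  have h5 := mul_le_mul_of_nonneg_left h3 hL0
  have h6 := mul_le_mul_of_nonneg_left hL1 (by positivity : 0 ≤ 2 * η ^ 2)
  linarith

/-- The excess `(σ (u · φ) - y) (u · φ - w · φ)` of `u` over `w`. -/
noncomputable def excess (P : Params) (φ : (Fin N → ℝ) → Fin n → ℝ) (w u : Fin n → ℝ)
    (ex : Example N) : ℝ :=
  (P.act (u ⬝ᵥ φ ex.1) - ex.2) * (u ⬝ᵥ φ ex.1 - w ⬝ᵥ φ ex.1)

/-- The bridge from learning to experts. Both `q` and `normalized v` have total mass one, so the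
constant `1/2` in the losses drops out and the linear part remains. -/
theorem excess_eq [NeZero n] {q v : Fin n → ℝ} (hq : ∑ j, q j = 1) (hv : ∀ j, 0 < v j)
    (ex : Example N) :
    excess P φ (P.lam • q) (predictor P v) ex =
      2 * P.lam * (normalized v ⬝ᵥ lossVec P φ v ex - ∑ j, q j * lossVec P φ v ex j) := by
  have hs := sum_normalized hv
  have e : ∀ p : Fin n → ℝ, ∑ j, p j = 1 → ∑ j, p j * lossVec P φ v ex j =
      (1 + (P.act (P.lam * (normalized v ⬝ᵥ φ ex.1)) - ex.2) * (p ⬝ᵥ φ ex.1)) / 2 := by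
    intro p hp
    set g := P.act (P.lam * (normalized v ⬝ᵥ φ ex.1)) - ex.2 with hg
    rw [← hp, dotProduct, Finset.mul_sum, ← Finset.sum_add_distrib, Finset.sum_div]
    exact Finset.sum_congr rfl fun j _ => by rw [lossVec, ← hg]; ring
  rw [dotProduct, e _ hs, e _ hq, excess, predictor, smul_dotProduct, smul_dotProduct]
  simp only [smul_eq_mul]
  ring

/-- The sum of the excesses, for `β = 1 - √(log n / T)`. -/
theorem prefixSum_excess_le [NeZero n] (hact : ∀ z, P.act z ∈ Set.Icc (0 : ℝ) 1)
    (hlam : 0 ≤ P.lam) {T : ℕ} (hn : 2 ≤ n) (hT : 4 * Real.log n ≤ T)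
    (hbeta : P.beta = 1 - Real.sqrt (Real.log n / T)) {train : Fin T → Example N}
    (htrain : ∀ i, train i ∈ bounded φ) {q : Fin n → ℝ} (hq0 : ∀ j, 0 ≤ q j)
    (hq : ∑ j, q j = 1) :
    prefixSum (fun t p ex => excess P φ (P.lam • q) (predictor P (weightsAfter P φ t p)) ex) T
      train ≤ 6 * P.lam * Real.sqrt (T * Real.log n) := by
  have hlog : 0 < Real.log n := Real.log_pos (by exact_mod_cast hn)
  have hT0 : (0 : ℝ) < T := by linarith
  set η := Real.sqrt (Real.log n / T) with hηdef
  have hη : 0 < η := Real.sqrt_pos.2 (by positivity)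
  have hηsq : η ^ 2 = Real.log n / T := Real.sq_sqrt (by positivity)
  have hη2 : η ≤ 1 / 2 := by
    rw [hηdef, Real.sqrt_le_left (by norm_num), div_le_iff₀ hT0]
    linarith
  have hb : 0 < P.beta := by linarith
  -- The choice of `η` makes `log n / η` and `η T` both equal to `√(T log n)`; the bound is one of
  -- the first plus two of the second.
  have hreg : ∀ j, totalLoss P φ T train - expertLoss P φ j T train ≤
      3 * Real.sqrt (T * Real.log n) := by
    intro j
    have h := totalLoss_sub_expertLoss_le hact hη hη2 hbeta htrain j
    have h2 : η * Real.sqrt (T * Real.log n) = Real.log n := by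
      rw [hηdef, ← Real.sqrt_mul (by positivity),
        show Real.log n / T * (T * Real.log n) = Real.log n ^ 2 by field_simp,
        Real.sqrt_sq hlog.le]
    have h3 : η ^ 2 * T = Real.log n := by rw [hηsq]; field_simp
    refine le_of_mul_le_mul_left ?_ hη
    calc _ ≤ _ := h
      _ = 3 * (η * Real.sqrt (T * Real.log n)) := by rw [h2]; linarith
      _ = _ := by ring
  have e : ∀ (t : ℕ) (p : Fin t → Example N) (ex : Example N),
      excess P φ (P.lam • q) (predictor P (weightsAfter P φ t p)) ex =
      2 * P.lam * (normalized (weightsAfter P φ t p) ⬝ᵥ lossVec P φ (weightsAfter P φ t p) ex +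
        -1 * ∑ j, q j * lossVec P φ (weightsAfter P φ t p) ex j) := fun t p ex => by
    rw [excess_eq hq (weightsAfter_pos hb p)]
    ring
  simp only [e]
  rw [prefixSum_const_mul, prefixSum_add, prefixSum_const_mul, prefixSum_sum]
  simp only [prefixSum_const_mul]
  change 2 * P.lam * (totalLoss P φ T train + -1 * ∑ j, q j * expertLoss P φ j T train) ≤ _
  have h4 : totalLoss P φ T train + -1 * ∑ j, q j * expertLoss P φ j T train =
      ∑ j, q j * (totalLoss P φ T train - expertLoss P φ j T train) := by
    simp only [mul_sub, Finset.sum_sub_distrib, ← Finset.sum_mul, hq]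
    ring
  -- The mixture `q` is no better than the best expert, so the bounds for single experts average.
  have h5 : ∑ j, q j * (totalLoss P φ T train - expertLoss P φ j T train) ≤
      3 * Real.sqrt (T * Real.log n) := by
    calc _ ≤ ∑ j, q j * (3 * Real.sqrt (T * Real.log n)) :=
          Finset.sum_le_sum fun j _ => mul_le_mul_of_nonneg_left (hreg j) (hq0 j)
      _ = _ := by rw [← Finset.sum_mul, hq, one_mul]
  rw [h4]
  calc _ ≤ 2 * P.lam * (3 * Real.sqrt (T * Real.log n)) := by gcongr
    _ = _ := by ring

end Regret

/-! ### The learning problem in terms of features -/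

section Learning

variable {N n : ℕ}

/-- The risk of `u` with respect to the features `φ`. -/
noncomputable def featRisk (act : ℝ → ℝ) (φ : (Fin N → ℝ) → Fin n → ℝ) (w : Fin n → ℝ)
    (D : Measure (Example N)) (u : Fin n → ℝ) : ℝ :=
  ∫ s, (act (u ⬝ᵥ φ s.1) - act (w ⬝ᵥ φ s.1)) ^ 2 ∂D

/-- The squared loss of `u`. -/
noncomputable def sqLoss (act : ℝ → ℝ) (φ : (Fin N → ℝ) → Fin n → ℝ) (u : Fin n → ℝ)
    (s : Example N) : ℝ :=
  (act (u ⬝ᵥ φ s.1) - s.2) ^ 2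

/-- A distribution of examples with bounded features `φ` and `E[Y | X] = σ (w · φ X)`. -/
structure FeatureModel (act : ℝ → ℝ) (φ : (Fin N → ℝ) → Fin n → ℝ) (w : Fin n → ℝ)
    (D : Measure (Example N)) : Prop where
  isProbabilityMeasure : IsProbabilityMeasure D
  measurable_features : ∀ j, Measurable fun x => φ x j
  ae_bounded : ∀ᵐ s ∂D, s ∈ bounded φ
  condExp_eq : D[fun s => s.2 | MeasurableSpace.comap Prod.fst inferInstance] =ᵐ[D]
    fun s => act (w ⬝ᵥ φ s.1)

variable {act : ℝ → ℝ} {φ : (Fin N → ℝ) → Fin n → ℝ} {w : Fin n → ℝ} {D : Measure (Example N)}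

theorem abs_dotProduct_le {u x : Fin n → ℝ} (hx : ∀ j, |x j| ≤ 1) : |u ⬝ᵥ x| ≤ ∑ j, |u j| := by
  refine (Finset.abs_sum_le_sum_abs _ _).trans (Finset.sum_le_sum fun j _ => ?_)
  rw [abs_mul]
  exact mul_le_of_le_one_right (abs_nonneg _) (hx j)

theorem abs_smul_dotProduct_le {lam : ℝ} (hlam : 0 ≤ lam) {p x : Fin n → ℝ} (hp0 : ∀ j, 0 ≤ p j)
    (hp : ∑ j, p j = 1) (hx : ∀ j, |x j| ≤ 1) : |(lam • p) ⬝ᵥ x| ≤ lam := by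
  have h := abs_dotProduct_le (u := p) hx
  simp only [abs_of_nonneg (hp0 _), hp] at h
  rw [smul_dotProduct, smul_eq_mul, abs_mul, abs_of_nonneg hlam]
  exact mul_le_of_le_one_right hlam h

theorem measurable_dotProduct (hφ : ∀ j, Measurable fun x => φ x j) (u : Fin n → ℝ) :
    Measurable fun x => u ⬝ᵥ φ x := by
  unfold dotProduct
  fun_prop

/-- The noise is orthogonal to bounded functions of the features: such a function can be pulled out
of the conditional expectation. The model assumption on `E[Y | X]` is used through this statement.
-/
theorem FeatureModel.integral_mul_eq_zero (h : FeatureModel act φ w D) (hact : Measurable act)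
    (hact01 : ∀ z, act z ∈ Set.Icc (0 : ℝ) 1) {g : (Fin N → ℝ) → ℝ} (hg : Measurable g) {B : ℝ}
    (hB : ∀ᵐ s ∂D, |g s.1| ≤ B) :
    ∫ s, g s.1 * (s.2 - act (w ⬝ᵥ φ s.1)) ∂D = 0 := by
  have := h.isProbabilityMeasure
  have hm : MeasurableSpace.comap (Prod.fst : Example N → Fin N → ℝ) inferInstance ≤
      (inferInstance : MeasurableSpace (Example N)) := measurable_fst.comap_le
  have hd := measurable_dotProduct h.measurable_features w
  have hgm : Measurable fun s : Example N => g s.1 := hg.comp measurable_fst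
  have hsig : Measurable fun s : Example N => act (w ⬝ᵥ φ s.1) :=
    hact.comp (hd.comp measurable_fst)
  have i1 : Integrable (fun s : Example N => s.2) D := by
    refine Integrable.of_bound measurable_snd.aestronglyMeasurable 1 ?_
    filter_upwards [h.ae_bounded] with s hs
    rw [Real.norm_eq_abs, abs_le]
    constructor <;> linarith [hs.2.1, hs.2.2]
  have i2 : Integrable ((fun s : Example N => g s.1) * fun s : Example N => s.2) D := by
    refine i1.bdd_mul (c := B) hgm.aestronglyMeasurable ?_
    simpa [Real.norm_eq_abs] using hB
  have i3 : Integrable (fun s : Example N => act (w ⬝ᵥ φ s.1)) D := by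
    refine Integrable.of_bound hsig.aestronglyMeasurable 1 (ae_of_all _ fun s => ?_)
    rw [Real.norm_eq_abs, abs_le]
    constructor <;> linarith [(hact01 (w ⬝ᵥ φ s.1)).1, (hact01 (w ⬝ᵥ φ s.1)).2]
  have i4 : Integrable (fun s : Example N => g s.1 * act (w ⬝ᵥ φ s.1)) D := by
    refine i3.bdd_mul (c := B) hgm.aestronglyMeasurable ?_
    simpa [Real.norm_eq_abs] using hB
  have hsm : StronglyMeasurable[MeasurableSpace.comap (Prod.fst : Example N → Fin N → ℝ)
      inferInstance] fun s : Example N => g s.1 :=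
    (hg.comp (comap_measurable _)).stronglyMeasurable
  have h1 := condExp_mul_of_stronglyMeasurable_left hsm i2 i1
  have h2 : ∫ s, g s.1 * s.2 ∂D = ∫ s, g s.1 * act (w ⬝ᵥ φ s.1) ∂D := by
    refine (integral_condExp hm (f := (fun s : Example N => g s.1) * fun s : Example N =>
      s.2)).symm.trans (integral_congr_ae ?_)
    filter_upwards [h1, h.condExp_eq] with s hs1 hs2
    rw [hs1, Pi.mul_apply, hs2]
  have i2' : Integrable (fun s : Example N => g s.1 * s.2) D := i2
  simp only [mul_sub]
  rw [integral_sub i2' i4]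
  exact sub_eq_zero.2 h2

theorem FeatureModel.integrable_of_bound (h : FeatureModel act φ w D) {f : Example N → ℝ}
    (hf : Measurable f) {B : ℝ} (hB : ∀ s ∈ bounded φ, |f s| ≤ B) : Integrable f D := by
  have := h.isProbabilityMeasure
  refine Integrable.of_bound hf.aestronglyMeasurable B ?_
  filter_upwards [h.ae_bounded] with s hs using hB s hs

/-- By monotonicity `a - b` and `x - y` have the same sign, and by the Lipschitz bound the latter is
at least as large in absolute value. -/
theorem sq_sub_le_mul {a b x y : ℝ} (hmono : x ≤ y → a ≤ b) (hmono' : y ≤ x → b ≤ a)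
    (hlip : |a - b| ≤ |x - y|) : (a - b) ^ 2 ≤ (a - b) * (x - y) := by
  rcases le_total x y with hxy | hxy
  · have := hmono hxy
    rw [abs_of_nonpos (by linarith), abs_of_nonpos (by linarith)] at hlip
    nlinarith
  · have := hmono' hxy
    rw [abs_of_nonneg (by linarith), abs_of_nonneg (by linarith)] at hlip
    nlinarith

/-- The expected excess bounds the risk. -/
theorem FeatureModel.featRisk_le_integral_excess {P : Params} (h : FeatureModel P.act φ w D)
    (hmono : Monotone P.act) (hlip : LipschitzWith 1 P.act)
    (hact01 : ∀ z, P.act z ∈ Set.Icc (0 : ℝ) 1) (u : Fin n → ℝ) :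
    featRisk P.act φ w D u ≤ ∫ s, excess P φ w u s ∂D := by
  have hact : Measurable P.act := hlip.continuous.measurable
  have mu := measurable_dotProduct h.measurable_features u
  have mw := measurable_dotProduct h.measurable_features w
  have mu1 : Measurable fun s : Example N => u ⬝ᵥ φ s.1 := mu.comp measurable_fst
  have mw1 : Measurable fun s : Example N => w ⬝ᵥ φ s.1 := mw.comp measurable_fst
  have hbd : ∀ s ∈ bounded φ, |u ⬝ᵥ φ s.1 - w ⬝ᵥ φ s.1| ≤ ∑ j, |u j| + ∑ j, |w j| :=
    fun s hs => (abs_sub _ _).trans (add_le_add (abs_dotProduct_le hs.1) (abs_dotProduct_le hs.1))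
  have hdiff : ∀ s : Example N, |P.act (u ⬝ᵥ φ s.1) - P.act (w ⬝ᵥ φ s.1)| ≤ 1 := fun s => by
    have h1 := hact01 (u ⬝ᵥ φ s.1)
    have h2 := hact01 (w ⬝ᵥ φ s.1)
    rw [abs_le]
    constructor <;> linarith [h1.1, h1.2, h2.1, h2.2]
  have hdiff' : ∀ s ∈ bounded φ, |s.2 - P.act (w ⬝ᵥ φ s.1)| ≤ 1 := fun s hs => by
    have h1 := hs.2
    have h2 := hact01 (w ⬝ᵥ φ s.1)
    rw [abs_le]
    constructor <;> linarith [h1.1, h1.2, h2.1, h2.2]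
  have i1 : Integrable (fun s : Example N => (P.act (u ⬝ᵥ φ s.1) - P.act (w ⬝ᵥ φ s.1)) *
      (u ⬝ᵥ φ s.1 - w ⬝ᵥ φ s.1)) D := by
    refine h.integrable_of_bound (B := 1 * (∑ j, |u j| + ∑ j, |w j|))
      (((hact.comp mu1).sub (hact.comp mw1)).mul (mu1.sub mw1)) fun s hs => ?_
    rw [abs_mul]
    exact mul_le_mul (hdiff s) (hbd s hs) (abs_nonneg _) zero_le_one
  have i2 : Integrable (fun s : Example N => (u ⬝ᵥ φ s.1 - w ⬝ᵥ φ s.1) *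
      (s.2 - P.act (w ⬝ᵥ φ s.1))) D := by
    refine h.integrable_of_bound (B := (∑ j, |u j| + ∑ j, |w j|) * 1)
      ((mu1.sub mw1).mul (measurable_snd.sub (hact.comp mw1))) fun s hs => ?_
    rw [abs_mul]
    exact mul_le_mul (hbd s hs) (hdiff' s hs) (abs_nonneg _)
      ((abs_nonneg _).trans (hbd s hs))
  have i3 : Integrable (fun s : Example N =>
      (P.act (u ⬝ᵥ φ s.1) - P.act (w ⬝ᵥ φ s.1)) ^ 2) D := by
    refine h.integrable_of_bound (B := 1) (((hact.comp mu1).sub (hact.comp mw1)).pow_const 2)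
      fun s hs => ?_
    rw [abs_pow]
    exact pow_le_one₀ (abs_nonneg _) (hdiff s)
  have h0 := h.integral_mul_eq_zero hact hact01 (mu.sub mw)
    (by filter_upwards [h.ae_bounded] with s hs using hbd s hs)
  have e : ∀ s, excess P φ w u s = (P.act (u ⬝ᵥ φ s.1) - P.act (w ⬝ᵥ φ s.1)) *
      (u ⬝ᵥ φ s.1 - w ⬝ᵥ φ s.1) -
      (u ⬝ᵥ φ s.1 - w ⬝ᵥ φ s.1) * (s.2 - P.act (w ⬝ᵥ φ s.1)) := fun s => by
    rw [excess]; ring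
  simp only [e]
  rw [integral_sub i1 i2]
  simp only [Pi.sub_apply] at h0
  rw [h0, sub_zero]
  refine integral_mono i3 i1 fun s => sq_sub_le_mul (fun hxy => hmono hxy) (fun hxy => hmono hxy) ?_
  simpa [Real.dist_eq] using hlip.dist_le_mul (u ⬝ᵥ φ s.1) (w ⬝ᵥ φ s.1)

/-- The expected squared loss is the risk up to a constant. -/
theorem FeatureModel.integral_sqLoss (h : FeatureModel act φ w D) (hact : Measurable act)
    (hact01 : ∀ z, act z ∈ Set.Icc (0 : ℝ) 1) (u : Fin n → ℝ) :
    ∫ s, sqLoss act φ u s ∂D = featRisk act φ w D u + ∫ s, sqLoss act φ w s ∂D := by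
  have mu := measurable_dotProduct h.measurable_features u
  have mw := measurable_dotProduct h.measurable_features w
  have mu1 : Measurable fun s : Example N => u ⬝ᵥ φ s.1 := mu.comp measurable_fst
  have mw1 : Measurable fun s : Example N => w ⬝ᵥ φ s.1 := mw.comp measurable_fst
  have hdiff : ∀ s : Example N, |act (u ⬝ᵥ φ s.1) - act (w ⬝ᵥ φ s.1)| ≤ 1 := fun s => by
    have h1 := hact01 (u ⬝ᵥ φ s.1)
    have h2 := hact01 (w ⬝ᵥ φ s.1)
    rw [abs_le]
    constructor <;> linarith [h1.1, h1.2, h2.1, h2.2]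
  have hdiff' : ∀ s ∈ bounded φ, |s.2 - act (w ⬝ᵥ φ s.1)| ≤ 1 := fun s hs => by
    have h1 := hs.2
    have h2 := hact01 (w ⬝ᵥ φ s.1)
    rw [abs_le]
    constructor <;> linarith [h1.1, h1.2, h2.1, h2.2]
  have i1 : Integrable (fun s : Example N => (act (u ⬝ᵥ φ s.1) - act (w ⬝ᵥ φ s.1)) ^ 2) D := by
    refine h.integrable_of_bound (B := 1) (((hact.comp mu1).sub (hact.comp mw1)).pow_const 2)
      fun s hs => ?_
    rw [abs_pow]
    exact pow_le_one₀ (abs_nonneg _) (hdiff s)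
  have i2 : Integrable (fun s : Example N => (act (u ⬝ᵥ φ s.1) - act (w ⬝ᵥ φ s.1)) *
      (s.2 - act (w ⬝ᵥ φ s.1))) D := by
    refine h.integrable_of_bound (B := 1)
      (((hact.comp mu1).sub (hact.comp mw1)).mul (measurable_snd.sub (hact.comp mw1)))
      fun s hs => ?_
    rw [abs_mul]
    exact mul_le_one₀ (hdiff s) (abs_nonneg _) (hdiff' s hs)
  have i3 : Integrable (sqLoss act φ w) D := by
    refine h.integrable_of_bound (B := 1) (((hact.comp mw1).sub measurable_snd).pow_const 2)
      fun s hs => ?_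
    rw [sqLoss, abs_pow, abs_sub_comm]
    exact pow_le_one₀ (abs_nonneg _) (hdiff' s hs)
  have h0 := h.integral_mul_eq_zero hact hact01 ((hact.comp mu).sub (hact.comp mw))
    (ae_of_all _ hdiff)
  simp only [Pi.sub_apply, Function.comp_apply] at h0
  -- A bias-variance decomposition whose cross term integrates to zero by `h0`.
  have e : ∀ s, sqLoss act φ u s = (act (u ⬝ᵥ φ s.1) - act (w ⬝ᵥ φ s.1)) ^ 2 -
      2 * ((act (u ⬝ᵥ φ s.1) - act (w ⬝ᵥ φ s.1)) * (s.2 - act (w ⬝ᵥ φ s.1))) +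
      sqLoss act φ w s := fun s => by
    rw [sqLoss, sqLoss]; ring
  simp only [e]
  rw [integral_add (f := fun s : Example N => (act (u ⬝ᵥ φ s.1) - act (w ⬝ᵥ φ s.1)) ^ 2 -
    2 * ((act (u ⬝ᵥ φ s.1) - act (w ⬝ᵥ φ s.1)) * (s.2 - act (w ⬝ᵥ φ s.1))))
    (i1.sub (i2.const_mul 2)) i3, integral_sub i1 (i2.const_mul 2),
    integral_const_mul, h0, featRisk]
  ring

/-! ### Measurability of the trajectory -/

theorem measurable_normalized {α : Type*} [MeasurableSpace α] {v : α → Fin n → ℝ}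
    (hv : ∀ j, Measurable fun a => v a j) (j : Fin n) :
    Measurable fun a => normalized (v a) j := by
  unfold normalized
  fun_prop

theorem measurable_predictor_dotProduct {α : Type*} [MeasurableSpace α] (P : Params)
    (hφ : ∀ j, Measurable fun x => φ x j) {v : α → Fin n → ℝ} (hv : ∀ j, Measurable fun a => v a j) :
    Measurable fun z : α × Example N => predictor P (v z.1) ⬝ᵥ φ z.2.1 := by
  have h := measurable_normalized hv
  have h' : ∀ j, Measurable fun z : α × Example N => normalized (v z.1) j := fun j =>
    (h j).comp measurable_fst
  have hφ' : ∀ j, Measurable fun z : α × Example N => φ z.2.1 j := fun j =>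
    (hφ j).comp (measurable_fst.comp measurable_snd)
  simp only [predictor, dotProduct, Pi.smul_apply, smul_eq_mul]
  fun_prop

theorem measurable_weightsAfter (P : Params) (hact : Measurable P.act)
    (hφ : ∀ j, Measurable fun x => φ x j) (t : ℕ) (j : Fin n) :
    Measurable fun train : Fin t → Example N => weightsAfter P φ t train j := by
  induction t generalizing j with
  | zero => exact measurable_const
  | succ t ih =>
    have h1 := measurable_predictor_dotProduct P hφ ih
    have hlast : Measurable fun x : Fin (t + 1) → Example N =>
        ((Fin.init x : Fin t → Example N), x (Fin.last t)) :=
      measurable_init.prodMk (measurable_pi_apply (Fin.last t))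
    have h2 : Measurable fun z : (Fin t → Example N) × Example N =>
        weightsAfter P φ t z.1 j * P.beta ^ ((1 + (P.act
          (predictor P (weightsAfter P φ t z.1) ⬝ᵥ φ z.2.1) - z.2.2) * φ z.2.1 j) / 2) := by
      have hφj : Measurable fun z : (Fin t → Example N) × Example N => φ z.2.1 j :=
        (hφ j).comp (measurable_fst.comp measurable_snd)
      refine ((ih j).comp measurable_fst).mul (measurable_const.pow ?_)
      refine ((((hact.comp h1).sub (measurable_snd.comp measurable_snd)).mul hφj).const_add
        1).div_const 2
    convert h2.comp hlast using 1
    funext train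
    simp only [Function.comp_apply, weightsAfter, nextWeights, predictor, smul_dotProduct,
      smul_eq_mul]

theorem exists_of_mem_visited {P : Params} [NeZero n] (hbeta : 0 < P.beta) {t : ℕ}
    {train : Fin t → Example N} {u : Fin n → ℝ} (hu : u ∈ visited P φ t train) :
    ∃ p : Fin n → ℝ, (∀ j, 0 ≤ p j) ∧ ∑ j, p j = 1 ∧ u = P.lam • p := by
  induction t with
  | zero => exact absurd hu (Set.notMem_empty _)
  | succ t ih =>
    rcases hu with rfl | hu
    · exact ⟨_, fun j => (normalized_pos (weightsAfter_pos hbeta _) j).le,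
        sum_normalized (weightsAfter_pos hbeta _), rfl⟩
    · exact ih hu

/-- The averaging argument: used contrapositively, a small sum of risks over the rounds yields one
candidate of small risk. -/
theorem mul_le_prefixSum_of_forall_visited {P : Params} {f : (Fin n → ℝ) → ℝ} {c : ℝ} {T : ℕ}
    {train : Fin T → Example N} (h : ∀ u ∈ visited P φ T train, c ≤ f u) :
    T * c ≤ prefixSum (fun t p _ => f (predictor P (weightsAfter P φ t p))) T train := by
  induction T with
  | zero => simp [prefixSum]
  | succ T ih =>
    have h1 := ih fun u hu => h u (Set.mem_insert_of_mem _ hu)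
    have h2 := h _ (Set.mem_insert _ _)
    rw [prefixSum]
    push_cast
    linarith

end Learning

/-! ### Bad events for the two training sets. -/

section Events

variable {N n M : ℕ} {P : Params} {φ : (Fin N → ℝ) → Fin n → ℝ} {D : Measure (Example N)}

theorem FeatureModel.ae_pi_bounded {act : ℝ → ℝ} {w : Fin n → ℝ} (h : FeatureModel act φ w D)
    (T : ℕ) : ∀ᵐ x ∂(Measure.pi fun _ : Fin T => D), ∀ i, x i ∈ bounded φ := by
  have := h.isProbabilityMeasure
  refine Filter.eventually_all.2 fun i => ?_
  exact (Measure.quasiMeasurePreserving_eval (μ := fun _ : Fin T => D) i).ae h.ae_bounded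

theorem abs_excess_le (hact : ∀ z, P.act z ∈ Set.Icc (0 : ℝ) 1) (hlam : 0 ≤ P.lam)
    {q p : Fin n → ℝ} (hq0 : ∀ j, 0 ≤ q j) (hq : ∑ j, q j = 1) (hp0 : ∀ j, 0 ≤ p j)
    (hp : ∑ j, p j = 1) {ex : Example N} (hex : ex ∈ bounded φ) :
    |excess P φ (P.lam • q) (P.lam • p) ex| ≤ 2 * P.lam := by
  have h1 := hact ((P.lam • p) ⬝ᵥ φ ex.1)
  have h2 := hex.2
  have h3 := abs_smul_dotProduct_le hlam hp0 hp hex.1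
  have h4 := abs_smul_dotProduct_le hlam hq0 hq hex.1
  have h5 : |P.act ((P.lam • p) ⬝ᵥ φ ex.1) - ex.2| ≤ 1 := by
    rw [abs_le]
    constructor <;> linarith [h1.1, h1.2, h2.1, h2.2]
  rw [excess, abs_mul]
  calc _ ≤ 1 * (P.lam + P.lam) := by
        refine mul_le_mul h5 ((abs_sub _ _).trans (add_le_add h3 h4)) (abs_nonneg _) zero_le_one
    _ = _ := by ring

/-- With high probability over the first training set, one of the candidates has small risk. -/
theorem measure_not_exists_good_le [NeZero n] {q : Fin n → ℝ}
    (h : FeatureModel P.act φ (P.lam • q) D) (hmono : Monotone P.act)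
    (hlip : LipschitzWith 1 P.act) (hact : ∀ z, P.act z ∈ Set.Icc (0 : ℝ) 1)
    (hq0 : ∀ j, 0 ≤ q j) (hq : ∑ j, q j = 1) (hn : 2 ≤ n) (hlam : 0 < P.lam) (heps : 0 < P.eps)
    {T : ℕ} (hT4 : 4 * Real.log n ≤ T) (hbeta : P.beta = 1 - Real.sqrt (Real.log n / T)) {ℓ : ℝ}
    (hℓn : Real.log n ≤ ℓ) (hT : 1024 * P.lam ^ 2 * ℓ / P.eps ^ 2 ≤ T) :
    (Measure.pi fun _ : Fin T => D)
      {x | ¬ ∃ u ∈ visited P φ T x, featRisk P.act φ (P.lam • q) D u ≤ P.eps / 2} ≤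
      ENNReal.ofReal (Real.exp (-(2 * ℓ))) := by
  have := h.isProbabilityMeasure
  have hlog : 0 < Real.log n := Real.log_pos (by exact_mod_cast hn)
  have hT0 : (0 : ℝ) < T := by linarith
  have hℓ : 0 < ℓ := by linarith
  have hb : 0 < P.beta := by
    rw [hbeta, sub_pos, Real.sqrt_lt' one_pos, div_lt_iff₀ hT0]
    linarith
  set R := P.lam * Real.sqrt (T * ℓ) with hR
  have hR0 : 0 ≤ R := by positivity
  have hR2 : R ^ 2 = P.lam ^ 2 * (T * ℓ) := by rw [hR, mul_pow, Real.sq_sqrt (by positivity)]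
  -- The constant `1024 = 32 ^ 2` in the bound for `T` appears here.
  have hRle : R ≤ P.eps * T / 32 := by
    refine abs_le_of_sq_le_sq' ?_ (by positivity) |>.2
    rw [hR2]
    rw [div_le_iff₀ (by positivity)] at hT
    have := mul_le_mul_of_nonneg_right hT hT0.le
    linarith
  set g : (t : ℕ) → (Fin t → Example N) → Example N → ℝ := fun t p ex =>
    excess P φ (P.lam • q) (predictor P (weightsAfter P φ t p)) ex with hg
  have hact' : Measurable P.act := hlip.continuous.measurable
  have hmeas : ∀ t, Measurable fun z : (Fin t → Example N) × Example N => g t z.1 z.2 := by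
    intro t
    have m1 := measurable_predictor_dotProduct P h.measurable_features
      (measurable_weightsAfter P hact' h.measurable_features t)
    have m2 : Measurable fun z : (Fin t → Example N) × Example N => (P.lam • q) ⬝ᵥ φ z.2.1 :=
      (measurable_dotProduct h.measurable_features _).comp (measurable_fst.comp measurable_snd)
    exact ((hact'.comp m1).sub (measurable_snd.comp measurable_snd)).mul (m1.sub m2)
  have hbound : ∀ t p, ∀ᵐ ω ∂D, g t p ω ∈ Set.Icc (-(2 * P.lam)) (-(2 * P.lam) +
      2 * (2 * P.lam)) := by
    intro t p
    filter_upwards [h.ae_bounded] with s hs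
    have := abs_excess_le hact hlam.le hq0 hq (p := normalized (weightsAfter P φ t p))
      (fun j => (normalized_pos (weightsAfter_pos hb p) j).le)
      (sum_normalized (weightsAfter_pos hb p)) hs
    rw [abs_le] at this
    exact ⟨this.1, this.2.trans (le_of_eq (by ring))⟩
  -- Excesses lie in an interval of length `4 λ`, so a deviation of `4 R` has exponent `16 λ² T ℓ /
  -- (8 T λ²) = 2 ℓ`.
  have hazuma := measure_prefixSum_ge_le D hmeas (by positivity) hbound
    (by exact_mod_cast hT0) (r := 4 * R) (by positivity)
  have e : (4 * R) ^ 2 / (2 * T * (2 * P.lam) ^ 2) = 2 * ℓ := by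
    rw [mul_pow, hR2]
    field_simp
    norm_num
  rw [e] at hazuma
  refine (measure_mono_ae ?_).trans hazuma
  filter_upwards [h.ae_pi_bounded T] with x hx hbad
  by_contra hcon
  refine hbad ?_
  -- If all risks exceed `ε / 2`, then `T ε / 2` is at most the deviation plus the observed excess,
  -- which is below `4 R + 6 R ≤ (10/32) ε T`: a contradiction.
  by_contra hno
  push Not at hno
  have h1 := mul_le_prefixSum_of_forall_visited fun u hu => (hno u hu).le
  have h2 : prefixSum (fun t p _ => featRisk P.act φ (P.lam • q) D
      (predictor P (weightsAfter P φ t p))) T x ≤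
      prefixSum (fun t p ω => ((∫ ω', g t p ω' ∂D) - g t p ω) + g t p ω) T x := by
    refine prefixSum_mono hx fun t p ω _ => ?_
    rw [sub_add_cancel]
    exact h.featRisk_le_integral_excess hmono hlip hact _
  rw [prefixSum_add] at h2
  have h3 := prefixSum_excess_le hact hlam.le hn hT4 hbeta hx hq0 hq
  have h4 : Real.sqrt (T * Real.log n) ≤ Real.sqrt (T * ℓ) :=
    Real.sqrt_le_sqrt (mul_le_mul_of_nonneg_left hℓn hT0.le)
  have h5 : prefixSum g T x ≤ 6 * R := by
    refine h3.trans ?_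
    rw [hR, ← mul_assoc]
    gcongr
  have h6 : prefixSum (fun t p ω => (∫ ω', g t p ω' ∂D) - g t p ω) T x < 4 * R := not_le.1 hcon
  have h7 : 0 < P.eps * T := by positivity
  linarith

theorem empRisk_eq (act : ℝ → ℝ) (φ : (Fin N → ℝ) → Fin n → ℝ) (test : Fin M → Example N)
    (u : Fin n → ℝ) : empRisk act φ test u = (∑ m, sqLoss act φ u (test m)) / M := rfl

theorem measurable_empRisk {α : Type*} [MeasurableSpace α] {act : ℝ → ℝ} {u : α → Fin n → ℝ}
    (hu : Measurable fun z : α × Example N => sqLoss act φ (u z.1) z.2) :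
    Measurable fun z : α × (Fin M → Example N) => empRisk act φ z.2 (u z.1) := by
  have h1 : ∀ m, Measurable fun z : α × (Fin M → Example N) =>
      sqLoss act φ (u z.1) (z.2 m) := fun m => by
    have hp : Measurable fun z : α × (Fin M → Example N) => (z.1, z.2 m) :=
      measurable_fst.prodMk ((measurable_pi_apply m).comp measurable_snd)
    have := hu.comp hp
    simpa only [Function.comp_def] using this
  have h2 : Measurable fun z : α × (Fin M → Example N) => ∑ m, sqLoss act φ (u z.1) (z.2 m) :=
    Finset.measurable_fun_sum _ fun m _ => h1 m
  simp only [empRisk_eq]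
  exact h2.div_const _

/-- The quantifier over candidates is a finite union over the rounds, each candidate being a
function of a prefix of the training set. -/
theorem measurableSet_exists_visited {α : Type*} [MeasurableSpace α]
    {Q : (Fin n → ℝ) → α → Prop}
    (hQ : ∀ t, MeasurableSet {z : (Fin t → Example N) × α |
      Q (predictor P (weightsAfter P φ t z.1)) z.2}) (T : ℕ) :
    MeasurableSet {z : (Fin T → Example N) × α | ∃ u ∈ visited P φ T z.1, Q u z.2} := by
  induction T with
  | zero => simp [visited]
  | succ T ih =>
    have hm : Measurable fun z : (Fin (T + 1) → Example N) × α =>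
        ((Fin.init z.1 : Fin T → Example N), z.2) :=
      (measurable_init.comp measurable_fst).prodMk measurable_snd
    convert (hm (hQ T)).union (hm ih) using 1
    ext z
    simp [visited]

theorem measure_exists_visited_le {α : Type*} [MeasurableSpace α] (μ : Measure α)
    {Q : (Fin n → ℝ) → α → Prop} {x : ℝ≥0∞} (hx : ∀ u, μ {a | Q u a} ≤ x) {T : ℕ}
    (train : Fin T → Example N) : μ {a | ∃ u ∈ visited P φ T train, Q u a} ≤ T * x := by
  induction T with
  | zero => simp [visited]
  | succ T ih =>
    refine (measure_mono (t := {a | Q (predictor P (weightsAfter P φ T (Fin.init train))) a} ∪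
      {a | ∃ u ∈ visited P φ T (Fin.init train), Q u a}) ?_).trans
      ((measure_union_le _ _).trans ((add_le_add (hx _) (ih (Fin.init train))).trans_eq ?_))
    · rintro a ⟨u, rfl | hu, ha⟩
      · exact Or.inl ha
      · exact Or.inr ⟨u, hu, ha⟩
    · push_cast
      ring

/-- With high probability, the empirical risks of all candidates are close to their means. -/
theorem measure_exists_bad_estimate_le {act : ℝ → ℝ} {w : Fin n → ℝ}
    (h : FeatureModel act φ w D) (hP : P.act = act) (hact : Measurable act)
    (hact01 : ∀ z, act z ∈ Set.Icc (0 : ℝ) 1) (hM : 0 < M) {τ : ℝ} (hτ : 0 ≤ τ) (T : ℕ) :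
    ((Measure.pi fun _ : Fin T => D).prod (Measure.pi fun _ : Fin M => D))
      {s | ∃ u ∈ visited P φ T s.1, τ ≤ |empRisk act φ s.2 u - ∫ s, sqLoss act φ u s ∂D|} ≤
      T * (2 * ENNReal.ofReal (Real.exp (-(2 * M * τ ^ 2)))) := by
  have := h.isProbabilityMeasure
  have hmeas : MeasurableSet {s : (Fin T → Example N) × (Fin M → Example N) |
      ∃ u ∈ visited P φ T s.1, τ ≤ |empRisk act φ s.2 u - ∫ s, sqLoss act φ u s ∂D|} := by
    refine measurableSet_exists_visited (Q := fun u (y : Fin M → Example N) =>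
      τ ≤ |empRisk act φ y u - ∫ s, sqLoss act φ u s ∂D|) (fun t => ?_) T
    have m1 := measurable_predictor_dotProduct P h.measurable_features
      (measurable_weightsAfter P (hP ▸ hact) h.measurable_features t)
    have m2 : Measurable fun z : (Fin t → Example N) × Example N =>
        sqLoss act φ (predictor P (weightsAfter P φ t z.1)) z.2 :=
      ((hact.comp m1).sub (measurable_snd.comp measurable_snd)).pow_const 2
    have m3 := (m2.stronglyMeasurable.integral_prod_right' (ν := D)).measurable
    have m4 : Measurable fun z : (Fin t → Example N) × (Fin M → Example N) =>
        empRisk act φ z.2 (predictor P (weightsAfter P φ t z.1)) :=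
      measurable_empRisk (u := fun x => predictor P (weightsAfter P φ t x)) m2
    have m5 : Measurable fun z : (Fin t → Example N) × (Fin M → Example N) =>
        ∫ s, sqLoss act φ (predictor P (weightsAfter P φ t z.1)) s ∂D := by
      have hf : Measurable fun z : (Fin t → Example N) × (Fin M → Example N) => z.1 :=
        measurable_fst
      have := m3.comp hf
      simpa only [Function.comp_def] using this
    have m6 := measurable_abs.comp (m4.sub m5)
    simp only [Function.comp_def, Pi.sub_apply] at m6
    exact measurableSet_le measurable_const m6
  have hsigma : SigmaFinite (Measure.pi fun _ : Fin M => D) := inferInstance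
  have hsf : SFinite (Measure.pi fun _ : Fin M => D) := instSFiniteOfSigmaFinite
  rw [Measure.prod_apply hmeas]
  -- With the first training set fixed, the candidates are fixed vectors, so Hoeffding over the
  -- second set applies to each of them.
  calc _ ≤ ∫⁻ _, T * (2 * ENNReal.ofReal (Real.exp (-(2 * M * τ ^ 2))))
        ∂(Measure.pi fun _ : Fin T => D) := by
        refine lintegral_mono fun train => ?_
        refine measure_exists_visited_le (Measure.pi fun _ : Fin M => D)
          (Q := fun u (y : Fin M → Example N) =>
            τ ≤ |empRisk act φ y u - ∫ s, sqLoss act φ u s ∂D|) (fun u => ?_) train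
        refine measure_abs_sum_div_sub_integral_ge_le D (f := sqLoss act φ u) ?_ ?_ hM hτ
        · exact ((hact.comp ((measurable_dotProduct h.measurable_features u).comp
            measurable_fst)).sub measurable_snd).pow_const 2
        · filter_upwards [h.ae_bounded] with s hs
          have h1 := hact01 (u ⬝ᵥ φ s.1)
          refine ⟨sq_nonneg _, ?_⟩
          rw [sqLoss, sq_le_one_iff_abs_le_one, abs_le]
          constructor <;> linarith [h1.1, h1.2, hs.2.1, hs.2.2]
    _ = _ := by simp

end Events

/-! ### The learning guarantee -/

section Guarantee

variable {N n M : ℕ} {φ : (Fin N → ℝ) → Fin n → ℝ} {D : Measure (Example N)}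

/-- If the empirical risks are accurate and some candidate is good, then so is the output. -/
theorem failProb_learn_featRisk_le [NeZero n] {access : (Fin N → ℝ) → Fin n → RAM ℝ} {a : ℕ}
    (hacc : ∀ x, Reads (access x) a (φ x)) {P : Params} {w : Fin n → ℝ}
    (h : FeatureModel P.act φ w D) (hlip : LipschitzWith 1 P.act)
    (hact : ∀ z, P.act z ∈ Set.Icc (0 : ℝ) 1) (hbeta : 0 < P.beta) (hlam : 0 < P.lam)
    (heps : 0 < P.eps) {T : ℕ} (hT : 0 < T) (hM : 0 < M) (hK : 0 < numReps P T M)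
    {train : Fin T → Example N} {test : Fin M → Example N} (htest : ∀ m, test m ∈ bounded φ)
    (hgood : ∃ u ∈ visited P φ T train, featRisk P.act φ w D u ≤ P.eps / 2)
    (hest : ¬ ∃ u ∈ visited P φ T train,
      P.eps / 16 ≤ |empRisk P.act φ test u - ∫ s, sqLoss P.act φ u s ∂D|) :
    failProb (learn access P train test) (fun u => featRisk P.act φ w D u ≤ P.eps) ≤
      T * (M * ENNReal.ofReal (Real.exp (-(numReps P T M / 6)))) := by
  refine le_trans (failProb_mono ?_) (failProb_learn_le hacc hT (emp := empRisk P.act φ test)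
    (τ := P.eps / 8) fun t x => failProb_approxRisk_le hacc hlip hact hlam heps hM hK htest
      (normalized_pos (weightsAfter_pos hbeta x)) (sum_normalized (weightsAfter_pos hbeta x)))
  rintro u ⟨hu, hmin⟩
  obtain ⟨v, hv, hrisk⟩ := hgood
  push Not at hest
  have h1 := abs_lt.1 (hest u hu)
  have h2 := abs_lt.1 (hest v hv)
  have h3 := hmin v hv
  -- The loss of `w` is common to both candidates and cancels; the remaining budget is `ε/2 + 2 ε/8
  -- + 2 ε/16 = 7 ε/8`.
  rw [h.integral_sqLoss hlip.continuous.measurable hact] at h1 h2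
  linarith [h1.1, h2.2]

theorem numReps_pos {P : Params} {T : ℕ} (hT : 0 < T) (hM : 0 < M) (hdelta : 0 < P.delta)
    (hdelta1 : P.delta < 1) : 0 < numReps P T M := by
  have hT' : (1 : ℝ) ≤ T := by exact_mod_cast hT
  have hM' : (1 : ℝ) ≤ M := by exact_mod_cast hM
  refine Nat.ceil_pos.2 (mul_pos (by norm_num) (Real.log_pos ?_))
  rw [lt_div_iff₀ hdelta]
  nlinarith

/-- The number of means makes one estimate fail with probability at most `δ' / (M T)`, and there are
`M T` estimates. -/
theorem mul_exp_numReps_le {P : Params} {T : ℕ} (hT : 0 < T) (hM : 0 < M) (hdelta : 0 < P.delta) :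
    (T : ℝ≥0∞) * (M * ENNReal.ofReal (Real.exp (-(numReps P T M / 6)))) ≤
      ENNReal.ofReal P.delta := by
  have hT' : (0 : ℝ) < T := by exact_mod_cast hT
  have hM' : (0 : ℝ) < M := by exact_mod_cast hM
  have h1 : 6 * Real.log (M * T / P.delta) ≤ numReps P T M := Nat.le_ceil _
  have h2 : Real.exp (-(numReps P T M / 6)) ≤ P.delta / (M * T) := by
    rw [← inv_div (M * T : ℝ), ← Real.exp_log (show 0 < M * T / P.delta by positivity),
      ← Real.exp_neg, Real.exp_le_exp]
    linarith
  rw [← ENNReal.ofReal_natCast T, ← ENNReal.ofReal_natCast M, ← ENNReal.ofReal_mul hM'.le,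
    ← ENNReal.ofReal_mul hT'.le]
  refine ENNReal.ofReal_le_ofReal ?_
  calc (T : ℝ) * (M * Real.exp (-(numReps P T M / 6))) ≤ T * (M * (P.delta / (M * T))) := by gcongr
    _ = P.delta := by field_simp

theorem featRisk_le_of_abs_sub_le {act : ℝ → ℝ} {w u : Fin n → ℝ} (h : FeatureModel act φ w D)
    (hlip : LipschitzWith 1 act) {c : ℝ}
    (hu : ∀ s ∈ bounded φ, |u ⬝ᵥ φ s.1 - w ⬝ᵥ φ s.1| ≤ c) :
    featRisk act φ w D u ≤ c ^ 2 := by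
  have := h.isProbabilityMeasure
  refine (le_abs_self _).trans ?_
  have h1 := norm_integral_le_of_norm_le_const (μ := D) (C := c ^ 2)
    (f := fun s : Example N => (act (u ⬝ᵥ φ s.1) - act (w ⬝ᵥ φ s.1)) ^ 2) (by
      filter_upwards [h.ae_bounded] with s hs
      rw [Real.norm_eq_abs, abs_pow]
      refine pow_le_pow_left₀ (abs_nonneg _) (le_trans ?_ (hu s hs)) 2
      simpa [Real.dist_eq] using hlip.dist_le_mul (u ⬝ᵥ φ s.1) (w ⬝ᵥ φ s.1))
  simpa [featRisk] using h1

/-- The main case. Outside a null set, the samples can be bad in two ways: no good candidate, or an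
inaccurate empirical risk. Each has probability at most `δ / 3`, and the last third is left to the
internal randomness. -/
theorem measure_not_failProb_learn_le_of_lt [NeZero n] {access : (Fin N → ℝ) → Fin n → RAM ℝ}
    {a : ℕ} (hacc : ∀ x, Reads (access x) a (φ x)) {act : ℝ → ℝ} {lam eps delta : ℝ}
    {q : Fin n → ℝ} (h : FeatureModel act φ (lam • q) D) (hmono : Monotone act)
    (hlip : LipschitzWith 1 act) (hact : ∀ z, act z ∈ Set.Icc (0 : ℝ) 1)
    (hq0 : ∀ j, 0 ≤ q j) (hq : ∑ j, q j = 1) (hn : 2 ≤ n) (heps : 0 < eps) (heps1 : eps < 1)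
    (hlam : eps / 2 < lam) (hdelta : 0 < delta) (hdelta1 : delta < 1) {T : ℕ}
    (hS : SampleSizes 1024 n lam eps delta T M) :
    ((Measure.pi fun _ : Fin T => D).prod (Measure.pi fun _ : Fin M => D))
      {s | ¬ failProb (learn access (parameters act lam eps delta n T) s.1 s.2)
        (fun u => featRisk act φ (lam • q) D u ≤ eps) ≤ ENNReal.ofReal (delta / 3)} ≤
      ENNReal.ofReal (2 * delta / 3) := by
  obtain ⟨hTn, hTl, hMl⟩ := hS
  have := h.isProbabilityMeasure
  have hpiM : IsProbabilityMeasure (Measure.pi fun _ : Fin M => D) := inferInstance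
  have hpiT : IsProbabilityMeasure (Measure.pi fun _ : Fin T => D) := inferInstance
  have hn' : (2 : ℝ) ≤ n := by exact_mod_cast hn
  have hde : 0 < delta * eps := by positivity
  have hde1 : delta * eps < 1 := by nlinarith
  have hlam0 : 0 < lam := by linarith
  set ℓ := Real.log (n / (delta * eps)) with hℓ
  have hℓn : Real.log n ≤ ℓ := by
    refine Real.log_le_log (by linarith) ?_
    rw [le_div_iff₀ hde]
    nlinarith
  have hlog2 : (1 : ℝ) / 2 < Real.log 2 := by linarith [Real.log_two_gt_d9]
  have hlogn : Real.log 2 ≤ Real.log n := Real.log_le_log (by norm_num) hn'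
  -- Here `λ > ε / 2` is needed: it gives `1024 λ ^ 2 / ε ^ 2 ≥ 256`, hence a bound for `T` free of
  -- `λ`, and in particular `4 log n ≤ T`.
  have hT256 : 256 * ℓ ≤ T := by
    refine le_trans ?_ hTl
    rw [le_div_iff₀ (by positivity)]
    have : eps ^ 2 ≤ 4 * lam ^ 2 := by nlinarith
    nlinarith
  have hT6 : (6 : ℝ) ≤ T := by linarith
  have hT0 : 0 < T := by
    have : (0 : ℝ) < T := by linarith
    exact_mod_cast this
  have hLpos : 0 < Real.log (T / delta) := by
    refine Real.log_pos ?_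
    rw [lt_div_iff₀ hdelta]
    linarith
  have hM0' : (0 : ℝ) < M := lt_of_lt_of_le (by positivity) hMl
  have hM0 : 0 < M := by exact_mod_cast hM0'
  have hbeta : 0 < (parameters act lam eps delta n T).beta := by
    change 0 < 1 - Real.sqrt (Real.log n / T)
    rw [sub_pos, Real.sqrt_lt' one_pos, div_lt_iff₀ (by linarith)]
    linarith
  set P := parameters act lam eps delta n T with hP
  have hA := measure_not_exists_good_le (P := P) (D := D) (φ := φ) h hmono hlip hact hq0 hq hn
    hlam0 heps (by linarith) rfl hℓn hTl
  have hB := measure_exists_bad_estimate_le (P := P) (M := M) h rfl hlip.continuous.measurable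
    hact hM0 (τ := eps / 16) (by positivity) T
  have hA' : Real.exp (-(2 * ℓ)) ≤ delta / 3 := by
    have e1 : Real.exp (-(2 * ℓ)) = (delta * eps / n) ^ 2 := by
      rw [show -(2 * ℓ) = -ℓ + -ℓ by ring, Real.exp_add, Real.exp_neg, hℓ,
        Real.exp_log (by positivity), inv_div]
      ring
    have e2 : delta * eps / n ≤ delta / 2 := by
      gcongr
      nlinarith
    rw [e1]
    calc _ ≤ (delta / 2) ^ 2 := by gcongr
      _ ≤ _ := by nlinarith
  have hB' : (T : ℝ≥0∞) * (2 * ENNReal.ofReal (Real.exp (-(2 * M * (eps / 16) ^ 2)))) ≤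
      ENNReal.ofReal (delta / 3) := by
    have e1 : Real.exp (-(2 * M * (eps / 16) ^ 2)) ≤ (delta / T) ^ 2 := by
      rw [show (delta / T) ^ 2 = Real.exp (-(2 * Real.log (T / delta))) by
        rw [show -(2 * Real.log (T / delta)) = -Real.log (T / delta) + -Real.log (T / delta) by
          ring, Real.exp_add, Real.exp_neg, Real.exp_log (by positivity), inv_div]
        ring, Real.exp_le_exp]
      rw [div_le_iff₀ (by positivity)] at hMl
      nlinarith
    rw [← ENNReal.ofReal_natCast T, ← ENNReal.ofReal_ofNat 2, ← ENNReal.ofReal_mul (by norm_num),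
      ← ENNReal.ofReal_mul (by linarith)]
    refine ENNReal.ofReal_le_ofReal ?_
    calc (T : ℝ) * (2 * Real.exp (-(2 * M * (eps / 16) ^ 2))) ≤ T * (2 * (delta / T) ^ 2) := by
          gcongr
      _ = 2 * delta ^ 2 / T := by field_simp
      _ ≤ 2 * delta ^ 2 / 6 := by gcongr
      _ ≤ delta / 3 := by nlinarith
  have hnull : ((Measure.pi fun _ : Fin T => D).prod (Measure.pi fun _ : Fin M => D))
      (Prod.snd ⁻¹' {y | ¬ ∀ i, y i ∈ bounded φ}) = 0 :=
    Measure.quasiMeasurePreserving_snd.preimage_null (h.ae_pi_bounded M)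
  have hfst : ((Measure.pi fun _ : Fin T => D).prod (Measure.pi fun _ : Fin M => D))
      (Prod.fst ⁻¹' {x | ¬ ∃ u ∈ visited P φ T x, featRisk act φ (lam • q) D u ≤ eps / 2}) ≤
      ENNReal.ofReal (delta / 3) := by
    have hsigma : SigmaFinite (Measure.pi fun _ : Fin M => D) := inferInstance
    have hsf : SFinite (Measure.pi fun _ : Fin M => D) := instSFiniteOfSigmaFinite
    rw [← Set.prod_univ, Measure.prod_prod, measure_univ, mul_one]
    exact hA.trans (ENNReal.ofReal_le_ofReal hA')
  refine (measure_mono (t := (Prod.snd ⁻¹' {y | ¬ ∀ i, y i ∈ bounded φ}) ∪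
    ((Prod.fst ⁻¹' {x | ¬ ∃ u ∈ visited P φ T x, featRisk act φ (lam • q) D u ≤ eps / 2}) ∪
    {s | ∃ u ∈ visited P φ T s.1,
      eps / 16 ≤ |empRisk act φ s.2 u - ∫ s, sqLoss act φ u s ∂D|})) ?_).trans
    ((measure_union_le _ _).trans ?_)
  · intro s hs
    by_contra hcon
    simp only [Set.mem_union, not_or, Set.mem_preimage, Set.mem_ofPred_eq, not_not] at hcon
    refine hs ((failProb_learn_featRisk_le (P := P) hacc h hlip hact hbeta hlam0 heps hT0 hM0
      (numReps_pos hT0 hM0 ?_ ?_) hcon.1 hcon.2.1 hcon.2.2).trans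
      (mul_exp_numReps_le hT0 hM0 ?_))
    · change 0 < delta / 3
      positivity
    · change delta / 3 < 1
      linarith
    · change 0 < delta / 3
      positivity
  · rw [hnull, zero_add]
    refine (measure_union_le _ _).trans ((add_le_add hfst (hB.trans hB')).trans_eq ?_)
    rw [← ENNReal.ofReal_add (by positivity) (by positivity)]
    congr 1
    ring

/-- Adds the degenerate cases, where every candidate has risk at most `ε`. For `n = 1` the only
candidate is `w`. For `λ ≤ ε / 2` linear forms of norm `λ` differ by at most `ε` on bounded
features, so the risk is at most `ε ^ 2`. -/
theorem measure_not_failProb_learn_le [NeZero n] {access : (Fin N → ℝ) → Fin n → RAM ℝ}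
    {a : ℕ} (hacc : ∀ x, Reads (access x) a (φ x)) {act : ℝ → ℝ} {lam eps delta : ℝ}
    {w : Fin n → ℝ} (h : FeatureModel act φ w D) (hmono : Monotone act)
    (hlip : LipschitzWith 1 act) (hact : ∀ z, act z ∈ Set.Icc (0 : ℝ) 1)
    (hw0 : ∀ j, 0 ≤ w j) (hw : ∑ j, w j = lam) (heps : 0 < eps) (heps1 : eps < 1)
    (hdelta : 0 < delta) (hdelta1 : delta < 1) {T : ℕ}
    (hS : SampleSizes 1024 n lam eps delta T M) :
    ((Measure.pi fun _ : Fin T => D).prod (Measure.pi fun _ : Fin M => D))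
      {s | ¬ failProb (learn access (parameters act lam eps delta n T) s.1 s.2)
        (fun u => featRisk act φ w D u ≤ eps) ≤ ENNReal.ofReal (delta / 3)} ≤
      ENNReal.ofReal (2 * delta / 3) := by
  have hn1 : 1 ≤ n := Nat.pos_of_neZero n
  have hT0' : (0 : ℝ) < T := lt_of_le_of_lt (Real.log_natCast_nonneg n) hS.1
  have hT0 : 0 < T := by exact_mod_cast hT0'
  have hlam0 : 0 ≤ lam := hw ▸ Finset.sum_nonneg fun j _ => hw0 j
  have hbeta : 0 < (parameters act lam eps delta n T).beta := by
    change 0 < 1 - Real.sqrt (Real.log n / T)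
    rw [sub_pos, Real.sqrt_lt' one_pos, div_lt_iff₀ hT0']
    linarith [hS.1]
  have hall : (∀ p : Fin n → ℝ, (∀ j, 0 ≤ p j) → ∑ j, p j = 1 →
      featRisk act φ w D (lam • p) ≤ eps) →
      ((Measure.pi fun _ : Fin T => D).prod (Measure.pi fun _ : Fin M => D))
      {s | ¬ failProb (learn access (parameters act lam eps delta n T) s.1 s.2)
        (fun u => featRisk act φ w D u ≤ eps) ≤ ENNReal.ofReal (delta / 3)} ≤
      ENNReal.ofReal (2 * delta / 3) := by
    intro H
    refine (measure_mono_null (t := ∅) ?_ measure_empty).trans_le zero_le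
    refine Set.subset_empty_iff.2 ?_
    refine Set.eq_empty_of_forall_notMem fun s hs => hs ?_
    rw [((ensures_learn hacc (parameters act lam eps delta n T) hT0 s.1 s.2
      (Nat.le_pow_clog one_lt_two n)).mono le_rfl ?_).failProb_eq_zero]
    · exact zero_le
    · intro u hu
      obtain ⟨p, hp0, hp, rfl⟩ := exists_of_mem_visited hbeta hu
      exact H p hp0 hp
  rcases hn1.eq_or_lt with rfl | hn
  · refine hall fun p hp0 hp => ?_
    have e : lam • p = w := by
      funext j
      rw [Fin.sum_univ_one] at hp hw
      rw [Subsingleton.elim j 0, Pi.smul_apply, hp, smul_eq_mul, mul_one, hw]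
    rw [e, featRisk]
    simpa using heps.le
  · rcases le_or_gt lam (eps / 2) with hle | hlt
    · refine hall fun p hp0 hp => ?_
      refine (featRisk_le_of_abs_sub_le h hlip (c := eps) fun s hs => ?_).trans (by nlinarith)
      have h1 := abs_smul_dotProduct_le hlam0 hp0 hp hs.1
      have h2 := abs_dotProduct_le (u := w) hs.1
      simp only [abs_of_nonneg (hw0 _), hw] at h2
      exact (abs_sub _ _).trans (by linarith)
    · have hlam : 0 < lam := by linarith
      have e : w = lam • fun j => w j / lam := by
        funext j
        rw [Pi.smul_apply, smul_eq_mul, mul_div_cancel₀ _ hlam.ne']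
      rw [e] at h ⊢
      exact measure_not_failProb_learn_le_of_lt hacc h hmono hlip hact
        (fun j => div_nonneg (hw0 j) hlam.le)
        (by rw [← Finset.sum_div, hw, div_self hlam.ne']) hn heps heps1 hlt hdelta hdelta1 hS

/-- A bound for the success probability in terms of the failure probability given the samples. -/
theorem le_successProb {D : Measure (Example N)} [IsProbabilityMeasure D] {T : ℕ}
    {alg : (Fin T → Example N) → (Fin M → Example N) → RAM (Fin N → ℝ)} {good : Set (Fin N → ℝ)}
    {delta : ℝ} (hdelta : 0 < delta) (hdelta1 : delta < 1)
    (h : ((Measure.pi fun _ : Fin T => D).prod (Measure.pi fun _ : Fin M => D))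
      {s | ¬ failProb (alg s.1 s.2) (fun v => v ∈ good) ≤ ENNReal.ofReal (delta / 3)} ≤
      ENNReal.ofReal (2 * delta / 3)) :
    ENNReal.ofReal (1 - delta) ≤ successProb D T M alg good := by
  have hpiM : IsProbabilityMeasure (Measure.pi fun _ : Fin M => D) := inferInstance
  have hpiT : IsProbabilityMeasure (Measure.pi fun _ : Fin T => D) := inferInstance
  unfold successProb
  set μ := (Measure.pi fun _ : Fin T => D).prod (Measure.pi fun _ : Fin M => D) with hμ
  have hprob : IsProbabilityMeasure μ := inferInstance
  set B := {s : (Fin T → Example N) × (Fin M → Example N) |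
    ¬ failProb (alg s.1 s.2) (fun v => v ∈ good) ≤ ENNReal.ofReal (delta / 3)} with hB
  -- Measurability of `B` is not established, so it is replaced by a measurable superset of the same
  -- measure before integrating over the complement.
  have hms : MeasurableSet (toMeasurable μ B)ᶜ := (measurableSet_toMeasurable μ B).compl
  calc ENNReal.ofReal (1 - delta)
      ≤ ENNReal.ofReal ((1 - delta / 3) * (1 - 2 * delta / 3)) :=
        ENNReal.ofReal_le_ofReal (by nlinarith)
    _ = (1 - ENNReal.ofReal (delta / 3)) * (1 - ENNReal.ofReal (2 * delta / 3)) := by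
        rw [ENNReal.ofReal_mul (by linarith), ENNReal.ofReal_sub _ (by positivity),
          ENNReal.ofReal_sub _ (by positivity), ENNReal.ofReal_one]
    _ ≤ (1 - ENNReal.ofReal (delta / 3)) * μ (toMeasurable μ B)ᶜ := by
        rw [prob_compl_eq_one_sub (measurableSet_toMeasurable μ B), measure_toMeasurable]
        gcongr
    _ = ∫⁻ _ in (toMeasurable μ B)ᶜ, (1 - ENNReal.ofReal (delta / 3)) ∂μ := by
        rw [setLIntegral_const]
    _ ≤ ∫⁻ s in (toMeasurable μ B)ᶜ, (alg s.1 s.2).law.toOuterMeasure {r | r.1 ∈ good} ∂μ := by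
        refine setLIntegral_mono' hms fun s hs => ?_
        have hs' : failProb (alg s.1 s.2) (fun v => v ∈ good) ≤ ENNReal.ofReal (delta / 3) := by
          by_contra hcon
          exact hs (subset_toMeasurable μ B hcon)
        exact (tsub_le_tsub_left hs' 1).trans (one_sub_failProb_le _ _)
    _ ≤ _ := setLIntegral_le_lintegral _ _

theorem le_successProb_sparsitron [NeZero N] {act : ℝ → ℝ} {w : Fin N → ℝ} (h : IsGLM act w D)
    (hmono : Monotone act) (hlip : LipschitzWith 1 act) (hact : ∀ z, act z ∈ Set.Icc (0 : ℝ) 1)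
    {lam eps delta : ℝ} (hw0 : ∀ j, 0 ≤ w j) (hw : ∑ j, |w j| = lam) (heps : 0 < eps)
    (heps1 : eps < 1) (hdelta : 0 < delta) (hdelta1 : delta < 1) {T : ℕ}
    (hS : SampleSizes 1024 N lam eps delta T M) :
    ENNReal.ofReal (1 - delta) ≤ successProb D T M (sparsitron (parameters act lam eps delta N T))
      {v | risk act w D v ≤ eps} := by
  have := h.isProbabilityMeasure
  have hmodel : FeatureModel act (fun x : Fin N → ℝ => x) w D := by
    refine ⟨h.isProbabilityMeasure, fun j => measurable_pi_apply j, ?_, h.condExp_eq⟩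
    filter_upwards [h.features_mem, h.label_mem] with s h1 h2
    exact ⟨fun j => abs_le.2 (h1 j), by rcases h2 with h2 | h2 <;> simp [h2]⟩
  simp only [abs_of_nonneg (hw0 _)] at hw
  exact le_successProb hdelta hdelta1 (measure_not_failProb_learn_le reads_plainAccess hmodel hmono
    hlip hact hw0 hw heps heps1 hdelta hdelta1 hS)

/-! ### Reduction of arbitrary signs to nonnegative weights. -/

theorem sum_signed (f : Fin (2 * N + 1) → ℝ) :
    ∑ j, f j = ∑ j : Fin N, (f ⟨j.val, by omega⟩ + f ⟨N + j.val, by omega⟩) +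
      f ⟨2 * N, by omega⟩ := by
  have e : N + N + 1 = 2 * N + 1 := by omega
  rw [← (finCongr e).sum_comp, Fin.sum_univ_castSucc, Fin.sum_univ_add, Finset.sum_add_distrib]
  congr 2
  simp only [finCongr_apply]
  ext
  simp

theorem dotProduct_signedFeatures (u : Fin (2 * N + 1) → ℝ) (x : Fin N → ℝ) :
    u ⬝ᵥ signedFeatures x = unsigned u ⬝ᵥ x := by
  rw [dotProduct, sum_signed, dotProduct]
  have h1 : signedFeatures x ⟨2 * N, by omega⟩ = 0 := by
    unfold signedFeatures
    rw [dif_neg (by simp; omega), dif_neg (by simp)]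
  rw [h1, mul_zero, add_zero]
  refine Finset.sum_congr rfl fun j _ => ?_
  have h2 : signedFeatures x ⟨j.val, by omega⟩ = x j := by
    unfold signedFeatures
    rw [dif_pos j.isLt]
  have h3 : signedFeatures x ⟨N + j.val, by omega⟩ = -x j := by
    unfold signedFeatures
    rw [dif_neg (by simp), dif_pos (by simp; omega)]
    simp
  rw [h2, h3, unsigned]
  ring

/-- Non-negative coefficients of total weight `lam` on the features `(x, -x, 0)` that represent
the linear form `w`. -/
noncomputable def signedWeights (lam : ℝ) (w : Fin N → ℝ) (j : Fin (2 * N + 1)) : ℝ :=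
  if h : j.val < N then max (w ⟨j.val, h⟩) 0
  else if h' : j.val < 2 * N then max (-w ⟨j.val - N, by omega⟩) 0 else lam - ∑ i, |w i|

theorem signedWeights_left (lam : ℝ) (w : Fin N → ℝ) (j : Fin N) :
    signedWeights lam w ⟨j.val, by omega⟩ = max (w j) 0 := by
  unfold signedWeights
  rw [dif_pos j.isLt]

theorem signedWeights_right (lam : ℝ) (w : Fin N → ℝ) (j : Fin N) :
    signedWeights lam w ⟨N + j.val, by omega⟩ = max (-w j) 0 := by
  unfold signedWeights
  rw [dif_neg (by simp), dif_pos (by simp; omega)]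
  simp

theorem signedWeights_nonneg {lam : ℝ} {w : Fin N → ℝ} (hw : ∑ j, |w j| ≤ lam)
    (j : Fin (2 * N + 1)) : 0 ≤ signedWeights lam w j := by
  unfold signedWeights
  split_ifs
  · exact le_max_right _ _
  · exact le_max_right _ _
  · linarith

/-- Positive and negative parts add up to `|w j|`, and the coordinate of the zero feature takes the
slack. This turns `‖w‖₁ ≤ λ` into the equality needed for nonnegative weights. -/
theorem sum_signedWeights (lam : ℝ) (w : Fin N → ℝ) : ∑ j, signedWeights lam w j = lam := by
  have h1 : signedWeights lam w ⟨2 * N, by omega⟩ = lam - ∑ i, |w i| := by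
    unfold signedWeights
    rw [dif_neg (by simp; omega), dif_neg (by simp)]
  rw [sum_signed, h1]
  simp only [signedWeights_left, signedWeights_right]
  have h2 : ∀ j, max (w j) 0 + max (-w j) 0 = |w j| := fun j => by
    rcases le_total 0 (w j) with h | h
    · rw [max_eq_left h, max_eq_right (by linarith), abs_of_nonneg h, add_zero]
    · rw [max_eq_right h, max_eq_left (by linarith), abs_of_nonpos h, zero_add]
  simp only [h2]
  ring

theorem unsigned_signedWeights (lam : ℝ) (w : Fin N → ℝ) :
    unsigned (signedWeights lam w) = w := by
  funext j
  rw [unsigned, signedWeights_left, signedWeights_right]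
  rcases le_total 0 (w j) with h | h
  · rw [max_eq_left h, max_eq_right (by linarith), sub_zero]
  · rw [max_eq_right h, max_eq_left (by linarith)]
    ring

theorem IsGLM.featureModel_signed {act : ℝ → ℝ} {w : Fin N → ℝ} (h : IsGLM act w D) (lam : ℝ) :
    FeatureModel act signedFeatures (signedWeights lam w) D := by
  refine ⟨h.isProbabilityMeasure, fun j => ?_, ?_, ?_⟩
  · unfold signedFeatures
    split_ifs
    · exact measurable_pi_apply _
    · exact (measurable_pi_apply _).neg
    · exact measurable_const
  · filter_upwards [h.features_mem, h.label_mem] with s h1 h2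
    refine ⟨fun j => ?_, by rcases h2 with h2 | h2 <;> simp [h2]⟩
    unfold signedFeatures
    split_ifs
    · exact abs_le.2 (h1 _)
    · rw [abs_neg]
      exact abs_le.2 (h1 _)
    · simp
  · simp only [dotProduct_signedFeatures, unsigned_signedWeights]
    exact h.condExp_eq

theorem le_successProb_sparsitronSigned {act : ℝ → ℝ} {w : Fin N → ℝ}
    (h : IsGLM act w D) (hmono : Monotone act) (hlip : LipschitzWith 1 act)
    (hact : ∀ z, act z ∈ Set.Icc (0 : ℝ) 1) {lam eps delta : ℝ} (hw : ∑ j, |w j| ≤ lam)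
    (heps : 0 < eps) (heps1 : eps < 1) (hdelta : 0 < delta) (hdelta1 : delta < 1) {T : ℕ}
    (hS : SampleSizes 1024 (2 * N + 1) lam eps delta T M) :
    ENNReal.ofReal (1 - delta) ≤
      successProb D T M (sparsitronSigned (parameters act lam eps delta (2 * N + 1) T))
        {v | risk act w D v ≤ eps} := by
  have := h.isProbabilityMeasure
  have hmain := measure_not_failProb_learn_le (M := M) reads_signedAccess
    (h.featureModel_signed lam) hmono hlip hact (signedWeights_nonneg hw)
    (sum_signedWeights lam w) heps heps1 hdelta hdelta1 hS
  refine le_successProb hdelta hdelta1 (le_trans (measure_mono fun s hs => ?_) hmain)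
  intro hcon
  -- The final conversion is deterministic and preserves the linear form, so it adds no failure
  -- probability.
  refine hs (le_trans (failProb_bind_le (x := 0) fun u hu => ?_) ((add_zero _).trans_le hcon))
  rw [((ensures_unsignedLoop u).mono le_rfl ?_).failProb_eq_zero]
  rintro _ rfl
  simp only [featRisk, dotProduct_signedFeatures, unsigned_signedWeights] at hu
  exact hu

end Guarantee

end Sparsitron


theorem mainTheorem5 :
    ∃ (C C' : ℝ) (k : ℕ), 0 < C ∧ 0 < C' ∧
    ∀ (N : ℕ) [NeZero N] (σ : ℝ → ℝ), Monotone σ → LipschitzWith 1 σ →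
      (∀ z, σ z ∈ Set.Icc (0 : ℝ) 1) →
    ∀ (lam eps delta : ℝ), 0 ≤ lam → 0 < eps → eps < 1 → 0 < delta → delta < 1 →
      -- number of samples
      (∃ T M : ℕ, SampleSizes C N lam eps delta T M ∧ SampleSizes C (2 * N + 1) lam eps delta T M ∧
        (T : ℝ) ≤ C' * max 1 lam ^ 2 * Real.log (2 * N / (delta * eps)) / eps ^ 2 ∧
        (M : ℝ) ≤ C' * Real.log (2 * T / delta) / eps ^ 2 ∧
        (T + M : ℝ) ≤ C' * max 1 lam ^ 2 * Real.log (2 * N / (delta * eps)) / eps ^ 2) ∧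
    ∀ (T M : ℕ),
      -- learning guarantee
      (∀ (w : Fin N → ℝ) (D : Measure (Example N)), IsGLM σ w D →
        ((∀ j, 0 ≤ w j) → ∑ j, |w j| = lam → SampleSizes C N lam eps delta T M →
          ENNReal.ofReal (1 - delta) ≤
            successProb D T M (sparsitron (parameters σ lam eps delta N T))
              {v | risk σ w D v ≤ eps}) ∧
        (∑ j, |w j| ≤ lam → SampleSizes C (2 * N + 1) lam eps delta T M →
          ENNReal.ofReal (1 - delta) ≤
            successProb D T M (sparsitronSigned (parameters σ lam eps delta (2 * N + 1) T))
              {v | risk σ w D v ≤ eps})) ∧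
      -- run time
      (1 ≤ T → ∀ (train : Fin T → Example N) (test : Fin M → Example N),
        StepsLE (sparsitron (parameters σ lam eps delta N T) train test)
          (polylog C' k N T M lam eps delta * (T * roundCost N M lam eps delta)) ∧
        StepsLE (sparsitronSigned (parameters σ lam eps delta (2 * N + 1) T) train test)
          (polylog C' k N T M lam eps delta * (T * roundCost N M lam eps delta))) ∧
      -- online operation: the first training set is consumed one example at a time
      (1 ≤ T → ∀ (test : Fin M → Example N),
        (∀ (t : ℕ) (train : Fin (t + 1) → Example N),
          stateAfter plainAccess (parameters σ lam eps delta N T) T test train = (do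
            let s ← stateAfter plainAccess (parameters σ lam eps delta N T) T test
              (Fin.init train)
            RAM.exec .index
            oneRound plainAccess (parameters σ lam eps delta N T) T test (train (Fin.last t)) s) ∧
          stateAfter signedAccess (parameters σ lam eps delta (2 * N + 1) T) T test train = (do
            let s ← stateAfter signedAccess (parameters σ lam eps delta (2 * N + 1) T) T test
              (Fin.init train)
            RAM.exec .index
            oneRound signedAccess (parameters σ lam eps delta (2 * N + 1) T) T test
              (train (Fin.last t)) s)) ∧
        (∀ (ex : Example N) (s : State N),
          StepsLE (oneRound plainAccess (parameters σ lam eps delta N T) T test ex s)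
            (polylog C' k N T M lam eps delta * roundCost N M lam eps delta)) ∧
        (∀ (ex : Example N) (s : State (2 * N + 1)),
          StepsLE (oneRound signedAccess (parameters σ lam eps delta (2 * N + 1) T) T test ex s)
            (polylog C' k N T M lam eps delta * roundCost N M lam eps delta))) := by
  -- `1024` comes from the learning guarantee. `3000000` is the constant `2000000` of a round plus
  -- room for the linear overhead of the whole run, and it exceeds the `30000` needed for the sample
  -- sizes.
  refine ⟨1024, 3000000, 2, by norm_num, by norm_num, ?_⟩
  intro N _ σ hmono hlip hact lam eps delta hlam heps heps1 hdelta hdelta1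
  have hN : 1 ≤ N := Nat.pos_of_neZero N
  refine ⟨exists_sampleSizes hN hlam heps heps1 hdelta hdelta1 (by norm_num), fun T M =>
    ⟨fun w D h => ⟨fun hw0 hw hS => ?_, fun hw hS => ?_⟩, fun hT train test => ⟨?_, ?_⟩,
      fun hT test => ⟨fun t train => ⟨?_, ?_⟩, fun ex s => ?_, fun ex s => ?_⟩⟩⟩
  · exact le_successProb_sparsitron h hmono hlip hact hw0 hw heps heps1 hdelta hdelta1 hS
  · exact le_successProb_sparsitronSigned h hmono hlip hact hw heps heps1 hdelta hdelta1 hS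
  · exact stepsLE_sparsitron hT hlam heps heps1 hdelta hdelta1 le_rfl train test
  · exact stepsLE_sparsitronSigned hT hlam heps heps1 hdelta hdelta1 le_rfl train test
  · exact stateAfter_succ _ _ _ _ _
  · exact stateAfter_succ _ _ _ _ _
  · exact stepsLE_oneRound hN (by omega) hT hlam heps heps1 hdelta hdelta1 le_rfl
      reads_plainAccess test ex s
  · exact stepsLE_oneRound hN le_rfl hT hlam heps heps1 hdelta hdelta1 le_rfl
      reads_signedAccess test ex s
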